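/- **Setting.** A point process on $\mathbb R$ is a random locally finite counting measure; its points are listed in increasing order as $\dots\le T_{-1}\le T_0\le 0<T_1\le T_2\le\dots$. For each $K$ let $\Phi_{K1},\dots,\Phi_{KK}$ be i.i.d. stationary renewal point processes on $\mathbb R$ (inter-arrival times strictly positive), with $N_{Kk}(B)$ the number of points of $\Phi_{Kk}$ in $B$, and let $\Phi_K=\sum_{k=1}^K\Phi_{Kk}$. Let $\Phi^*$ be the homogeneous Poisson process on $\mathbb R$ of intensity $\lambda>0$. For a bounded interval $B$ of length $|B|>0$ put $$\lambda_{Kk}(B)=\frac{\mathbb P[N_{Kk}(B)=1]}{|B|},\quad \lambda_K^*(B)=\sum_{k=1}^K\lambda_{Kk}(B),\quad g_1(K,B)=\sum_{k=1}^K\sum_{j\ge2}j\,\mathbb P[N_{Kk}(B)=j],$$ $$g_2(K,B)=\max_{1\le k\le K}\lambda_{Kk}(B),\qquad g(K,B)=\max\{g_1(K,B),\,|B|^2g_2(K,B)\}.$$ Assume that the array is sparse: $g_1(K,B)\to0$ and $g_2(K,B)\to0$ as $K\to\infty$ for every bounded interval $B$; and that for some bounded interval $B_0$ of positive length $\lambda_K^*(B_0)\to\lambda$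 (for instance, $\lambda_K^*(B_0)=\lambda$ for all $K$). Each of these processes is the arrival process of a single-server first-come-first-served queue with unlimited waiting room; the $i$-th arrival brings the service time $S_i$, where $(S_i)_{i\in\mathbb Z}$ is i.i.d. with a law $P^S$ on $(0,\infty)$ and independent of the arrivals, and $\lambda\,\mathbb E[S]<1$. The queue is empty initially and is fed by the arrivals from time $s\in[-\infty,0]$ on, where $s=-\infty$ is the two-sided regime: job $n$ departs at $D_n=\sup\{T_m+S_m+\dots+S_n: m\le n,\ T_m\ge s\}$, and the queue length seen by the $i$-th arrival is the number of $m<i$ with $T_m\ge s$ and $D_m\ge T_i$. Denote it by $Q_i^{(K)}$ for the input $\Phi_K$ and by $Q_i^*$ for the input $\Phi^*$. Let $d_{\mathsf{TV}}(X,Y)=\sup_A|\mathbb P[X\in A]-\mathbb P[Y\in A]|$. **Statement.** There is a constant $C$ such that for every $i\in\mathbb Z$ and every $\epsilon>0$ there are $K_0$ and a bounded interval $B=B(\epsilon)$ of positive length, not depending on $s$, with $$d_{\mathsf{TV}}\big(Q_i^{(K)},Q_i^*\big)\le 2\epsilon+C\,g(K,B)\qquad\text{for all }K\ge K_0\text{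 and all } s\in[-\infty,0].$$ Moreover, for every $i$ and $s$, $d_{\mathsf{TV}}(Q_i^{(K)},Q_i^*)\to0$ as $K\to\infty$. -/

import Mathlib

open MeasureTheory ProbabilityTheory Filter Topology
open scoped ENNReal NNReal

noncomputable section

namespace QueueTV

/-- A realization of a point process on the line: a measure that takes natural-number values on
bounded Borel sets. -/
def IsCounting (φ : Measure ℝ) : Prop :=
  ∀ B : Set ℝ, MeasurableSet B → Bornology.IsBounded B → ∃ n : ℕ, φ B = n

/-- A point process on the line: a random element of the space of counting measures, with the
sigma-algebra generated by the evaluations `φ ↦ φ B` (Mathlib's sigma-algebra on `Measure ℝ`). -/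
structure IsPointProcess {Ω : Type*} [MeasurableSpace Ω] (Φ : Ω → Measure ℝ) : Prop where
  measurable : Measurable Φ
  counting : ∀ ω, IsCounting (Φ ω)

/-- Stationarity: the law of the point process is invariant under all time shifts. -/
def IsStationary {Ω : Type*} [MeasurableSpace Ω] (P : Measure Ω) (Φ : Ω → Measure ℝ) : Prop :=
  ∀ τ : ℝ, P.map (fun ω => (Φ ω).map (fun t => t + τ)) = P.map Φ

/-- The epoch of the `i`-th point, points being listed with multiplicity in increasing order as
`… ≤ T₋₁ ≤ T₀ ≤ 0 < T₁ ≤ T₂ ≤ …`. -/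
def arrivalTime (φ : Measure ℝ) (i : ℤ) : ℝ :=
  if 1 ≤ i then sInf {t : ℝ | 0 < t ∧ (i.toNat : ℝ≥0∞) ≤ φ (Set.Ioc 0 t)}
  else sSup {t : ℝ | t ≤ 0 ∧ ((1 - i).toNat : ℝ≥0∞) ≤ φ (Set.Icc t 0)}

/-- A stationary renewal process with inter-arrival distribution `F` on `(0, ∞)`: a stationary
point process with infinitely many points on both sides of the origin whose first positive epoch
`T₁` and subsequent inter-arrival times `T₂ - T₁, T₃ - T₂, …` are independent, the inter-arrival
times having law `F`. (The interval `T₁ - T₀` that covers the origin is length-biased in the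
stationary regime and does not have law `F`.) -/
structure IsStationaryRenewal {Ω : Type*} [MeasurableSpace Ω] (P : Measure Ω)
    (Φ : Ω → Measure ℝ) (F : Measure ℝ) : Prop where
  pointProcess : IsPointProcess Φ
  stationary : IsStationary P Φ
  infinite_points : ∀ᵐ ω ∂P, Φ ω (Set.Iic 0) = ∞ ∧ Φ ω (Set.Ioi 0) = ∞
  pos : F (Set.Iic 0) = 0
  law : ∀ n : ℕ, 1 ≤ n →
    P.map (fun ω => arrivalTime (Φ ω) (n + 1) - arrivalTime (Φ ω) n) = F
  indep : iIndepFun (fun (n : ℕ) ω =>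
    if n = 0 then arrivalTime (Φ ω) 1
    else arrivalTime (Φ ω) (n + 1) - arrivalTime (Φ ω) n) P

/-- A homogeneous Poisson process of intensity `lam` on the line. -/
structure IsPoisson {Ω : Type*} [MeasurableSpace Ω] (P : Measure Ω)
    (Φ : Ω → Measure ℝ) (lam : ℝ) : Prop where
  pointProcess : IsPointProcess Φ
  law : ∀ B : Set ℝ, MeasurableSet B → Bornology.IsBounded B → ∀ j : ℕ,
    P {ω | Φ ω B = j} = ENNReal.ofReal
      (Real.exp (-(lam * volume.real B)) * (lam * volume.real B) ^ j / (j.factorial : ℝ))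
  indep : ∀ (n : ℕ) (B : Fin n → Set ℝ), (∀ l, MeasurableSet (B l)) →
    (∀ l, Bornology.IsBounded (B l)) → Pairwise (fun l m => Disjoint (B l) (B m)) →
    iIndepFun (fun l ω => Φ ω (B l)) P

/-- The service times `S i`, `i ∈ ℤ`: i.i.d. with law `PS`. -/
structure IsServiceSeq {Ω : Type*} [MeasurableSpace Ω] (P : Measure Ω)
    (S : ℤ → Ω → ℝ) (PS : Measure ℝ) : Prop where
  measurable : ∀ i, Measurable (S i)
  law : ∀ i, P.map (S i) = PS
  indep : iIndepFun S P

/-- The superposition of the point processes in a row. -/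
def superposition {Ω : Type*} {K : ℕ} (Φ : Fin K → Ω → Measure ℝ) (ω : Ω) : Measure ℝ :=
  ∑ k, Φ k ω

section Sparsity

variable {Ω : Type*} [MeasurableSpace Ω] (P : Measure Ω) {K : ℕ} (Φ : Fin K → Ω → Measure ℝ)

/-- The rate `P[N_k(B) = 1] / |B|` of user `k` on `B`. -/
def rate (k : Fin K) (B : Set ℝ) : ℝ≥0∞ :=
  P {ω | Φ k ω B = 1} / volume B

/-- The Poisson sum rate `∑ₖ P[N_k(B) = 1] / |B|`. -/
def sumRate (B : Set ℝ) : ℝ≥0∞ :=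
  ∑ k, rate P Φ k B

/-- `g₁(K,B) = ∑ₖ ∑_{j ≥ 2} j P[N_k(B) = j]`. -/
def g₁ (B : Set ℝ) : ℝ≥0∞ :=
  ∑ k, ∑' j : ℕ, if 2 ≤ j then (j : ℝ≥0∞) * P {ω | Φ k ω B = j} else 0

/-- `g₂(K) = maxₖ P[N_k(B) = 1] / |B|`. -/
def g₂ (B : Set ℝ) : ℝ≥0∞ :=
  ⨆ k, rate P Φ k B

/-- `g(K,B) = max {g₁(K,B), |B|² g₂(K)}`. -/
def g (B : Set ℝ) : ℝ≥0∞ :=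
  max (g₁ P Φ B) (volume B ^ 2 * g₂ P Φ B)

end Sparsity

/-- Sparsity of a triangular array: on every bounded interval, `g₁` and `g₂` vanish as the number
of users grows. -/
structure IsSparse {Ω : ℕ → Type*} [∀ K, MeasurableSpace (Ω K)] (P : ∀ K, Measure (Ω K))
    (Φ : ∀ K, Fin K → Ω K → Measure ℝ) : Prop where
  g₁_tendsto : ∀ a b : ℝ, a < b →
    Tendsto (fun K => g₁ (P K) (Φ K) (Set.Ico a b)) atTop (𝓝 0)
  g₂_tendsto : ∀ a b : ℝ, a < b →
    Tendsto (fun K => g₂ (P K) (Φ K) (Set.Ico a b)) atTop (𝓝 0)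

/-- Departure time of job `n` from the FCFS single-server queue fed by the jobs that arrive at
times `t m ≥ s` with service times `S m`, the queue being empty initially. It is the explicit
solution `Dₙ = sup_{m ≤ n, t m ≥ s} (t m + S m + ⋯ + S n)` of `Dₙ = max(Dₙ₋₁, t n) + S n`.
The starting time `s = ⊥` stands for `-∞`, that is, for the two-sided (stationary) regime. -/
def departure (t S : ℤ → ℝ) (s : EReal) (n : ℤ) : EReal :=
  ⨆ m ∈ {m : ℤ | m ≤ n ∧ s ≤ (t m : EReal)}, ((t m + ∑ j ∈ Finset.Icc m n, S j : ℝ) : EReal)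

/-- The number of jobs in the system (waiting or in service) just before the `i`-th arrival: the
earlier jobs that have not departed before time `t i`. -/
def queueLength (t S : ℤ → ℝ) (s : EReal) (i : ℤ) : ℕ∞ :=
  Set.encard {m : ℤ | m < i ∧ s ≤ (t m : EReal) ∧ (t i : EReal) ≤ departure t S s m}

/-- The queue length seen by the `i`-th arrival, as a random variable: arrivals are the points of
`Φ`, the `i`-th arrival brings the service time `S i`, and the queue starts empty at time `s`. -/
def queueSeen {Ω : Type*} (Φ : Ω → Measure ℝ) (S : ℤ → Ω → ℝ) (s : EReal) (i : ℤ) (ω : Ω) : ℕ∞ :=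
  queueLength (arrivalTime (Φ ω)) (fun j => S j ω) s i

/-- Total variation distance `sup_A |P(X ∈ A) - P'(Y ∈ A)|` between the laws of two random
variables with values in `{0, 1, …, ∞}`. -/
def dTV {Ω Ω' : Type*} [MeasurableSpace Ω] [MeasurableSpace Ω'] (P : Measure Ω) (P' : Measure Ω')
    (X : Ω → ℕ∞) (Y : Ω' → ℕ∞) : ℝ :=
  ⨆ A : Set ℕ∞, |P.real {ω | X ω ∈ A} - P'.real {ω | Y ω ∈ A}|

end QueueTV

end

/-! Two facts are combined: Poisson approximation on bounded windows, and the locality of the queue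
in time.

Locally, a sparse superposition is close to the Poisson process in total variation. Laws on the
space of measures are compared through the masses of finite partitions (`tvLe_of_partition`). The
counts of one user are compared with a Poisson vector of the same mean; the cost is the squared mean
plus twice the contribution of multiple points (`tvLe_poissonVec_of_counts`). Costs add up under
convolution over the users, and their sum is of order `g` (`sum_error_le`). Stationarity makes the
mean measure of row K equal to ℓ_K times Lebesgue measure, and ℓ_K → λ can be read off on a single
interval (`exists_intensity_tendsto`). Replacing ℓ_K by λ costs |ℓ_K - λ| |B|, which is small but
not controlled by `g`; it is absorbed in the ε-term (`tvLe_restrict_superposition`).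

The queue forgets its past at regenerations. Cut the past into slots of length h. If the two-sided
server has idle time in some slot and no job arrives in the following one, then all earlier work is
done before the next arrival, so neither the earlier history nor an earlier starting time matters
(`queueLength_eq_of_idle`). For the stable Poisson input, laws of large numbers provide a bounded
window that contains such a pair of slots with high probability (`IsPoisson.exists_goodWindow`,
`exists_idle_slot`).

The difficulty is that two-sided idleness depends on the whole past, whereas the approximation of
the superposition holds on bounded windows only. Conservation of work in the mean overcomes it. For
every stationary input of finite mean, the mean idle time per slot is at least h minus the mean work
per slot (`le_lintegral_idleInf`); for the Poisson input there is equality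
(`lintegral_idleInf_add_le`). The idle time with a finite horizon u is a function of the window, so
its mean is nearly the same for both inputs, and for the Poisson input it is nearly the two-sided
mean when u is large. Since the mean works also nearly agree, the horizon-u and two-sided mean idle
times of the superposition nearly agree. The former dominates the latter pointwise, so Markov's
inequality makes them close with high probability (`measure_idleGap_ge_le`). Thus a good event that
is visible in the window forces a true regeneration for both inputs, uniformly in the starting time
(`ofReal_dTV_queueSeen_le`). -/

noncomputable section

namespace QueueTV

/-! ### One-sided total variation bounds -/

/-- `μ A ≤ ν A + δ` for every measurable `A`; for probability measures this says that the total
variation distance of `μ` and `ν` is at most `δ`. -/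
def TVLe {α : Type*} [MeasurableSpace α] (μ ν : Measure α) (δ : ℝ≥0∞) : Prop :=
  ∀ A, MeasurableSet A → μ A ≤ ν A + δ

section TV

variable {α β : Type*} [MeasurableSpace α] [MeasurableSpace β] {μ ν ρ : Measure α} {δ δ' : ℝ≥0∞}

lemma TVLe.refl (μ : Measure α) (δ : ℝ≥0∞) : TVLe μ μ δ := fun _ _ => le_self_add

lemma TVLe.mono (h : TVLe μ ν δ) (hδ : δ ≤ δ') : TVLe μ ν δ' :=
  fun A hA => (h A hA).trans (by gcongr)

lemma TVLe.trans (h : TVLe μ ν δ) (h' : TVLe ν ρ δ') : TVLe μ ρ (δ + δ') := fun A hA =>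
  (h A hA).trans ((add_le_add_left (h' A hA) δ).trans (by rw [add_assoc, add_comm δ']))

/-- Apply the bound to the complement; equal total masses turn it around. -/
lemma TVLe.symm [IsProbabilityMeasure μ] [IsProbabilityMeasure ν] (h : TVLe μ ν δ) :
    TVLe ν μ δ := by
  intro A hA
  have h1 := h Aᶜ hA.compl
  have h2 := prob_add_prob_compl (μ := μ) hA
  have h3 := prob_add_prob_compl (μ := ν) hA
  have : ν A + ν Aᶜ ≤ μ A + δ + ν Aᶜ := by
    rw [h3, ← h2, add_assoc, add_comm δ]
    gcongr
  exact (ENNReal.add_le_add_iff_right (measure_ne_top ν _)).1 this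

lemma TVLe.map (h : TVLe μ ν δ) {f : α → β} (hf : Measurable f) : TVLe (μ.map f) (ν.map f) δ := by
  intro A hA
  rw [Measure.map_apply hf hA, Measure.map_apply hf hA]
  exact h _ (hf hA)

/-- By Fubini it suffices to bound each section over the common factor, and the errors are averaged
against a probability measure. -/
lemma TVLe.prod_right [SFinite μ] [SFinite ν] (h : TVLe μ ν δ) (π : Measure β)
    [IsProbabilityMeasure π] : TVLe (μ.prod π) (ν.prod π) δ := by
  intro A hA
  rw [Measure.prod_apply_symm hA, Measure.prod_apply_symm hA]
  calc ∫⁻ y, μ ((fun x => (x, y)) ⁻¹' A) ∂π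
      ≤ ∫⁻ y, (ν ((fun x => (x, y)) ⁻¹' A) + δ) ∂π :=
        lintegral_mono fun y => h _ (measurable_prodMk_right hA)
    _ = _ := by rw [lintegral_add_right _ measurable_const]; simp

lemma TVLe.prod_left [SFinite μ] [SFinite ν] (h : TVLe μ ν δ) (π : Measure β)
    [IsProbabilityMeasure π] : TVLe (π.prod μ) (π.prod ν) δ := by
  rw [← Measure.prod_swap, ← Measure.prod_swap (μ := ν)]
  exact (h.prod_right π).map measurable_swap

/-- Replace one factor at a time in the product measure, then push forward by addition. This is what
makes errors add over independent users. -/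
lemma TVLe.conv {M : Type*} [AddMonoid M] [MeasurableSpace M] [MeasurableAdd₂ M]
    {μ ν μ' ν' : Measure M} [IsProbabilityMeasure μ] [IsProbabilityMeasure ν]
    [IsProbabilityMeasure μ'] [IsProbabilityMeasure ν'] (h : TVLe μ ν δ) (h' : TVLe μ' ν' δ') :
    TVLe (μ.conv μ') (ν.conv ν') (δ + δ') :=
  ((h.prod_right μ').trans (h'.prod_left ν)).map measurable_add

/-- A total variation bound for integrals of bounded functions. -/
lemma TVLe.lintegral_le (h : TVLe μ ν δ) {f : α → ℝ≥0∞} (hf : Measurable f) {c : ℝ}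
    (hc : 0 ≤ c) (hfc : ∀ x, f x ≤ ENNReal.ofReal c) :
    ∫⁻ x, f x ∂μ ≤ ∫⁻ x, f x ∂ν + ENNReal.ofReal c * δ := by
  -- Layer cake formula: as `f` is bounded by `c`, only levels in `(0, c]` contribute, so an error
  -- `δ` per level costs `c * δ`.
  have key : ∀ κ : Measure α, ∫⁻ x, f x ∂κ
      = ∫⁻ t in Set.Ioc 0 c, κ {x | t < (f x).toReal} := by
    intro κ
    have h1 : ∀ x, f x = ENNReal.ofReal (f x).toReal := fun x =>
      (ENNReal.ofReal_toReal ((hfc x).trans_lt ENNReal.ofReal_lt_top).ne).symm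
    have h2 := lintegral_eq_lintegral_meas_lt κ (f := fun x => (f x).toReal)
      (ae_of_all _ fun x => ENNReal.toReal_nonneg) hf.ennreal_toReal.aemeasurable
    simp_rw [← h1] at h2
    rw [h2, ← Set.Ioc_union_Ioi_eq_Ioi hc, lintegral_union measurableSet_Ioi
      (Set.Ioc_disjoint_Ioi le_rfl)]
    have : ∫⁻ t in Set.Ioi c, κ {x | t < (f x).toReal} = 0 := by
      rw [setLIntegral_congr_fun (g := fun _ => 0) measurableSet_Ioi]
      · simp
      · intro t ht
        have : {x | t < (f x).toReal} = ∅ := by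
          ext x
          simp only [Set.mem_ofPred_eq, Set.mem_empty_iff_false, iff_false, not_lt]
          exact (ENNReal.toReal_le_of_le_ofReal hc (hfc x)).trans ht.le
        simp [this]
    rw [this, add_zero]
  rw [key μ, key ν]
  calc ∫⁻ t in Set.Ioc 0 c, μ {x | t < (f x).toReal}
      ≤ ∫⁻ t in Set.Ioc 0 c, (ν {x | t < (f x).toReal} + δ) :=
        lintegral_mono fun t => h _ (measurableSet_lt measurable_const hf.ennreal_toReal)
    _ = _ := by
        rw [lintegral_add_right _ measurable_const]
        simp [mul_comm]

end TV

/-! ### Vectors of independent Poisson variables -/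

section Poisson

variable {ι : Type*} [Fintype ι]

/-- The law of a vector of independent Poisson variables with means `θ i`. -/
def poissonVec (θ : ι → ℝ≥0) : Measure (ι → ℝ≥0∞) :=
  Measure.pi fun i => (poissonMeasure (θ i)).map Nat.cast

instance (r : ℝ≥0) : IsProbabilityMeasure ((poissonMeasure r).map (Nat.cast : ℕ → ℝ≥0∞)) :=
  Measure.isProbabilityMeasure_map (by fun_prop)

instance (θ : ι → ℝ≥0) : IsProbabilityMeasure (poissonVec θ) := by
  unfold poissonVec; infer_instance

/-- Regrouping a pair of vectors as a vector of pairs is measure preserving, and addition then acts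
coordinatewise. -/
lemma pi_conv_pi {M : Type*} [AddMonoid M] [MeasurableSpace M] [MeasurableAdd₂ M]
    (μ ν : ι → Measure M) [∀ i, IsProbabilityMeasure (μ i)] [∀ i, IsProbabilityMeasure (ν i)] :
    (Measure.pi μ).conv (Measure.pi ν) = Measure.pi fun i => (μ i).conv (ν i) := by
  unfold Measure.conv
  have : ∀ i, IsProbabilityMeasure (((μ i).prod (ν i)).map fun x => x.1 + x.2) :=
    fun i => Measure.isProbabilityMeasure_map (by fun_prop)
  rw [← (measurePreserving_arrowProdEquivProdArrow M M ι μ ν).map_eq, Measure.map_map,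
    ← Measure.pi_map_pi (fun i => (by fun_prop))]
  · rfl
  · fun_prop
  · exact (MeasurableEquiv.arrowProdEquivProdArrow M M ι).measurable

lemma poissonVec_add (θ θ' : ι → ℝ≥0) :
    poissonVec (θ + θ') = (poissonVec θ).conv (poissonVec θ') := by
  simp only [poissonVec, pi_conv_pi, map_cast_poissonMeasure_conv, Pi.add_apply]

lemma map_cast_poissonMeasure_singleton (r : ℝ≥0) (n : ℕ) :
    (poissonMeasure r).map (Nat.cast : ℕ → ℝ≥0∞) {(n : ℝ≥0∞)} =
      ENNReal.ofReal (Real.exp (-r) * r ^ n / n.factorial) := by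
  rw [Measure.map_apply (by fun_prop) (measurableSet_singleton _), ← poissonMeasure_singleton]
  congr 1
  ext m
  simp

lemma poissonVec_zero_singleton (θ : ι → ℝ≥0) :
    poissonVec θ {0} = ENNReal.ofReal (Real.exp (-(∑ i, θ i : ℝ≥0))) := by
  have h : ∀ i, (poissonMeasure (θ i)).map (Nat.cast : ℕ → ℝ≥0∞) {0} =
      ENNReal.ofReal (Real.exp (-(θ i))) := fun i => by
    simpa using map_cast_poissonMeasure_singleton (θ i) 0
  rw [poissonVec, Measure.pi_singleton]
  simp only [Pi.zero_apply, h]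
  rw [← ENNReal.ofReal_prod_of_nonneg (fun _ _ => (Real.exp_pos _).le), ← Real.exp_sum]
  congr 2
  push_cast
  rw [Finset.sum_neg_distrib]

lemma poissonVec_single_singleton [DecidableEq ι] (θ : ι → ℝ≥0) (i : ι) :
    poissonVec θ {Pi.single i 1} =
      θ i * ENNReal.ofReal (Real.exp (-(∑ i, θ i : ℝ≥0))) := by
  have h : ∀ j, (poissonMeasure (θ j)).map (Nat.cast : ℕ → ℝ≥0∞) {(Pi.single i 1 : ι → ℝ≥0∞) j} =
      (if j = i then (θ i : ℝ≥0∞) else 1) * ENNReal.ofReal (Real.exp (-(θ j))) := fun j => by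
    by_cases hj : j = i
    · subst hj
      have := map_cast_poissonMeasure_singleton (θ j) 1
      simp only [Nat.cast_one, pow_one, Nat.factorial_one, div_one] at this
      simp only [Pi.single_eq_same, this, if_true]
      rw [ENNReal.ofReal_mul (Real.exp_pos _).le, mul_comm, ENNReal.ofReal_coe_nnreal]
    · simpa [hj] using map_cast_poissonMeasure_singleton (θ j) 0
  rw [poissonVec, Measure.pi_singleton]
  simp only [h]
  rw [Finset.prod_mul_distrib, Finset.prod_ite_eq' Finset.univ i, if_pos (Finset.mem_univ i),
    ← ENNReal.ofReal_prod_of_nonneg (fun _ _ => (Real.exp_pos _).le), ← Real.exp_sum]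
  congr 3
  push_cast
  rw [Finset.sum_neg_distrib]

/-- The inequality `1 - x ≤ exp (-x)`, free of truncated subtraction. It is the only analytic
estimate behind the Poisson comparison. -/
lemma one_le_exp_neg_add (x : ℝ≥0) : 1 ≤ ENNReal.ofReal (Real.exp (-x)) + x := by
  rw [← ENNReal.ofReal_coe_nnreal, ← ENNReal.ofReal_add (Real.exp_pos _).le (NNReal.coe_nonneg x),
    ← ENNReal.ofReal_one]
  apply ENNReal.ofReal_le_ofReal
  have := Real.add_one_le_exp (-(x : ℝ))
  linarith

/-- The Poisson vector vanishes except with probability `1 - exp (-∑ η) ≤ ∑ η`. -/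
lemma tvLe_dirac_poissonVec (η : ι → ℝ≥0) :
    TVLe (Measure.dirac 0) (poissonVec η) (∑ i, η i : ℝ≥0) := by
  intro A hA
  by_cases h : (0 : ι → ℝ≥0∞) ∈ A
  · calc Measure.dirac 0 A ≤ 1 := prob_le_one
      _ ≤ poissonVec η {0} + (∑ i, η i : ℝ≥0) := by
          rw [poissonVec_zero_singleton]; exact one_le_exp_neg_add _
      _ ≤ _ := by gcongr; simpa using h
  · rw [Measure.dirac_apply' _ hA]; simp [h]

/-- Adding an independent Poisson vector of total mean `∑ η` changes the law by at most `∑ η`. -/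
lemma tvLe_poissonVec_add (θ η : ι → ℝ≥0) :
    TVLe (poissonVec θ) (poissonVec (θ + η)) (∑ i, η i : ℝ≥0) := by
  have := (TVLe.refl (poissonVec θ) 0).conv (tvLe_dirac_poissonVec η)
  rwa [Measure.conv_dirac_zero, ← poissonVec_add, zero_add] at this

/-- When the means are ordered, the larger vector is the smaller one plus an independent Poisson
vector of total mean at most `δ`. The order hypothesis avoids summing coordinatewise differences of
both signs. -/
lemma tvLe_poissonVec (θ θ' : ι → ℝ≥0) {δ : ℝ≥0} (h : θ ≤ θ' ∨ θ' ≤ θ)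
    (h1 : ∑ i, θ i ≤ ∑ i, θ' i + δ) (h2 : ∑ i, θ' i ≤ ∑ i, θ i + δ) :
    TVLe (poissonVec θ) (poissonVec θ') δ := by
  have key : ∀ θ θ' : ι → ℝ≥0, θ ≤ θ' → ∑ i, θ' i ≤ ∑ i, θ i + δ →
      TVLe (poissonVec θ) (poissonVec θ') δ := by
    intro θ θ' h h1
    have h3 := tvLe_poissonVec_add θ (θ' - θ)
    rw [add_tsub_cancel_of_le h] at h3
    refine h3.mono ?_
    rw [ENNReal.coe_le_coe]
    have : ∑ i, θ i + ∑ i, (θ' - θ) i = ∑ i, θ' i := by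
      rw [← Finset.sum_add_distrib]
      exact Finset.sum_congr rfl fun i _ => add_tsub_cancel_of_le (h i)
    rw [← this] at h1
    exact le_of_add_le_add_left h1
  rcases h with h | h
  · exact key _ _ h h2
  · exact (key _ _ h h1).symm

/-- A random vector `X` with values in `ℕ^ι` and few multiple points is close in law to a Poisson
vector with the same mean. -/
lemma tvLe_poissonVec_of_counts {Ω : Type*} [MeasurableSpace Ω] {P : Measure Ω}
    [IsProbabilityMeasure P] {X : Ω → ι → ℝ≥0∞} (hX : Measurable X)
    (hXn : ∀ ω i, ∃ n : ℕ, X ω i = n) (θ : ι → ℝ≥0) (hθ : ∀ i, ∫⁻ ω, X ω i ∂P = θ i)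
    {γ : ℝ≥0∞} (hγ : ∫⁻ ω in {ω | 2 ≤ ∑ i, X ω i}, ∑ i, X ω i ∂P ≤ γ) :
    TVLe (P.map X) (poissonVec θ) ((∑ i, θ i : ℝ≥0) ^ 2 + 2 * γ) := by
  classical
  intro A hA
  rw [Measure.map_apply hX hA]
  set t : ℝ≥0 := ∑ i, θ i with ht
  have hN : Measurable fun ω => ∑ i, X ω i := by fun_prop
  have hNn : ∀ ω, ∃ n : ℕ, ∑ i, X ω i = n := by
    intro ω
    choose n hn using hXn ω
    exact ⟨∑ i, n i, by simp [hn]⟩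
  have hm2 : MeasurableSet {ω | 2 ≤ ∑ i, X ω i} := measurableSet_le measurable_const hN
  have hEN : ∫⁻ ω, ∑ i, X ω i ∂P = t := by
    rw [lintegral_finsetSum _ (fun i _ => by fun_prop), ht]
    simp [hθ]
  -- multiple points
  have hmult : P {ω | 2 ≤ ∑ i, X ω i} ≤ γ := by
    refine le_trans ?_ hγ
    rw [← setLIntegral_one]
    exact setLIntegral_mono' hm2 fun ω hω => le_trans (by norm_num) hω
  -- no points
  have hzero : P {ω | X ω = 0} ≤ poissonVec θ {0} + γ := by
    have hm0 : MeasurableSet {ω | X ω = 0} := hX (measurableSet_singleton 0)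
    -- Split the mean number of points: where there is at most one point it contributes at most the
    -- probability of a nonzero vector, and the rest is at most `γ`.
    have h1 : (t : ℝ≥0∞) ≤ P {ω | X ω = 0}ᶜ + γ := by
      rw [← hEN, ← lintegral_add_compl _ hm2, add_comm]
      refine add_le_add ?_ hγ
      rw [← lintegral_indicator_one hm0.compl, ← lintegral_indicator hm2.compl]
      refine lintegral_mono fun ω => ?_
      by_cases h2 : ω ∈ {ω | 2 ≤ ∑ i, X ω i}ᶜ
      · rw [Set.indicator_of_mem h2]
        obtain ⟨n, hn⟩ := hNn ω
        simp only [Set.mem_compl_iff, Set.mem_ofPred_eq, hn, not_le] at h2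
        have h2' : n < 2 := by exact_mod_cast h2
        rw [hn]
        by_cases h0 : X ω = 0
        · have : (n : ℝ≥0∞) = 0 := by rw [← hn, h0]; simp
          rw [this]; exact zero_le
        · rw [Set.indicator_of_mem (by simpa using h0)]
          simp only [Pi.one_apply]
          exact_mod_cast Nat.le_of_lt_succ h2'
      · rw [Set.indicator_of_notMem h2]; exact zero_le
    have h2 : P {ω | X ω = 0} + t ≤ 1 + γ := by
      rw [← prob_add_prob_compl (μ := P) hm0, add_assoc]
      gcongr
    have h3 : P {ω | X ω = 0} + t ≤ (poissonVec θ {0} + γ) + t := by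
      refine h2.trans ?_
      rw [poissonVec_zero_singleton, add_right_comm]
      gcongr
      exact one_le_exp_neg_add _
    exact (ENNReal.add_le_add_iff_right ENNReal.coe_ne_top).1 h3
  -- one point
  have hone : ∀ i, P {ω | X ω = Pi.single i 1} ≤ poissonVec θ {Pi.single i 1} + θ i * t := by
    intro i
    rw [poissonVec_single_singleton, ← mul_add]
    -- Markov bounds the probability by `θ i`, and `1 ≤ exp (-t) + t` splits this into the Poisson
    -- mass and `θ i * t`. Summed over `i`, the errors give `t ^ 2`.
    calc P {ω | X ω = Pi.single i 1} ≤ P {ω | 1 ≤ X ω i} :=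
          measure_mono fun ω (hω : X ω = _) => by simp [hω]
      _ ≤ ∫⁻ ω, X ω i ∂P := by
          simpa using mul_meas_ge_le_lintegral (μ := P) (f := fun ω => X ω i) (by fun_prop) 1
      _ = θ i * 1 := by rw [hθ, mul_one]
      _ ≤ _ := by gcongr; exact one_le_exp_neg_add _
  -- An integer vector of total below two is zero or a unit vector, so only these atoms and the
  -- event of multiple points have to be treated.
  have hsub : X ⁻¹' A ⊆ ((X ⁻¹' (A ∩ {0})) ∪ {ω | 2 ≤ ∑ i, X ω i}) ∪
      ⋃ i ∈ (Finset.univ : Finset ι), X ⁻¹' (A ∩ {Pi.single i 1}) := by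
    intro ω hω
    obtain ⟨n, hn⟩ := hNn ω
    choose m hmm using hXn ω
    by_cases h0 : X ω = 0
    · exact Or.inl (Or.inl ⟨hω, h0⟩)
    by_cases h2 : 2 ≤ ∑ i, X ω i
    · exact Or.inl (Or.inr h2)
    right
    have hs : ∑ i, m i < 2 := by
      simp only [hmm, not_le] at h2
      exact_mod_cast h2
    have hex : ∃ i, m i ≠ 0 := by
      by_contra hcon
      push Not at hcon
      exact h0 (funext fun i => by simp [hmm, hcon])
    obtain ⟨i, hi⟩ := hex
    simp only [Set.mem_iUnion]
    refine ⟨i, Finset.mem_univ i, hω, ?_⟩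
    funext j
    rw [← Finset.add_sum_erase _ _ (Finset.mem_univ i)] at hs
    by_cases hj : j = i
    · subst hj
      have : m j = 1 := by omega
      simp [hmm, this]
    · have := Finset.single_le_sum (f := m) (s := Finset.univ.erase i) (fun _ _ => Nat.zero_le _)
        (Finset.mem_erase.2 ⟨hj, Finset.mem_univ j⟩)
      have : m j = 0 := by omega
      simp [hmm, this, hj]
  -- Only a lower bound is needed on the Poisson side, so its mass on larger vectors is discarded.
  have hlow : poissonVec θ (A ∩ {0}) + ∑ i, poissonVec θ (A ∩ {Pi.single i 1})
      ≤ poissonVec θ A := by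
    rw [← measure_biUnion_finset, ← measure_union]
    · refine measure_mono (Set.union_subset Set.inter_subset_left ?_)
      simp only [Set.iUnion_subset_iff]
      exact fun i _ => Set.inter_subset_left
    · rw [Set.disjoint_left]
      rintro x ⟨-, hx⟩ hx'
      simp only [Set.mem_iUnion] at hx'
      obtain ⟨i, -, -, hi⟩ := hx'
      rw [Set.mem_singleton_iff] at hx hi
      have := congrFun (hx.symm.trans hi) i
      simp at this
    · exact Finset.measurableSet_biUnion _ fun i _ => hA.inter (measurableSet_singleton _)
    · intro i _ j _ hij
      rw [Function.onFun, Set.disjoint_left]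
      rintro x ⟨-, hx⟩ ⟨-, hx'⟩
      rw [Set.mem_singleton_iff] at hx hx'
      have := congrFun (hx.symm.trans hx') i
      simp [hij] at this
    · exact fun i _ => hA.inter (measurableSet_singleton _)
  have e0 : P (X ⁻¹' (A ∩ {0})) ≤ poissonVec θ (A ∩ {0}) + γ := by
    by_cases h : (0 : ι → ℝ≥0∞) ∈ A
    · rw [Set.inter_eq_right.2 (by simpa using h)]; exact hzero
    · have : A ∩ {0} = ∅ := by simpa using h
      simp [this]
  have e1 : ∀ i, P (X ⁻¹' (A ∩ {Pi.single i 1}))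
      ≤ poissonVec θ (A ∩ {Pi.single i 1}) + θ i * t := by
    intro i
    by_cases h : (Pi.single i 1 : ι → ℝ≥0∞) ∈ A
    · rw [Set.inter_eq_right.2 (by simpa using h)]; exact hone i
    · have : A ∩ {Pi.single i (1 : ℝ≥0∞)} = ∅ := by simpa using h
      simp [this]
  calc P (X ⁻¹' A) ≤ _ := measure_mono hsub
    _ ≤ (P (X ⁻¹' (A ∩ {0})) + P {ω | 2 ≤ ∑ i, X ω i}) +
        ∑ i, P (X ⁻¹' (A ∩ {Pi.single i 1})) :=
      (measure_union_le _ _).trans (add_le_add (measure_union_le _ _)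
        (measure_biUnion_finset_le _ _))
    _ ≤ ((poissonVec θ (A ∩ {0}) + γ) + γ) +
        ∑ i, (poissonVec θ (A ∩ {Pi.single i 1}) + θ i * t) :=
      add_le_add (add_le_add e0 hmult) (Finset.sum_le_sum fun i _ => e1 i)
    _ = (poissonVec θ (A ∩ {0}) + ∑ i, poissonVec θ (A ∩ {Pi.single i 1})) +
        ((t : ℝ≥0∞) ^ 2 + 2 * γ) := by
      rw [Finset.sum_add_distrib, ← Finset.sum_mul, ht]
      push_cast
      ring
    _ ≤ _ := by gcongr

end Poisson

/-! ### Total variation of random measures through finite partitions -/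

lemma measurable_restrict_measure {B : Set ℝ} (hB : MeasurableSet B) :
    Measurable fun φ : Measure ℝ => φ.restrict B := by
  refine Measure.measurable_of_measurable_coe _ fun s hs => ?_
  simp_rw [Measure.restrict_apply hs]
  exact Measure.measurable_coe (hs.inter hB)

/-- The masses that a measure gives to the pieces of the partition defined by `f`. -/
def partitionMass {ι : Type*} (f : ℝ → ι) (φ : Measure ℝ) (i : ι) : ℝ≥0∞ := φ (f ⁻¹' {i})

lemma measurable_partitionMass {n : ℕ} {f : ℝ → Fin n} (hf : Measurable f) :
    Measurable (partitionMass f) :=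
  measurable_pi_lambda _ fun i => Measure.measurable_coe (hf (measurableSet_singleton i))

/-- The events that depend on the masses of finitely many disjoint sets. -/
def partitionEvents : Set (Set (Measure ℝ)) :=
  {s | ∃ (n : ℕ) (f : ℝ → Fin n) (C : Set (Fin n → ℝ≥0∞)), Measurable f ∧ MeasurableSet C ∧
    s = partitionMass f ⁻¹' C}

/-- Masses of a partition are marginals of those of the common refinement with a second partition.
-/
lemma partitionMass_eq_sum {n m : ℕ} {f : ℝ → Fin n} {f' : ℝ → Fin m} (hf : Measurable f)
    (hf' : Measurable f') (φ : Measure ℝ) (i : Fin n) :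
    partitionMass f φ i = ∑ j, partitionMass (fun x => (f x, f' x)) φ (i, j) := by
  simp only [partitionMass]
  rw [← measure_biUnion_finset]
  · congr 1
    ext x
    simp
  · intro j _ j' _ hj
    rw [Function.onFun, Set.disjoint_left]
    intro x hx hx'
    simp only [Set.mem_preimage, Set.mem_singleton_iff, Prod.mk.injEq] at hx hx'
    exact hj (hx.2.symm.trans hx'.2)
  · exact fun j _ => (hf.prodMk hf') (measurableSet_singleton (i, j))

lemma partitionMass_comp_equiv {ι κ : Type*} (e : ι ≃ κ) (f : ℝ → ι) (φ : Measure ℝ) (i : ι) :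
    partitionMass (fun x => e (f x)) φ (e i) = partitionMass f φ i := by
  simp only [partitionMass]
  congr 1
  ext x
  simp

/-- Two events become events of a single partition on the common refinement, whose pieces are
indexed by `Fin (n * m)`; this gives unions. -/
lemma isSetAlgebra_partitionEvents : IsSetAlgebra partitionEvents where
  empty_mem := ⟨1, fun _ => 0, ∅, measurable_const, MeasurableSet.empty, by simp⟩
  compl_mem := by
    rintro s ⟨n, f, C, hf, hC, rfl⟩
    exact ⟨n, f, Cᶜ, hf, hC.compl, rfl⟩
  union_mem := by
    rintro s t ⟨n, f, C, hf, hC, rfl⟩ ⟨m, f', C', hf', hC', rfl⟩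
    let r : (Fin (n * m) → ℝ≥0∞) → Fin n → ℝ≥0∞ := fun v i => ∑ j, v (finProdFinEquiv (i, j))
    let r' : (Fin (n * m) → ℝ≥0∞) → Fin m → ℝ≥0∞ := fun v j => ∑ i, v (finProdFinEquiv (i, j))
    have hr : Measurable r := by fun_prop
    have hr' : Measurable r' := by fun_prop
    refine ⟨n * m, fun x => finProdFinEquiv (f x, f' x), r ⁻¹' C ∪ r' ⁻¹' C',
      (measurable_of_countable _).comp (hf.prodMk hf'), (hr hC).union (hr' hC'), ?_⟩
    have h1 : ∀ φ, r (partitionMass (fun x => finProdFinEquiv (f x, f' x)) φ)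
        = partitionMass f φ := by
      intro φ
      funext i
      simp only [r, partitionMass_eq_sum hf hf' φ i]
      exact Finset.sum_congr rfl fun j _ =>
        partitionMass_comp_equiv finProdFinEquiv (fun x => (f x, f' x)) φ (i, j)
    have h2 : ∀ φ, r' (partitionMass (fun x => finProdFinEquiv (f x, f' x)) φ)
        = partitionMass f' φ := by
      intro φ
      funext j
      simp only [r', partitionMass_eq_sum hf' hf φ j]
      refine Finset.sum_congr rfl fun i _ => ?_
      rw [partitionMass_comp_equiv finProdFinEquiv (fun x => (f x, f' x)) φ (i, j),
        ← partitionMass_comp_equiv (Equiv.prodComm _ _) (fun x => (f x, f' x)) φ (i, j)]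
      rfl
    ext φ
    simp only [Set.mem_union, Set.mem_preimage, h1, h2]

lemma generateFrom_partitionEvents :
    (Measure.instMeasurableSpace : MeasurableSpace (Measure ℝ)) =
      MeasurableSpace.generateFrom partitionEvents := by
  classical
  apply le_antisymm
  · refine iSup₂_le fun s hs => ?_
    rintro _ ⟨C, hC, rfl⟩
    apply MeasurableSpace.measurableSet_generateFrom
    -- The evaluation at `s` is a mass of the two-piece partition into `s` and its complement.
    refine ⟨2, fun x => if x ∈ s then 1 else 0, (fun v => v 1) ⁻¹' C,
      Measurable.ite hs measurable_const measurable_const, measurable_pi_apply 1 hC, ?_⟩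
    ext φ
    have : (fun x => if x ∈ s then (1 : Fin 2) else 0) ⁻¹' {1} = s := by
      ext x; by_cases h : x ∈ s <;> simp [h]
    simp [partitionMass, this]
  · refine MeasurableSpace.generateFrom_le ?_
    rintro _ ⟨n, f, C, hf, hC, rfl⟩
    exact measurable_partitionMass hf hC

/-- Events of finite partitions form a generating algebra, so any event can be approximated by one
of them. Approximating with respect to `μ + ν` makes the error small under both laws at once. -/
lemma tvLe_of_partition {μ ν : Measure (Measure ℝ)} [IsFiniteMeasure μ] [IsFiniteMeasure ν]
    {δ : ℝ≥0∞} (h : ∀ (n : ℕ) (f : ℝ → Fin n), Measurable f →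
      TVLe (μ.map (partitionMass f)) (ν.map (partitionMass f)) δ) : TVLe μ ν δ := by
  intro A hA
  refine ENNReal.le_of_forall_pos_le_add fun ε hε _ => ?_
  obtain ⟨t, ⟨n, f, C, hf, hC, rfl⟩, ht⟩ :=
    (Measure.MeasureDense.of_generateFrom_isSetAlgebra_finite (μ + ν)
      isSetAlgebra_partitionEvents generateFrom_partitionEvents).approx A hA
      (measure_ne_top _ _) (ε / 2) (by positivity)
  have hlt : ∀ κ : Measure (Measure ℝ), κ ≤ μ + ν →
      κ (symmDiff A (partitionMass f ⁻¹' C)) ≤ ENNReal.ofReal (ε / 2) :=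
    fun κ hκ => (hκ _).trans ht.le
  have hfC := h n f hf C hC
  rw [Measure.map_apply (measurable_partitionMass hf) hC,
    Measure.map_apply (measurable_partitionMass hf) hC] at hfC
  have hε2 : ENNReal.ofReal (ε / 2) + ENNReal.ofReal (ε / 2) = ε := by
    rw [← ENNReal.ofReal_add (by positivity) (by positivity), add_halves,
      ENNReal.ofReal_coe_nnreal]
  have hdiff : ∀ (κ : Measure (Measure ℝ)) (s t : Set (Measure ℝ)), κ s ≤ κ t + κ (symmDiff s t) :=
    fun κ s t => (measure_mono (by
      intro x hx
      by_cases h : x ∈ t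
      · exact Or.inl h
      · exact Or.inr (Or.inl ⟨hx, h⟩))).trans (measure_union_le _ _)
  calc μ A ≤ μ (partitionMass f ⁻¹' C) + ENNReal.ofReal (ε / 2) :=
        (hdiff μ _ _).trans (by gcongr; exact hlt μ (Measure.le_add_right le_rfl))
    _ ≤ ν (partitionMass f ⁻¹' C) + δ + ENNReal.ofReal (ε / 2) := by gcongr
    _ ≤ ν A + ENNReal.ofReal (ε / 2) + δ + ENNReal.ofReal (ε / 2) := by
        gcongr
        refine (hdiff ν _ A).trans ?_
        rw [symmDiff_comm]
        gcongr
        exact hlt ν (Measure.le_add_left le_rfl)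
    _ = ν A + δ + ε := by rw [← hε2]; ring

/-! ### Counts -/

/-- The natural number closest from below to a mass. -/
def massNat (x : ℝ≥0∞) : ℕ := ⌊x.toReal⌋₊

lemma measurable_massNat : Measurable massNat := Nat.measurable_floor.comp ENNReal.measurable_toReal

@[simp] lemma massNat_natCast (n : ℕ) : massNat n = n := by simp [massNat]

lemma IsPointProcess.measurable_apply {Ω : Type*} [MeasurableSpace Ω] {Φ : Ω → Measure ℝ}
    (h : IsPointProcess Φ) {B : Set ℝ} (hB : MeasurableSet B) : Measurable fun ω => Φ ω B :=
  (Measure.measurable_coe hB).comp h.measurable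

lemma IsCounting.cast_massNat {φ : Measure ℝ} (h : IsCounting φ) {B : Set ℝ}
    (hB : MeasurableSet B) (hb : Bornology.IsBounded B) : (massNat (φ B) : ℝ≥0∞) = φ B := by
  obtain ⟨n, hn⟩ := h B hB hb
  simp [hn]

lemma IsCounting.lt_top {φ : Measure ℝ} (h : IsCounting φ) {B : Set ℝ}
    (hb : Bornology.IsBounded B) : φ B < ∞ := by
  obtain ⟨r, hr⟩ := hb.subset_closedBall 0
  obtain ⟨n, hn⟩ := h _ measurableSet_closedBall Metric.isBounded_closedBall
  exact (measure_mono hr).trans_lt (hn ▸ ENNReal.natCast_lt_top n)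

/-- Translates the series in `g₁` into the truncated mean produced by the Poisson comparison. -/
lemma setLIntegral_two_le_eq_tsum {Ω : Type*} [MeasurableSpace Ω] {P : Measure Ω}
    {X : Ω → ℝ≥0∞} (hX : Measurable X) (hXn : ∀ ω, ∃ n : ℕ, X ω = n) :
    ∫⁻ ω in {ω | 2 ≤ X ω}, X ω ∂P =
      ∑' j : ℕ, if 2 ≤ j then (j : ℝ≥0∞) * P {ω | X ω = j} else 0 := by
  have hN : Measurable fun ω => massNat (X ω) := measurable_massNat.comp hX
  have hXN : ∀ ω, X ω = (massNat (X ω) : ℕ) := fun ω => by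
    obtain ⟨n, hn⟩ := hXn ω
    simp [hn]
  rw [← lintegral_indicator (measurableSet_le measurable_const hX)]
  have h1 : ∀ ω, Set.indicator {ω | 2 ≤ X ω} X ω =
      (fun n : ℕ => if 2 ≤ n then (n : ℝ≥0∞) else 0) (massNat (X ω)) := fun ω => by
    obtain ⟨n, hn⟩ := hXn ω
    have : (2 : ℝ≥0∞) ≤ n ↔ 2 ≤ n := by exact_mod_cast Iff.rfl
    simp [Set.indicator, hn, this]
  simp_rw [h1]
  rw [← lintegral_map (f := fun n : ℕ => if 2 ≤ n then (n : ℝ≥0∞) else 0)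
    (measurable_of_countable _) hN, lintegral_countable']
  refine tsum_congr fun j => ?_
  rw [Measure.map_apply hN (measurableSet_singleton j)]
  have : (fun ω => massNat (X ω)) ⁻¹' {j} = {ω | X ω = j} := by
    ext ω
    obtain ⟨n, hn⟩ := hXn ω
    simp [hn]
  rw [this]
  split_ifs <;> simp

/-- An integer-valued variable equals its indicator of the value one plus its part at values at
least two. The first term feeds `rate`, the second `g₁`. -/
lemma lintegral_eq_measure_one_add {Ω : Type*} [MeasurableSpace Ω] {P : Measure Ω}
    {X : Ω → ℝ≥0∞} (hX : Measurable X) (hXn : ∀ ω, ∃ n : ℕ, X ω = n) :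
    ∫⁻ ω, X ω ∂P = P {ω | X ω = 1} + ∫⁻ ω in {ω | 2 ≤ X ω}, X ω ∂P := by
  have h1 : MeasurableSet {ω | X ω = 1} := hX (measurableSet_singleton 1)
  have h2 : MeasurableSet {ω | 2 ≤ X ω} := measurableSet_le measurable_const hX
  rw [← lintegral_indicator_one h1, ← lintegral_indicator h2,
    ← lintegral_add_left (measurable_one.indicator h1)]
  refine lintegral_congr fun ω => ?_
  obtain ⟨n, hn⟩ := hXn ω
  have : (2 : ℝ≥0∞) ≤ n ↔ 2 ≤ n := by exact_mod_cast Iff.rfl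
  simp only [Set.indicator, Set.mem_ofPred_eq, hn, this, Nat.cast_eq_one, Pi.one_apply]
  rcases n with _ | _ | n <;> simp

/-! ### Poisson approximation of a superposition -/

lemma isPointProcess_superposition {Ω : Type*} [MeasurableSpace Ω] {K : ℕ}
    {Φ : Fin K → Ω → Measure ℝ} (h : ∀ k, IsPointProcess (Φ k)) :
    IsPointProcess (superposition Φ) where
  measurable := by
    refine Measure.measurable_of_measurable_coe _ fun s hs => ?_
    simp only [superposition, Measure.coe_finsetSum, Finset.sum_apply]
    exact Finset.measurable_sum _ fun k _ => (h k).measurable_apply hs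
  counting := by
    intro ω B hB hb
    choose n hn using fun k => (h k).counting ω B hB hb
    exact ⟨∑ k, n k, by simp [superposition, hn]⟩

/-- Le Cam's argument: each user's count vector is replaced by a Poisson vector of the same mean,
and independent sums turn into convolutions along which the errors add. -/
lemma tvLe_partitionMass_superposition {Ω : Type*} [MeasurableSpace Ω] {P : Measure Ω}
    [IsProbabilityMeasure P] {K : ℕ} {Φ : Fin K → Ω → Measure ℝ}
    (hΦ : ∀ k, IsPointProcess (Φ k)) (hind : iIndepFun Φ P) {B : Set ℝ} (hB : MeasurableSet B)
    (hb : Bornology.IsBounded B) (hfin : ∀ k, ∫⁻ ω, Φ k ω B ∂P ≠ ∞) {n : ℕ} {f : ℝ → Fin n}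
    (hf : Measurable f) :
    TVLe (P.map fun ω => partitionMass f ((superposition Φ ω).restrict B))
      (poissonVec fun i => ∑ k, (∫⁻ ω, partitionMass f ((Φ k ω).restrict B) i ∂P).toNNReal)
      (∑ k, ((∫⁻ ω, Φ k ω B ∂P) ^ 2 + 2 * ∫⁻ ω in {ω | 2 ≤ Φ k ω B}, Φ k ω B ∂P)) := by
  classical
  set X : Fin K → Ω → Fin n → ℝ≥0∞ := fun k ω => partitionMass f ((Φ k ω).restrict B) with hX
  have hXm0 : Measurable fun φ : Measure ℝ => partitionMass f (φ.restrict B) :=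
    (measurable_partitionMass hf).comp (measurable_restrict_measure hB)
  have hXm : ∀ k, Measurable (X k) := fun k => hXm0.comp (hΦ k).measurable
  have hXind : iIndepFun X P := hind.comp (fun _ φ => partitionMass f (φ.restrict B)) fun _ => hXm0
  have hXi : ∀ k ω i, X k ω i = Φ k ω (f ⁻¹' {i} ∩ B) := fun k ω i =>
    Measure.restrict_apply (hf (measurableSet_singleton i))
  have hsum : ∀ k ω, ∑ i, X k ω i = Φ k ω B := by
    intro k ω
    simp only [hXi]
    rw [← measure_biUnion_finset]
    · congr 1; ext x; simp
    · intro i _ j _ hij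
      rw [Function.onFun, Set.disjoint_left]
      rintro x ⟨hx, -⟩ ⟨hx', -⟩
      exact hij (hx.symm.trans hx')
    · exact fun i _ => (hf (measurableSet_singleton i)).inter hB
  set θ : Fin K → Fin n → ℝ≥0 := fun k i => (∫⁻ ω, X k ω i ∂P).toNNReal with hθ
  have hθi : ∀ k i, ∫⁻ ω, X k ω i ∂P = θ k i := by
    intro k i
    refine (ENNReal.coe_toNNReal (ne_top_of_le_ne_top (hfin k) ?_)).symm
    refine lintegral_mono fun ω => ?_
    rw [← hsum k ω]
    exact Finset.single_le_sum (fun _ _ => zero_le) (Finset.mem_univ i)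
  have hθs : ∀ k, ((∑ i, θ k i : ℝ≥0) : ℝ≥0∞) = ∫⁻ ω, Φ k ω B ∂P := by
    intro k
    push_cast
    simp only [← hθi, ← hsum]
    exact (lintegral_finsetSum _ fun i _ => (measurable_pi_apply i).comp (hXm k)).symm
  have hstep : ∀ k, TVLe (P.map (X k)) (poissonVec (θ k))
      ((∫⁻ ω, Φ k ω B ∂P) ^ 2 + 2 * ∫⁻ ω in {ω | 2 ≤ Φ k ω B}, Φ k ω B ∂P) := by
    intro k
    have := tvLe_poissonVec_of_counts (P := P) (hXm k)
      (fun ω i => by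
        rw [hXi]
        exact (hΦ k).counting ω _ ((hf (measurableSet_singleton i)).inter hB)
          (hb.subset Set.inter_subset_right)) (θ k) (hθi k) le_rfl
    rw [hθs] at this
    simpa only [hsum] using this
  -- Induction over sets of users: the user that is added is independent of the sum of those already
  -- treated.
  have key : ∀ s : Finset (Fin K), TVLe (P.map (∑ k ∈ s, X k)) (poissonVec (∑ k ∈ s, θ k))
      (∑ k ∈ s, ((∫⁻ ω, Φ k ω B ∂P) ^ 2 + 2 * ∫⁻ ω in {ω | 2 ≤ Φ k ω B}, Φ k ω B ∂P)) := by
    intro s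
    induction s using Finset.induction_on with
    | empty =>
      have h1 : P.map (0 : Ω → Fin n → ℝ≥0∞) = Measure.dirac 0 := by
        refine (Measure.map_const P (0 : Fin n → ℝ≥0∞)).trans ?_
        simp
      simp only [Finset.sum_empty, h1]
      simpa using tvLe_dirac_poissonVec (0 : Fin n → ℝ≥0)
    | insert k s hk ih =>
      have hsm : Measurable (∑ k ∈ s, X k) := by
        convert! Finset.measurable_sum s fun k _ => hXm k
        simp
      rw [Finset.sum_insert hk, Finset.sum_insert hk, Finset.sum_insert hk,
        IndepFun.map_add_eq_map_conv_map (hXm k) hsm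
          (hXind.indepFun_finsetSum_of_notMem hXm hk).symm, poissonVec_add]
      have : IsProbabilityMeasure (P.map (∑ k ∈ s, X k)) :=
        Measure.isProbabilityMeasure_map hsm.aemeasurable
      have : IsProbabilityMeasure (P.map (X k)) :=
        Measure.isProbabilityMeasure_map (hXm k).aemeasurable
      exact (hstep k).conv ih
  have h3 : (fun ω => partitionMass f ((superposition Φ ω).restrict B)) = ∑ k, X k := by
    funext ω i
    simp only [Finset.sum_apply, hXi, partitionMass,
      Measure.restrict_apply (hf (measurableSet_singleton i)), superposition,
      Measure.coe_finsetSum]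
  have h4 : (fun i => ∑ k, θ k i) = ∑ k, θ k := by
    funext i; simp
  rw [h3, h4]
  exact key Finset.univ

lemma IsPoisson.map_apply_eq {Ω : Type*} [MeasurableSpace Ω] {P : Measure Ω}
    [IsProbabilityMeasure P] {Φ : Ω → Measure ℝ} {lam : ℝ} (hΦ : IsPoisson P Φ lam)
    (hlam : 0 ≤ lam) {B : Set ℝ} (hB : MeasurableSet B) (hb : Bornology.IsBounded B) :
    P.map (fun ω => massNat (Φ ω B)) =
      poissonMeasure (lam.toNNReal * (volume B).toNNReal) := by
  have hm : Measurable fun ω => massNat (Φ ω B) :=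
    measurable_massNat.comp (hΦ.pointProcess.measurable_apply hB)
  refine Measure.ext_iff_singleton.2 fun j => ?_
  rw [Measure.map_apply hm (measurableSet_singleton j), poissonMeasure_singleton]
  have : (fun ω => massNat (Φ ω B)) ⁻¹' {j} = {ω | Φ ω B = j} := by
    ext ω
    obtain ⟨n, hn⟩ := hΦ.pointProcess.counting ω B hB hb
    simp [hn]
  rw [this, hΦ.law B hB hb j]
  congr 1
  have : ((lam.toNNReal * (volume B).toNNReal : ℝ≥0) : ℝ) = lam * volume.real B := by
    push_cast
    rw [Real.coe_toNNReal _ hlam]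
    rfl
  rw [this]

lemma IsPoisson.map_partitionMass {Ω : Type*} [MeasurableSpace Ω] {P : Measure Ω}
    [IsProbabilityMeasure P] {Φ : Ω → Measure ℝ} {lam : ℝ} (hΦ : IsPoisson P Φ lam)
    (hlam : 0 ≤ lam) {B : Set ℝ} (hB : MeasurableSet B) (hb : Bornology.IsBounded B)
    {n : ℕ} {f : ℝ → Fin n} (hf : Measurable f) :
    P.map (fun ω => partitionMass f ((Φ ω).restrict B)) =
      poissonVec fun i => lam.toNNReal * (volume (f ⁻¹' {i} ∩ B)).toNNReal := by
  have hm : ∀ i, MeasurableSet (f ⁻¹' {i} ∩ B) := fun i =>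
    (hf (measurableSet_singleton i)).inter hB
  have hbi : ∀ i, Bornology.IsBounded (f ⁻¹' {i} ∩ B) := fun i => hb.subset Set.inter_subset_right
  have hi := hΦ.indep n (fun i => f ⁻¹' {i} ∩ B) hm hbi (by
    intro i j hij
    rw [Set.disjoint_left]
    rintro x ⟨hx, -⟩ ⟨hx', -⟩
    exact hij (hx.symm.trans hx'))
  rw [iIndepFun_iff_map_fun_eq_pi_map
    fun i => (hΦ.pointProcess.measurable_apply (hm i)).aemeasurable] at hi
  have h1 : (fun ω => partitionMass f ((Φ ω).restrict B)) = fun ω i => Φ ω (f ⁻¹' {i} ∩ B) := by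
    funext ω i
    exact Measure.restrict_apply (hf (measurableSet_singleton i))
  rw [h1, hi, poissonVec]
  congr 1
  funext i
  have hmN : Measurable fun ω => massNat (Φ ω (f ⁻¹' {i} ∩ B)) :=
    measurable_massNat.comp (hΦ.pointProcess.measurable_apply (hm i))
  rw [← hΦ.map_apply_eq hlam (hm i) (hbi i), Measure.map_map (by fun_prop) hmN]
  congr 1
  funext ω
  exact ((hΦ.pointProcess.counting ω).cast_massNat (hm i) (hbi i)).symm

/-- Poisson approximation on a bounded window: a superposition of independent point processes with
intensity `ℓ` against the Poisson process of intensity `lam`. -/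
lemma tvLe_restrict_superposition {Ω Ω' : Type*} [MeasurableSpace Ω] [MeasurableSpace Ω']
    {P : Measure Ω} [IsProbabilityMeasure P] {P' : Measure Ω'} [IsProbabilityMeasure P'] {K : ℕ}
    {Φ : Fin K → Ω → Measure ℝ} (hΦ : ∀ k, IsPointProcess (Φ k)) (hind : iIndepFun Φ P)
    {Φ' : Ω' → Measure ℝ} {lam : ℝ} (hlam : 0 ≤ lam) (hΦ' : IsPoisson P' Φ' lam) {ℓ : ℝ≥0}
    (hℓ : ∀ s, MeasurableSet s → ∫⁻ ω, superposition Φ ω s ∂P = ℓ * volume s)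
    {B : Set ℝ} (hB : MeasurableSet B) (hb : Bornology.IsBounded B) :
    TVLe (P.map fun ω => (superposition Φ ω).restrict B) (P'.map fun ω => (Φ' ω).restrict B)
      (∑ k, ((∫⁻ ω, Φ k ω B ∂P) ^ 2 + 2 * ∫⁻ ω in {ω | 2 ≤ Φ k ω B}, Φ k ω B ∂P)
        + edist ℓ lam.toNNReal * volume B) := by
  have hm1 : Measurable fun ω => (superposition Φ ω).restrict B :=
    (measurable_restrict_measure hB).comp (isPointProcess_superposition hΦ).measurable
  have hm2 : Measurable fun ω => (Φ' ω).restrict B :=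
    (measurable_restrict_measure hB).comp hΦ'.pointProcess.measurable
  have := Measure.isProbabilityMeasure_map (μ := P) hm1.aemeasurable
  have := Measure.isProbabilityMeasure_map (μ := P') hm2.aemeasurable
  have hsumint : ∀ s, MeasurableSet s → ∑ k, ∫⁻ ω, Φ k ω s ∂P = ℓ * volume s := by
    intro s hs
    rw [← hℓ s hs, ← lintegral_finsetSum _ fun k _ => (hΦ k).measurable_apply hs]
    simp [superposition]
  have hvB : volume B ≠ ∞ := hb.measure_lt_top.ne
  refine tvLe_of_partition fun n f hf => ?_
  rw [Measure.map_map (measurable_partitionMass hf) hm1,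
    Measure.map_map (measurable_partitionMass hf) hm2]
  have hmi : ∀ i, MeasurableSet (f ⁻¹' {i} ∩ B) := fun i =>
    (hf (measurableSet_singleton i)).inter hB
  have hvi : ∀ i, volume (f ⁻¹' {i} ∩ B) ≠ ∞ := fun i =>
    ne_top_of_le_ne_top hvB (measure_mono Set.inter_subset_right)
  have hfin : ∀ s, MeasurableSet s → volume s ≠ ∞ → ∀ k, ∫⁻ ω, Φ k ω s ∂P ≠ ∞ := by
    intro s hs hv k
    refine ne_top_of_le_ne_top (ENNReal.mul_ne_top (ENNReal.coe_ne_top (r := ℓ)) hv) ?_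
    rw [← hsumint s hs]
    exact Finset.single_le_sum (f := fun k => ∫⁻ ω, Φ k ω s ∂P) (fun _ _ => zero_le)
      (Finset.mem_univ k)
  refine (tvLe_partitionMass_superposition hΦ hind hB hb (hfin B hB hvB) hf).trans ?_
  have hP := hΦ'.map_partitionMass hlam hB hb hf
  change TVLe _ (P'.map fun ω => partitionMass f ((Φ' ω).restrict B)) _
  rw [hP]
  -- The Poisson means given by the user-by-user comparison add up to the mean measure of the
  -- superposition, which is `ℓ` times volume.
  have hθ : (fun i => ∑ k, (∫⁻ ω, partitionMass f ((Φ k ω).restrict B) i ∂P).toNNReal)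
      = fun i => ℓ * (volume (f ⁻¹' {i} ∩ B)).toNNReal := by
    funext i
    simp only [partitionMass, Measure.restrict_apply (hf (measurableSet_singleton i))]
    rw [← ENNReal.toNNReal_sum fun k _ => hfin _ (hmi i) (hvi i) k, hsumint _ (hmi i),
      ENNReal.toNNReal_mul, ENNReal.toNNReal_coe]
  rw [hθ]
  have hvs : ∑ i, (volume (f ⁻¹' {i} ∩ B)).toNNReal = (volume B).toNNReal := by
    rw [← ENNReal.toNNReal_sum fun i _ => hvi i, ← measure_biUnion_finset]
    · congr 2; ext x; simp
    · intro i _ j _ hij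
      rw [Function.onFun, Set.disjoint_left]
      rintro x ⟨hx, -⟩ ⟨hx', -⟩
      exact hij (hx.symm.trans hx')
    · exact fun i _ => hmi i
  have hδ : edist ℓ lam.toNNReal * volume B =
      ((nndist ℓ lam.toNNReal * (volume B).toNNReal : ℝ≥0) : ℝ≥0∞) := by
    rw [edist_nndist, ENNReal.coe_mul, ENNReal.coe_toNNReal hvB]
  rw [hδ]
  have htri : ∀ x y : ℝ≥0, x ≤ y + nndist x y := by
    intro x y
    rw [← NNReal.coe_le_coe]
    push_cast
    rw [NNReal.dist_eq]
    linarith [le_abs_self ((x : ℝ) - y)]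
  apply tvLe_poissonVec
  -- Both mean vectors are multiples of the vector of volumes, so they are ordered coordinatewise.
  · rcases le_total ℓ lam.toNNReal with h | h
    · exact Or.inl fun i => by dsimp only; gcongr
    · exact Or.inr fun i => by dsimp only; gcongr
  · rw [← Finset.mul_sum, ← Finset.mul_sum, hvs, ← add_mul]
    gcongr
    exact htri _ _
  · rw [← Finset.mul_sum, ← Finset.mul_sum, hvs, ← add_mul, nndist_comm]
    gcongr
    exact htri _ _

/-! ### Workload and idle time in slotted time

A sequence `x` lists the work brought in the slots of length `h` that precede a given time, the
most recent slot first. -/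

/-- The sequence without its first `l` terms. -/
def dropSeq {α : Type*} (l : ℕ) (x : ℕ → α) : ℕ → α := fun n => x (n + l)

@[simp] lemma dropSeq_apply {α : Type*} (l : ℕ) (x : ℕ → α) (n : ℕ) :
    dropSeq l x n = x (n + l) := rfl

@[simp] lemma dropSeq_zero {α : Type*} (x : ℕ → α) : dropSeq 0 x = x := rfl

lemma measurable_dropSeq {α : Type*} [MeasurableSpace α] (l : ℕ) :
    Measurable (dropSeq l : (ℕ → α) → ℕ → α) :=
  measurable_pi_lambda _ fun n => measurable_pi_apply (n + l)

lemma dropSeq_dropSeq {α : Type*} (l m : ℕ) (x : ℕ → α) :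
    dropSeq l (dropSeq m x) = dropSeq (l + m) x := by
  funext n; simp [add_assoc]

lemma measurePreserving_dropSeq {α : Type*} [MeasurableSpace α] {Q : Measure (ℕ → α)}
    (hQ : MeasurePreserving (dropSeq 1) Q Q) (l : ℕ) : MeasurePreserving (dropSeq l) Q Q := by
  induction l with
  | zero => exact MeasurePreserving.id Q
  | succ l ih =>
    convert! ih.comp hQ using 1

/-- The work brought in the first `k` slots. -/
def cumWork (x : ℕ → ℝ≥0∞) (k : ℕ) : ℝ≥0∞ := ∑ l ∈ Finset.range k, x l

/-- The final workload when the server starts empty `u` slots before the end. -/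
def load (h : ℝ≥0) (u : ℕ) (x : ℕ → ℝ≥0∞) : ℝ≥0∞ :=
  (Finset.range (u + 1)).sup fun k => cumWork x k - k * h

/-- The final workload in the two-sided regime. -/
def loadInf (h : ℝ≥0) (x : ℕ → ℝ≥0∞) : ℝ≥0∞ := ⨆ u, load h u x

/-- The idle time of the last slot when the server starts empty `u` slots before it. -/
def idle (h : ℝ≥0) (u : ℕ) (x : ℕ → ℝ≥0∞) : ℝ≥0∞ := h - (x 0 + load h u (dropSeq 1 x))

/-- The idle time of the last slot in the two-sided regime. -/
def idleInf (h : ℝ≥0) (x : ℕ → ℝ≥0∞) : ℝ≥0∞ := h - (x 0 + loadInf h (dropSeq 1 x))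

section Lindley

variable {h : ℝ≥0} {u : ℕ} {x : ℕ → ℝ≥0∞}

lemma cumWork_succ' (x : ℕ → ℝ≥0∞) (k : ℕ) :
    cumWork x (k + 1) = x 0 + cumWork (dropSeq 1 x) k := by
  simp only [cumWork, Finset.sum_range_succ', dropSeq_apply]
  exact add_comm _ _

lemma cumWork_mono (x : ℕ → ℝ≥0∞) : Monotone (cumWork x) := fun _ _ hkl =>
  Finset.sum_le_sum_of_subset (Finset.range_mono hkl)

lemma load_mono (h : ℝ≥0) (x : ℕ → ℝ≥0∞) : Monotone fun u => load h u x := fun _ _ huv =>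
  Finset.sup_mono (Finset.range_mono (Nat.succ_le_succ huv))

lemma load_le_cumWork (h : ℝ≥0) (u : ℕ) (x : ℕ → ℝ≥0∞) : load h u x ≤ cumWork x u :=
  Finset.sup_le fun _ hk => tsub_le_self.trans
    (cumWork_mono x (Nat.lt_succ_iff.1 (Finset.mem_range.1 hk)))

lemma load_le_loadInf (h : ℝ≥0) (u : ℕ) (x : ℕ → ℝ≥0∞) : load h u x ≤ loadInf h x :=
  le_iSup (fun u => load h u x) u

lemma cumWork_sub_le_load {k : ℕ} (hk : k ≤ u) : cumWork x k - k * h ≤ load h u x :=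
  Finset.le_sup (f := fun k => cumWork x k - k * h) (Finset.mem_range.2 (Nat.lt_succ_of_le hk))

lemma cumWork_sub_le_loadInf (h : ℝ≥0) (x : ℕ → ℝ≥0∞) (k : ℕ) :
    cumWork x k - k * h ≤ loadInf h x :=
  (cumWork_sub_le_load le_rfl).trans (load_le_loadInf h k x)

@[simp] lemma load_zero (h : ℝ≥0) (x : ℕ → ℝ≥0∞) : load h 0 x = 0 := by
  simp [load, cumWork]

/-- Lindley's recursion. Truncated subtraction plays the role of the positive part; the `k = 0` term
of the supremum is the case of an empty server. -/
lemma load_succ (h : ℝ≥0) (u : ℕ) (x : ℕ → ℝ≥0∞) :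
    load h (u + 1) x = (x 0 + load h u (dropSeq 1 x)) - h := by
  apply le_antisymm
  · refine Finset.sup_le fun k hk => ?_
    rcases k with _ | k
    · simp [cumWork]
    · rw [Finset.mem_range] at hk
      rw [cumWork_succ']
      push_cast
      rw [add_mul, one_mul, ← tsub_tsub]
      gcongr
      refine add_tsub_le_assoc.trans ?_
      gcongr
      exact cumWork_sub_le_load (by omega)
  · rw [tsub_le_iff_right]
    obtain ⟨k, hk, hk'⟩ := Finset.exists_mem_eq_sup (Finset.range (u + 1)) (by simp)
      fun k => cumWork (dropSeq 1 x) k - k * h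
    rw [Finset.mem_range] at hk
    rw [load.eq_def h u, hk']
    -- Truncation breaks additivity when the maximal term is zero. In that case the older load
    -- vanishes and the term `k = 1` already gives the bound.
    rcases le_total (cumWork (dropSeq 1 x) k) (k * h) with hc | hc
    · rw [tsub_eq_zero_of_le hc, add_zero, ← tsub_le_iff_right]
      refine le_trans ?_ (cumWork_sub_le_load (k := 1) (by omega))
      simp [cumWork]
    · rw [← AddLECancellable.add_tsub_assoc_of_le
        (ENNReal.addLECancellable_iff_ne.2 (ENNReal.mul_ne_top (by simp) (by simp))) hc,
        ← tsub_le_iff_right, tsub_tsub, ← cumWork_succ']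
      refine le_trans (le_of_eq ?_) (cumWork_sub_le_load (k := k + 1) (by omega))
      push_cast
      rw [add_mul, one_mul]

/-- Work balance of one slot: both sides equal the maximum of `h` and the work available. -/
lemma load_conservation (h : ℝ≥0) (u : ℕ) (x : ℕ → ℝ≥0∞) :
    load h (u + 1) x + h = x 0 + load h u (dropSeq 1 x) + idle h u x := by
  rw [load_succ, idle, tsub_add_eq_max, add_tsub_eq_max]

lemma loadInf_eq (h : ℝ≥0) (x : ℕ → ℝ≥0∞) :
    loadInf h x = (x 0 + loadInf h (dropSeq 1 x)) - h := by
  have h1 : loadInf h x = ⨆ u, load h (u + 1) x :=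
    ((load_mono h x).iSup_nat_add 1).symm
  simp only [h1, load_succ]
  rw [← ENNReal.iSup_sub, ← ENNReal.add_iSup, loadInf]

lemma loadInf_conservation (h : ℝ≥0) (x : ℕ → ℝ≥0∞) :
    loadInf h x + h = x 0 + loadInf h (dropSeq 1 x) + idleInf h x := by
  rw [loadInf_eq, idleInf, tsub_add_eq_max, add_tsub_eq_max]

/-- The one-slot balances telescope. The additive form stays meaningful when the two-sided load is
infinite. -/
lemma sum_idleInf (h : ℝ≥0) (x : ℕ → ℝ≥0∞) (L : ℕ) :
    loadInf h x + L * h = cumWork x L + loadInf h (dropSeq L x) +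
      ∑ l ∈ Finset.range L, idleInf h (dropSeq l x) := by
  induction L with
  | zero => simp [cumWork]
  | succ L ih =>
    have h1 := loadInf_conservation h (dropSeq L x)
    rw [dropSeq_dropSeq, add_comm 1 L, dropSeq_apply, zero_add] at h1
    push_cast
    rw [add_mul, one_mul, ← add_assoc, ih, add_right_comm, add_assoc (cumWork x L), h1,
      Finset.sum_range_succ, cumWork, cumWork, Finset.sum_range_succ]
    ring

lemma idle_le (h : ℝ≥0) (u : ℕ) (x : ℕ → ℝ≥0∞) : idle h u x ≤ h := tsub_le_self

lemma idleInf_le (h : ℝ≥0) (x : ℕ → ℝ≥0∞) : idleInf h x ≤ h := tsub_le_self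

lemma idleInf_le_idle (h : ℝ≥0) (u : ℕ) (x : ℕ → ℝ≥0∞) : idleInf h x ≤ idle h u x := by
  unfold idleInf idle
  gcongr
  exact load_le_loadInf _ _ _

lemma tendsto_idle (h : ℝ≥0) (x : ℕ → ℝ≥0∞) :
    Tendsto (fun u => idle h u x) atTop (𝓝 (idleInf h x)) := by
  unfold idle idleInf
  refine ENNReal.Tendsto.sub tendsto_const_nhds ?_ (Or.inl ENNReal.coe_ne_top)
  exact tendsto_const_nhds.add (tendsto_atTop_iSup (load_mono h _))

lemma measurable_cumWork (k : ℕ) : Measurable fun x => cumWork x k := by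
  unfold cumWork; fun_prop

lemma measurable_load (h : ℝ≥0) (u : ℕ) : Measurable (load h u) := by
  induction u with
  | zero => simp [funext (load_zero h)]
  | succ u ih =>
    have : load h (u + 1) = fun x => max (cumWork x (u + 1) - (u + 1 : ℕ) * h) (load h u x) := by
      funext x
      rw [load, Finset.range_add_one, Finset.sup_insert]
      rfl
    rw [this]
    exact ((measurable_cumWork (u + 1)).sub_const _).max ih

lemma measurable_loadInf (h : ℝ≥0) : Measurable (loadInf h) := by
  unfold loadInf
  exact Measurable.iSup fun u => measurable_load h u

lemma measurable_idle (h : ℝ≥0) (u : ℕ) : Measurable (idle h u) :=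
  measurable_const.sub ((measurable_pi_apply 0).add
    ((measurable_load h u).comp (measurable_dropSeq 1)))

lemma measurable_idleInf (h : ℝ≥0) : Measurable (idleInf h) :=
  measurable_const.sub ((measurable_pi_apply 0).add
    ((measurable_loadInf h).comp (measurable_dropSeq 1)))

/-! ### Mean idle times under a shift-invariant law -/

variable {Q : Measure (ℕ → ℝ≥0∞)}

lemma lintegral_cumWork (hQ : MeasurePreserving (dropSeq 1) Q Q) (n : ℕ) :
    ∫⁻ x, cumWork x n ∂Q = n * ∫⁻ x, x 0 ∂Q := by
  have : ∀ l, ∫⁻ x, x l ∂Q = ∫⁻ x, x 0 ∂Q := fun l => by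
    have := (measurePreserving_dropSeq hQ l).lintegral_comp (measurable_pi_apply 0)
    simpa using this
  unfold cumWork
  rw [lintegral_finsetSum _ fun l _ => measurable_pi_apply l]
  simp [this]

/-- Integrate the one-slot balance and sum over the horizon; shift invariance identifies the mean of
the shifted load with that of the load, so the sum telescopes. -/
lemma lintegral_load_conservation [IsProbabilityMeasure Q]
    (hQ : MeasurePreserving (dropSeq 1) Q Q) (n : ℕ) :
    ∫⁻ x, load h n x ∂Q + n * h =
      n * ∫⁻ x, x 0 ∂Q + ∑ u ∈ Finset.range n, ∫⁻ x, idle h u x ∂Q := by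
  induction n with
  | zero => simp
  | succ n ih =>
    have h1 : ∫⁻ x, load h (n + 1) x ∂Q + h =
        ∫⁻ x, x 0 ∂Q + ∫⁻ x, load h n x ∂Q + ∫⁻ x, idle h n x ∂Q := by
      have h2 : ∫⁻ x, (load h (n + 1) x + h) ∂Q = ∫⁻ x, load h (n + 1) x ∂Q + h := by
        rw [lintegral_add_right _ measurable_const]; simp
      rw [← h2]
      simp only [load_conservation]
      rw [lintegral_add_right _ (measurable_idle h n), lintegral_add_left (measurable_pi_apply 0),
        hQ.lintegral_comp (measurable_load h n)]
    push_cast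
    rw [add_mul, add_mul, one_mul, one_mul, add_comm (_ * _) (h : ℝ≥0∞), ← add_assoc, h1,
      Finset.sum_range_succ, add_right_comm (∫⁻ x, x 0 ∂Q + _), add_assoc (∫⁻ x, x 0 ∂Q), ih]
    ring

lemma tendsto_lintegral_idle [IsProbabilityMeasure Q] (h : ℝ≥0) :
    Tendsto (fun u => ∫⁻ x, idle h u x ∂Q) atTop (𝓝 (∫⁻ x, idleInf h x ∂Q)) :=
  tendsto_lintegral_of_dominated_convergence (fun _ => h) (fun u => measurable_idle h u)
    (fun u => ae_of_all _ fun x => idle_le h u x) (by simp)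
    (ae_of_all _ fun x => tendsto_idle h x)

lemma lintegral_idle_le [IsProbabilityMeasure Q] (h : ℝ≥0) (u : ℕ) :
    ∫⁻ x, idle h u x ∂Q ≤ h :=
  (lintegral_mono fun x => idle_le h u x).trans (by simp)

lemma lintegral_idleInf_le [IsProbabilityMeasure Q] (h : ℝ≥0) :
    ∫⁻ x, idleInf h x ∂Q ≤ h :=
  (lintegral_mono fun x => idleInf_le h x).trans (by simp)

/-- The mean idle times of the finite-horizon regimes, averaged over the horizon. -/
lemma tendsto_average_idle [IsProbabilityMeasure Q] (h : ℝ≥0) :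
    Tendsto (fun n : ℕ => (n : ℝ)⁻¹ * ∑ u ∈ Finset.range n, (∫⁻ x, idle h u x ∂Q).toReal) atTop
      (𝓝 (∫⁻ x, idleInf h x ∂Q).toReal) :=
  ((ENNReal.tendsto_toReal (ne_top_of_le_ne_top ENNReal.coe_ne_top
    (lintegral_idleInf_le h))).comp (tendsto_lintegral_idle h)).cesaro

/-- The mean balance per slot, in real numbers so that limits and differences can be taken. The load
has finite mean, being at most the work brought. -/
lemma toReal_load_conservation [IsProbabilityMeasure Q]
    (hQ : MeasurePreserving (dropSeq 1) Q Q) (hm : ∫⁻ x, x 0 ∂Q ≠ ∞) {n : ℕ} (hn : n ≠ 0) :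
    (∫⁻ x, load h n x ∂Q).toReal / n + h = (∫⁻ x, x 0 ∂Q).toReal +
      (n : ℝ)⁻¹ * ∑ u ∈ Finset.range n, (∫⁻ x, idle h u x ∂Q).toReal := by
  have hl : ∫⁻ x, load h n x ∂Q ≠ ∞ := by
    refine ne_top_of_le_ne_top ?_ (lintegral_mono fun x => load_le_cumWork h n x)
    rw [lintegral_cumWork hQ]
    exact ENNReal.mul_ne_top (by simp) hm
  have hi : ∀ u ∈ Finset.range n, ∫⁻ x, idle h u x ∂Q ≠ ∞ := fun u _ =>
    ne_top_of_le_ne_top ENNReal.coe_ne_top (lintegral_idle_le h u)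
  have h1 := congrArg ENNReal.toReal (lintegral_load_conservation (h := h) hQ n)
  rw [ENNReal.toReal_add hl (ENNReal.mul_ne_top (by simp) (by simp)),
    ENNReal.toReal_add (ENNReal.mul_ne_top (by simp) hm) (ENNReal.sum_ne_top.2 hi),
    ENNReal.toReal_sum hi, ENNReal.toReal_mul, ENNReal.toReal_mul] at h1
  simp only [ENNReal.toReal_natCast, ENNReal.coe_toReal] at h1
  have hn' : (n : ℝ) ≠ 0 := by exact_mod_cast hn
  field_simp
  linarith

/-- A stationary server is idle at least during the fraction of time not needed for the work. -/
lemma le_lintegral_idleInf [IsProbabilityMeasure Q] (hQ : MeasurePreserving (dropSeq 1) Q Q)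
    (hm : ∫⁻ x, x 0 ∂Q ≠ ∞) : (h : ℝ≥0∞) ≤ ∫⁻ x, x 0 ∂Q + ∫⁻ x, idleInf h x ∂Q := by
  have hi : ∫⁻ x, idleInf h x ∂Q ≠ ∞ := ne_top_of_le_ne_top ENNReal.coe_ne_top
    (lintegral_idleInf_le h)
  rw [← ENNReal.toReal_le_toReal ENNReal.coe_ne_top (ENNReal.add_ne_top.2 ⟨hm, hi⟩),
    ENNReal.toReal_add hm hi]
  -- In the balance per slot the load term is only known to be nonnegative, and is dropped. Neither
  -- stability nor ergodicity enters, which is why the bound applies to the superpositions.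
  refine ge_of_tendsto ((tendsto_average_idle h).const_add _) ?_
  filter_upwards [eventually_ne_atTop 0] with n hn
  rw [← toReal_load_conservation hQ hm hn, ENNReal.coe_toReal]
  have : 0 ≤ (∫⁻ x, load h n x ∂Q).toReal / n := by positivity
  linarith

/-- Beyond some index the work brought stays below the capacity `n * h`, so only finitely many terms
of the supremum are positive. -/
lemma loadInf_lt_top {m : ℝ≥0∞} (hm : m < h)
    (hx : Tendsto (fun n : ℕ => cumWork x n / n) atTop (𝓝 m)) : loadInf h x < ∞ := by
  have hev := hx.eventually_lt_const hm
  obtain ⟨N, hN⟩ := eventually_atTop.1 hev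
  -- Starting at `N + 1` keeps `n` nonzero when the denominator is cleared.
  have hle : ∀ n, N + 1 ≤ n → cumWork x n ≤ n * h := by
    intro n hn
    have h1 := (hN n (by omega)).le
    rw [ENNReal.div_le_iff (by simp; omega) (by simp)] at h1
    rwa [mul_comm]
  refine lt_of_le_of_lt (iSup_le fun u => Finset.sup_le fun k _ => ?_)
    (ENNReal.mul_lt_top (ENNReal.natCast_lt_top (N + 1)) (ENNReal.coe_lt_top (r := h)))
  rcases le_total (N + 1) k with hk | hk
  · rw [tsub_eq_zero_of_le (hle k hk)]; exact zero_le
  · exact tsub_le_self.trans ((cumWork_mono x hk).trans (hle _ le_rfl))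

/-- In a stable regime with a law of large numbers, the idle time is exactly the fraction of time
not needed for the work. -/
lemma lintegral_idleInf_add_le [IsProbabilityMeasure Q] (hQ : MeasurePreserving (dropSeq 1) Q Q)
    (hm : ∫⁻ x, x 0 ∂Q < h)
    (hlln : ∀ᵐ x ∂Q, Tendsto (fun n : ℕ => cumWork x n / n) atTop (𝓝 (∫⁻ x, x 0 ∂Q))) :
    ∫⁻ x, idleInf h x ∂Q + ∫⁻ x, x 0 ∂Q ≤ h := by
  set m := ∫⁻ x, x 0 ∂Q with hmdef
  have hmt : m ≠ ∞ := hm.ne_top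
  have hi : ∫⁻ x, idleInf h x ∂Q ≠ ∞ := ne_top_of_le_ne_top ENNReal.coe_ne_top
    (lintegral_idleInf_le h)
  -- By the mean balance, `r` is the limit of the mean load per slot; what has to be shown is `r ≤
  -- 0`.
  set r : ℝ := m.toReal + (∫⁻ x, idleInf h x ∂Q).toReal - h with hr
  have hlt : Tendsto (fun n : ℕ => (∫⁻ x, load h n x ∂Q).toReal / n) atTop (𝓝 r) := by
    refine (((tendsto_average_idle h).const_add m.toReal).sub_const (h : ℝ)).congr' ?_
    filter_upwards [eventually_ne_atTop 0] with n hn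
    rw [← toReal_load_conservation hQ hmt hn]
    ring
  have hload : ∀ n, ∫⁻ x, load h n x ∂Q ≤ n * m := fun n => by
    rw [← lintegral_cumWork hQ]
    exact lintegral_mono fun x => load_le_cumWork h n x
  have hloadt : ∀ n, ∫⁻ x, load h n x ∂Q ≠ ∞ := fun n =>
    ne_top_of_le_ne_top (ENNReal.mul_ne_top (by simp) hmt) (hload n)
  -- the work done, per slot
  let f : ℕ → (ℕ → ℝ≥0∞) → ℝ≥0∞ := fun n x => (cumWork x n - load h n x) / n
  have hf : ∀ n, Measurable (f n) := fun n =>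
    ((measurable_cumWork n).sub (measurable_load h n)).div_const _
  have hfint : ∀ n : ℕ, n ≠ 0 → ∫⁻ x, f n x ∂Q
      = ENNReal.ofReal (m.toReal - (∫⁻ x, load h n x ∂Q).toReal / n) := by
    intro n hn
    have hn0 : (n : ℝ≥0∞) ≠ 0 := by exact_mod_cast hn
    have hsub : Measurable fun x => cumWork x n - load h n x :=
      (measurable_cumWork n).sub (measurable_load h n)
    simp only [f, div_eq_mul_inv]
    rw [lintegral_mul_const _ hsub,
      lintegral_sub (measurable_load h n) (hloadt n)
        (ae_of_all _ fun x => load_le_cumWork h n x), lintegral_cumWork hQ, ← hmdef,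
      ← ENNReal.ofReal_toReal (a := (_ - _) * _)]
    · rw [ENNReal.toReal_mul, ENNReal.toReal_sub_of_le (hload n)
        (ENNReal.mul_ne_top (by simp) hmt), ENNReal.toReal_mul, ENNReal.toReal_inv]
      simp only [ENNReal.toReal_natCast]
      have hn' : (n : ℝ) ≠ 0 := by exact_mod_cast hn
      congr 1
      field_simp
    · refine ENNReal.mul_ne_top (ne_top_of_le_ne_top ?_ tsub_le_self) (ENNReal.inv_ne_top.2 hn0)
      exact ENNReal.mul_ne_top (by simp) hmt
  have hflim : Tendsto (fun n => ∫⁻ x, f n x ∂Q) atTop (𝓝 (ENNReal.ofReal (m.toReal - r))) := by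
    refine ((ENNReal.continuous_ofReal.tendsto _).comp (hlt.const_sub m.toReal)).congr' ?_
    filter_upwards [eventually_ne_atTop 0] with n hn
    exact (hfint n hn).symm
  have hfae : ∀ᵐ x ∂Q, liminf (fun n => f n x) atTop = m := by
    filter_upwards [hlln] with x hx
    refine Tendsto.liminf_eq ?_
    have hlx := loadInf_lt_top hm hx
    have h0 : Tendsto (fun n : ℕ => load h n x / n) atTop (𝓝 0) := by
      have h1 : Tendsto (fun n : ℕ => loadInf h x / n) atTop (𝓝 0) := by
        have := ENNReal.Tendsto.const_div (a := loadInf h x) ENNReal.tendsto_nat_nhds_top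
          (Or.inr hlx.ne)
        simpa using this
      refine tendsto_of_tendsto_of_tendsto_of_le_of_le tendsto_const_nhds h1 (fun n => zero_le)
        fun n => ?_
      dsimp only
      gcongr
      exact load_le_loadInf _ _ _
    have h2 := ENNReal.Tendsto.sub hx h0 (Or.inl hmt)
    rw [tsub_zero] at h2
    refine h2.congr' ?_
    filter_upwards [eventually_ne_atTop 0] with n hn
    exact (ENNReal.sub_div fun _ _ => by exact_mod_cast hn).symm
  -- The work done per slot converges almost surely to `m`, because the load is almost surely
  -- bounded. Its mean converges to `m - r`, so Fatou's lemma leaves no room for `r > 0`.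
  have hfatou := lintegral_liminf_le (μ := Q) (u := atTop) hf
  rw [lintegral_congr_ae hfae, hflim.liminf_eq, lintegral_const, measure_univ, mul_one] at hfatou
  have hr0 : 0 ≤ r := ge_of_tendsto' hlt fun n => by positivity
  have hr1 : r ≤ 0 := by
    -- If `ENNReal.ofReal` truncates, Fatou gives `m = 0`; then no work arrives and all mean loads
    -- vanish.
    rcases le_total (m.toReal - r) 0 with h1 | h1
    · rw [ENNReal.ofReal_of_nonpos h1] at hfatou
      refine le_of_eq (tendsto_nhds_unique hlt ?_)
      have hm0 : m = 0 := le_antisymm hfatou zero_le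
      have : ∀ n : ℕ, (∫⁻ x, load h n x ∂Q).toReal / n = 0 := fun n => by
        have := hload n
        rw [hm0, mul_zero] at this
        rw [le_antisymm this zero_le]
        simp
      simp only [this]
      exact tendsto_const_nhds
    · have := (ENNReal.le_ofReal_iff_toReal_le hmt h1).1 hfatou
      linarith
  rw [← ENNReal.toReal_le_toReal (ENNReal.add_ne_top.2 ⟨hi, hmt⟩) ENNReal.coe_ne_top,
    ENNReal.toReal_add hi hmt, ENNReal.coe_toReal]
  linarith

end Lindley

/-! ### Arrival times -/

section Arrivals

variable {φ φ' : Measure ℝ}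

/-- Continuity from above; it shows that the infimum defining an arrival time is attained. -/
lemma le_measure_Ioc_of_forall_lt (hfin : ∀ a b, φ (Set.Icc a b) < ∞) {c : ℝ≥0∞} {t : ℝ}
    (h : ∀ s, t < s → c ≤ φ (Set.Ioc 0 s)) : c ≤ φ (Set.Ioc 0 t) := by
  have hI : ⋂ k : ℕ, Set.Ioc 0 (t + 1 / (k + 1 : ℝ)) = Set.Ioc 0 t := by
    ext x
    simp only [Set.mem_iInter, Set.mem_Ioc]
    constructor
    · intro hx
      refine ⟨(hx 0).1, ?_⟩
      have := tendsto_one_div_add_atTop_nhds_zero_nat (𝕜 := ℝ) |>.const_add t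
      rw [add_zero] at this
      exact ge_of_tendsto' this fun k => (hx k).2
    · exact fun hx k => ⟨hx.1, hx.2.trans (by linarith [Nat.one_div_pos_of_nat (α := ℝ) (n := k)])⟩
  have ht := tendsto_measure_iInter_atTop (μ := φ)
    (s := fun k : ℕ => Set.Ioc 0 (t + 1 / (k + 1 : ℝ)))
    (fun k => measurableSet_Ioc.nullMeasurableSet)
    (fun k l hkl => Set.Ioc_subset_Ioc_right
      (by have := Nat.one_div_le_one_div (α := ℝ) hkl; linarith))
    ⟨0, ((measure_mono Set.Ioc_subset_Icc_self).trans_lt (hfin _ _)).ne⟩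
  rw [hI] at ht
  exact ge_of_tendsto' ht fun k => h _ (by linarith [Nat.one_div_pos_of_nat (α := ℝ) (n := k)])

lemma le_measure_Icc_of_forall_lt (hfin : ∀ a b, φ (Set.Icc a b) < ∞) {c : ℝ≥0∞} {t : ℝ}
    (h : ∀ s, s < t → c ≤ φ (Set.Icc s 0)) : c ≤ φ (Set.Icc t 0) := by
  have hI : ⋂ k : ℕ, Set.Icc (t - 1 / (k + 1 : ℝ)) 0 = Set.Icc t 0 := by
    ext x
    simp only [Set.mem_iInter, Set.mem_Icc]
    constructor
    · intro hx
      refine ⟨?_, (hx 0).2⟩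
      have := tendsto_one_div_add_atTop_nhds_zero_nat (𝕜 := ℝ) |>.const_sub t
      rw [sub_zero] at this
      exact le_of_tendsto' this fun k => (hx k).1
    · exact fun hx k => ⟨le_trans (by linarith [Nat.one_div_pos_of_nat (α := ℝ) (n := k)]) hx.1,
        hx.2⟩
  have ht := tendsto_measure_iInter_atTop (μ := φ)
    (s := fun k : ℕ => Set.Icc (t - 1 / (k + 1 : ℝ)) 0)
    (fun k => measurableSet_Icc.nullMeasurableSet)
    (fun k l hkl => Set.Icc_subset_Icc_left
      (by have := Nat.one_div_le_one_div (α := ℝ) hkl; linarith))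
    ⟨0, (hfin _ _).ne⟩
  rw [hI] at ht
  exact ge_of_tendsto' ht fun k => h _ (by linarith [Nat.one_div_pos_of_nat (α := ℝ) (n := k)])

lemma exists_le_measure_Icc (hinf : φ (Set.Iic 0) = ∞) (n : ℕ) :
    ∃ t, t ≤ 0 ∧ (n : ℝ≥0∞) ≤ φ (Set.Icc t 0) := by
  have hU : ⋃ k : ℕ, Set.Icc (-(k : ℝ)) 0 = Set.Iic 0 := by
    ext x
    simp only [Set.mem_iUnion, Set.mem_Icc, Set.mem_Iic]
    constructor
    · rintro ⟨k, hk⟩; exact hk.2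
    · intro hx
      obtain ⟨k, hk⟩ := exists_nat_ge (-x)
      exact ⟨k, by linarith, hx⟩
  have ht := tendsto_measure_iUnion_atTop (μ := φ) (s := fun k : ℕ => Set.Icc (-(k : ℝ)) 0)
    (fun k l hkl => Set.Icc_subset_Icc_left (by simpa using hkl))
  rw [hU, hinf] at ht
  obtain ⟨k, hk⟩ := (ht.eventually (lt_mem_nhds (ENNReal.natCast_lt_top n))).exists
  exact ⟨-k, by simp, hk.le⟩

/-- The witness `β` makes the defining set nonempty; otherwise `sInf ∅ = 0` would break the
equivalence. -/
lemma arrivalTime_le_iff (hfin : ∀ a b, φ (Set.Icc a b) < ∞) {i : ℤ} (hi : 1 ≤ i) {β : ℝ}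
    (hβ : (i.toNat : ℝ≥0∞) ≤ φ (Set.Ioc 0 β)) {t : ℝ} (ht : 0 < t) :
    arrivalTime φ i ≤ t ↔ (i.toNat : ℝ≥0∞) ≤ φ (Set.Ioc 0 t) := by
  rw [arrivalTime, if_pos hi]
  have hbdd : BddBelow {t : ℝ | 0 < t ∧ (i.toNat : ℝ≥0∞) ≤ φ (Set.Ioc 0 t)} :=
    ⟨0, fun t ht => ht.1.le⟩
  constructor
  · intro h
    refine le_measure_Ioc_of_forall_lt hfin fun s hs => ?_
    have hne : {t : ℝ | 0 < t ∧ (i.toNat : ℝ≥0∞) ≤ φ (Set.Ioc 0 t)}.Nonempty := by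
      refine ⟨β, ?_, hβ⟩
      by_contra hb
      rw [Set.Ioc_eq_empty (by simpa using hb), measure_empty] at hβ
      have : i.toNat = 0 := by simpa using hβ
      omega
    obtain ⟨t', ht', hlt⟩ := exists_lt_of_csInf_lt hne (h.trans_lt hs)
    exact ht'.2.trans (measure_mono (Set.Ioc_subset_Ioc_right hlt.le))
  · exact fun h => csInf_le hbdd ⟨ht, h⟩

/-- For indices `i ≤ 0` the infinite mass on the left of the origin excludes the default value `sSup
∅ = 0`. -/
lemma le_arrivalTime_iff (hfin : ∀ a b, φ (Set.Icc a b) < ∞) (hinf : φ (Set.Iic 0) = ∞) {i : ℤ}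
    (hi : i ≤ 0) {t : ℝ} (ht : t ≤ 0) :
    t ≤ arrivalTime φ i ↔ ((1 - i).toNat : ℝ≥0∞) ≤ φ (Set.Icc t 0) := by
  rw [arrivalTime, if_neg (by omega)]
  have hbdd : BddAbove {t : ℝ | t ≤ 0 ∧ ((1 - i).toNat : ℝ≥0∞) ≤ φ (Set.Icc t 0)} :=
    ⟨0, fun t ht => ht.1⟩
  constructor
  · intro h
    refine le_measure_Icc_of_forall_lt hfin fun s hs => ?_
    obtain ⟨t', ht', hlt⟩ := exists_lt_of_lt_csSup
      (exists_le_measure_Icc hinf (1 - i).toNat) (hs.trans_le h)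
    exact ht'.2.trans (measure_mono (Set.Icc_subset_Icc_left hlt.le))
  · exact fun h => le_csSup hbdd ⟨ht, h⟩

lemma arrivalTime_nonpos {i : ℤ} (hi : i ≤ 0) : arrivalTime φ i ≤ 0 := by
  rw [arrivalTime, if_neg (by omega)]
  exact Real.sSup_nonpos fun t ht => ht.1

lemma arrivalTime_nonneg {i : ℤ} (hi : 1 ≤ i) : 0 ≤ arrivalTime φ i := by
  rw [arrivalTime, if_pos hi]
  exact Real.sInf_nonneg fun t ht => ht.1.le

lemma arrivalTime_mono (hfin : ∀ a b, φ (Set.Icc a b) < ∞) (hinf : φ (Set.Iic 0) = ∞) {i : ℤ}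
    {β : ℝ} (hβ0 : 0 < β) (hβ : (i.toNat : ℝ≥0∞) ≤ φ (Set.Ioc 0 β)) {m : ℤ} (hm : m ≤ i) :
    arrivalTime φ m ≤ arrivalTime φ i := by
  rcases le_or_gt i 0 with hi | hi
  · have hm0 : m ≤ 0 := hm.trans hi
    rw [le_arrivalTime_iff hfin hinf hi (arrivalTime_nonpos hm0)]
    refine le_trans ?_ ((le_arrivalTime_iff hfin hinf hm0 (arrivalTime_nonpos hm0)).1 le_rfl)
    exact_mod_cast Int.toNat_le_toNat (by omega)
  · rcases le_or_gt m 0 with hm0 | hm0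
    · exact (arrivalTime_nonpos hm0).trans (arrivalTime_nonneg hi)
    · rw [arrivalTime, arrivalTime, if_pos (by omega), if_pos (by omega)]
      refine csInf_le_csInf ⟨0, fun t ht => ht.1.le⟩ ⟨β, hβ0, hβ⟩ fun t ht => ⟨ht.1, ?_⟩
      exact le_trans (by exact_mod_cast Int.toNat_le_toNat hm) ht.2

/-- The arrival times inside a window depend on the restriction to the window only. -/
lemma arrivalTime_eq_or_lt (hfin : ∀ a b, φ (Set.Icc a b) < ∞) (hinf : φ (Set.Iic 0) = ∞)
    (hfin' : ∀ a b, φ' (Set.Icc a b) < ∞) (hinf' : φ' (Set.Iic 0) = ∞) {a b β : ℝ} (ha : a ≤ 0)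
    (hβ0 : 0 < β) (hβb : β < b)
    (heq : ∀ s, MeasurableSet s → s ⊆ Set.Ico a b → φ s = φ' s) {i : ℤ}
    (hβ : (i.toNat : ℝ≥0∞) ≤ φ (Set.Ioc 0 β)) {m : ℤ} (hm : m ≤ i) :
    arrivalTime φ m = arrivalTime φ' m ∨ (arrivalTime φ m < a ∧ arrivalTime φ' m < a) := by
  rcases le_or_gt m 0 with hm0 | hm0
  -- For thresholds `t` in `[a, 0]` the equivalence only involves the mass of `[t, 0]`, which lies
  -- in the window.
  · have key : ∀ t, a ≤ t → t ≤ 0 → (t ≤ arrivalTime φ m ↔ t ≤ arrivalTime φ' m) := by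
      intro t hat ht
      rw [le_arrivalTime_iff hfin hinf hm0 ht, le_arrivalTime_iff hfin' hinf' hm0 ht,
        heq _ measurableSet_Icc fun x hx => ⟨hat.trans hx.1, hx.2.trans_lt (hβ0.trans hβb)⟩]
    rcases le_or_gt a (arrivalTime φ m) with h | h
    · left
      have h' := (key a le_rfl ha).1 h
      exact le_antisymm ((key _ h (arrivalTime_nonpos hm0)).1 le_rfl)
        ((key _ h' (arrivalTime_nonpos hm0)).2 le_rfl)
    · right
      refine ⟨h, ?_⟩
      by_contra hcon
      exact absurd ((key a le_rfl ha).2 (not_lt.1 hcon)) (not_le.2 h)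
  · left
    have hmi : (m.toNat : ℝ≥0∞) ≤ i.toNat := by exact_mod_cast Int.toNat_le_toNat hm
    have hIoc : ∀ t, t < b → φ (Set.Ioc 0 t) = φ' (Set.Ioc 0 t) := fun t ht =>
      heq _ measurableSet_Ioc fun x hx => ⟨ha.trans hx.1.le, hx.2.trans_lt ht⟩
    have hβm := hmi.trans hβ
    have hβm' := hβm
    rw [hIoc β hβb] at hβm'
    have key : ∀ t, 0 < t → t < b → (arrivalTime φ m ≤ t ↔ arrivalTime φ' m ≤ t) := by
      intro t ht htb
      rw [arrivalTime_le_iff hfin hm0 hβm ht, arrivalTime_le_iff hfin' hm0 hβm' ht, hIoc t htb]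
    have h1 : arrivalTime φ m ≤ β := (arrivalTime_le_iff hfin hm0 hβm hβ0).2 hβm
    have h2 : arrivalTime φ' m ≤ β := (arrivalTime_le_iff hfin' hm0 hβm' hβ0).2 hβm'
    -- The counts are known to agree only on `(0, t]` with `t < b`; larger thresholds are settled by
    -- the bound `β < b` on both epochs.
    apply le_antisymm
    · refine le_of_forall_gt_imp_ge_of_dense fun t ht => ?_
      rcases lt_or_ge t b with htb | htb
      · exact (key t ((arrivalTime_nonneg hm0).trans_lt ht) htb).2 ht.le
      · exact h1.trans (hβb.le.trans htb)
    · refine le_of_forall_gt_imp_ge_of_dense fun t ht => ?_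
      rcases lt_or_ge t b with htb | htb
      · exact (key t ((arrivalTime_nonneg hm0).trans_lt ht) htb).1 ht.le
      · exact h2.trans (hβb.le.trans htb)

end Arrivals

/-! ### The queue -/

section Queue

variable {t t' S : ℤ → ℝ} {s : EReal} {i : ℤ}

/-- Jobs arriving before `s` never enter the queue, so their epochs may be changed freely as long as
they stay before `s`. -/
lemma queueLength_congr (h : ∀ m ≤ i, t m = t' m ∨ ((t m : EReal) < s ∧ (t' m : EReal) < s))
    (hi : t i = t' i) : queueLength t S s i = queueLength t' S s i := by
  have hs : ∀ m ≤ i, (s ≤ t m ↔ s ≤ t' m) := by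
    intro m hm
    rcases h m hm with h | h
    · rw [h]
    · exact iff_of_false (not_le.2 h.1) (not_le.2 h.2)
  have heq : ∀ m ≤ i, s ≤ t m → t m = t' m := by
    intro m hm hsm
    rcases h m hm with h | h
    · exact h
    · exact absurd hsm (not_le.2 h.1)
  have hD : ∀ m ≤ i, departure t S s m = departure t' S s m := by
    intro m hm
    apply le_antisymm
    · refine iSup₂_le fun k hk => ?_
      have hk' := (hs k (hk.1.trans hm)).1 hk.2
      rw [heq k (hk.1.trans hm) hk.2]
      exact le_iSup₂ (f := fun k (_ : k ∈ {k : ℤ | k ≤ m ∧ s ≤ (t' k : EReal)}) =>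
        ((t' k + ∑ j ∈ Finset.Icc k m, S j : ℝ) : EReal)) k ⟨hk.1, hk'⟩
    · refine iSup₂_le fun k hk => ?_
      have hk' := (hs k (hk.1.trans hm)).2 hk.2
      rw [← heq k (hk.1.trans hm) hk']
      exact le_iSup₂ (f := fun k (_ : k ∈ {k : ℤ | k ≤ m ∧ s ≤ (t k : EReal)}) =>
        ((t k + ∑ j ∈ Finset.Icc k m, S j : ℝ) : EReal)) k ⟨hk.1, hk'⟩
  unfold queueLength
  congr 1
  ext m
  simp only [Set.mem_ofPred_eq, hi]
  refine and_congr_right fun hm => ?_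
  rw [hs m hm.le, hD m hm.le]

/-- If all jobs before job `r` have left before it arrives, then the queue found later does not
depend on the starting time, as long as this is before the arrival of `r`. -/
lemma queueLength_eq_of_regeneration {r : ℤ} (hri : r ≤ i) {y : ℝ} (hy : y < t r)
    (hreg : ∀ m n, m ≤ n → n < r → t m + ∑ j ∈ Finset.Icc m n, S j ≤ y)
    (hmono : ∀ m, r ≤ m → m ≤ i → t r ≤ t m) (hs : s ≤ t r) :
    queueLength t S s i = queueLength t S (t r) i := by
  unfold queueLength
  congr 1
  ext m
  simp only [Set.mem_ofPred_eq]
  refine and_congr_right fun hm => ?_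
  constructor
  · rintro ⟨hsm, hD⟩
    -- A job older than `r` leaves by time `y`, which precedes `t r ≤ t i`, so it is not counted.
    have hrm : r ≤ m := by
      by_contra hcon
      have h1 : departure t S s m ≤ (y : EReal) := by
        refine iSup₂_le fun k hk => ?_
        exact_mod_cast hreg k m hk.1 (not_le.1 hcon)
      have h2 : t i ≤ y := by exact_mod_cast hD.trans h1
      linarith [hmono i hri le_rfl]
    refine ⟨by exact_mod_cast hmono m hrm hm.le, hD.trans (iSup₂_le fun k hk => ?_)⟩
    rcases le_or_gt r k with hk' | hk'
    · exact le_iSup₂ (f := fun k (_ : k ∈ {k : ℤ | k ≤ m ∧ (t r : EReal) ≤ (t k : EReal)}) =>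
        ((t k + ∑ j ∈ Finset.Icc k m, S j : ℝ) : EReal)) k
        ⟨hk.1, by exact_mod_cast hmono k hk' (hk.1.trans hm.le)⟩
    · refine le_trans ?_ (le_iSup₂ (f := fun k (_ : k ∈ {k : ℤ | k ≤ m ∧ (t r : EReal) ≤
        (t k : EReal)}) => ((t k + ∑ j ∈ Finset.Icc k m, S j : ℝ) : EReal)) r ⟨hrm, le_rfl⟩)
      -- In the departure formula, a term starting before `r` is dominated by the one starting at
      -- `r`, since its work up to job `r - 1` ends by `y < t r`.
      have hsplit : ∑ j ∈ Finset.Icc k m, S j =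
          ∑ j ∈ Finset.Icc k (r - 1), S j + ∑ j ∈ Finset.Icc r m, S j := by
        rw [← Finset.sum_union]
        · congr 1
          ext j
          simp only [Finset.mem_Icc, Finset.mem_union]
          omega
        · rw [Finset.disjoint_left]
          intro j
          simp only [Finset.mem_Icc]
          omega
      have := hreg k (r - 1) (by omega) (by omega)
      rw [EReal.coe_le_coe_iff, hsplit]
      linarith
  · rintro ⟨hsm, hD⟩
    refine ⟨hs.trans hsm, hD.trans (iSup₂_le fun k hk => ?_)⟩
    exact le_iSup₂ (f := fun k (_ : k ∈ {k : ℤ | k ≤ m ∧ s ≤ (t k : EReal)}) =>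
        ((t k + ∑ j ∈ Finset.Icc k m, S j : ℝ) : EReal)) k ⟨hk.1, hs.trans hk.2⟩

end Queue

/-! ### Slots -/

/-- The number of points in the `l`-th slot of length `h` before the origin. -/
def slotCount (h : ℝ≥0) (φ : Measure ℝ) (l : ℕ) : ℕ :=
  massNat (φ (Set.Ioc (-((l + 1) * h) : ℝ) (-(l * h))))

/-- The number of points in the first `k` slots. -/
def cumCount (c : ℕ → ℕ) (k : ℕ) : ℕ := ∑ l ∈ Finset.range k, c l

/-- The work brought by the jobs of slot `l`, jobs being numbered backwards from `0`. -/
def slotWork (c : ℕ → ℕ) (S : ℤ → ℝ) (l : ℕ) : ℝ≥0∞ :=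
  ∑ p ∈ Finset.Ico (cumCount c l) (cumCount c (l + 1)), ENNReal.ofReal (S (-(p : ℤ)))

lemma cumCount_succ (c : ℕ → ℕ) (k : ℕ) : cumCount c (k + 1) = cumCount c k + c k :=
  Finset.sum_range_succ _ _

lemma cumCount_mono (c : ℕ → ℕ) : Monotone (cumCount c) := fun _ _ hkl =>
  Finset.sum_le_sum_of_subset (Finset.range_mono hkl)

lemma IsCounting.measure_Ioc_eq_cumCount {φ : Measure ℝ} (hφ : IsCounting φ) (h : ℝ≥0) (k : ℕ) :
    φ (Set.Ioc (-(k * h) : ℝ) 0) = cumCount (slotCount h φ) k := by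
  induction k with
  | zero => simp [cumCount]
  | succ k ih =>
    have hh : (0 : ℝ) ≤ h := h.2
    have hU : Set.Ioc (-((k + 1 : ℕ) * h) : ℝ) 0 =
        Set.Ioc (-((k + 1) * h) : ℝ) (-(k * h)) ∪ Set.Ioc (-(k * h) : ℝ) 0 := by
      rw [Set.Ioc_union_Ioc_eq_Ioc]
      · push_cast; rfl
      · nlinarith
      · simp only [Left.neg_nonpos_iff]; positivity
    rw [hU, measure_union (Set.Ioc_disjoint_Ioc_of_le le_rfl) measurableSet_Ioc, ih, cumCount_succ,
      add_comm]
    push_cast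
    rw [slotCount, hφ.cast_massNat measurableSet_Ioc (Metric.isBounded_Ioc _ _)]

lemma cumWork_dropSeq_slotWork (c : ℕ → ℕ) (S : ℤ → ℝ) (l k : ℕ) :
    cumWork (dropSeq l (slotWork c S)) k =
      ∑ p ∈ Finset.Ico (cumCount c l) (cumCount c (k + l)), ENNReal.ofReal (S (-(p : ℤ))) := by
  induction k with
  | zero => simp [cumWork]
  | succ k ih =>
    rw [cumWork, Finset.sum_range_succ, ← cumWork, ih, dropSeq_apply, slotWork,
      Finset.sum_Ico_consecutive _ (cumCount_mono c (by omega)) (cumCount_mono c (by omega)),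
      add_right_comm]

lemma IsCounting.Icc_lt_top {φ : Measure ℝ} (hφ : IsCounting φ) (a b : ℝ) :
    φ (Set.Icc a b) < ∞ := hφ.lt_top (Metric.isBounded_Icc a b)

/-- If the server is idle in slot `l + 1` in the two-sided regime and no job arrives in slot `l`,
then the queue found by job `i` does not depend on the starting time before slot `l`. -/
lemma queueLength_eq_of_idle {φ : Measure ℝ} (hφ : IsCounting φ) (hinf : φ (Set.Iic 0) = ∞)
    {h : ℝ≥0} (hh : 0 < h) {S : ℤ → ℝ} {i : ℤ} {β : ℝ} (hβ0 : 0 < β)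
    (hβ : (i.toNat : ℝ≥0∞) ≤ φ (Set.Ioc 0 β)) {l : ℕ} (hempty : slotCount h φ l = 0)
    (hidle : idleInf h (dropSeq (l + 1) (slotWork (slotCount h φ) S)) ≠ 0)
    (hn : i.natAbs + 1 ≤ cumCount (slotCount h φ) l) {a : ℝ} (ha : a ≤ -(l * h)) :
    a ≤ arrivalTime φ i ∧ ∀ s : EReal, s ≤ a →
      queueLength (arrivalTime φ) S s i = queueLength (arrivalTime φ) S a i := by
  set c := slotCount h φ with hc
  set n := cumCount c l with hnn
  have hfin := hφ.Icc_lt_top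
  have hhr : (0 : ℝ) < h := hh
  have hn1 : cumCount c (l + 1) = n := by rw [cumCount_succ, hempty, add_zero]
  -- The regeneration takes place at job `1 - n`, the oldest of the `n` jobs in the first `l` slots;
  -- `hn` makes this index nonpositive and at most `i`.
  have hr0 : (1 - (n : ℤ)) ≤ 0 := by omega
  have hri : (1 - (n : ℤ)) ≤ i := by omega
  have hTr : -(l * h : ℝ) ≤ arrivalTime φ (1 - n) := by
    rw [le_arrivalTime_iff hfin hinf hr0 (by simp only [Left.neg_nonpos_iff]; positivity)]
    have h1 : (1 - (1 - (n : ℤ))).toNat = n := by omega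
    rw [h1, hnn, hc, ← hφ.measure_Ioc_eq_cumCount]
    exact measure_mono Set.Ioc_subset_Icc_self
  have hmono : ∀ m, (1 - (n : ℤ)) ≤ m → m ≤ i →
      arrivalTime φ (1 - n) ≤ arrivalTime φ m := by
    intro m hrm hmi
    refine arrivalTime_mono hfin hinf hβ0 (le_trans ?_ hβ) hrm
    exact_mod_cast Int.toNat_le_toNat hmi
  -- All the work present in slot `l + 1`: the jobs arriving there plus the backlog. Positive idle
  -- time means `w < h`.
  set w := slotWork c S (l + 1) + loadInf h (dropSeq (l + 2) (slotWork c S)) with hw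
  have hwh : w < h := by
    have h1 : (h : ℝ≥0∞) - w ≠ 0 := by
      rw [idleInf, dropSeq_dropSeq, dropSeq_apply, zero_add, add_comm 1 (l + 1)] at hidle
      exact hidle
    exact tsub_pos_iff_lt.1 (pos_iff_ne_zero.2 h1)
  have hwt : w ≠ ∞ := hwh.ne_top
  have hwr : w.toReal < h := by
    have := (ENNReal.toReal_lt_toReal hwt ENNReal.coe_ne_top).2 hwh
    simpa using this
  -- Older jobs finish by `-((l + 1) * h) + w`, even if the work of slot `l + 1` is counted as
  -- starting at the end of that slot. As `w < h`, this time lies before the end of the empty slot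
  -- `l`, hence before job `1 - n`.
  have hreg : ∀ m n', m ≤ n' → n' < 1 - (n : ℤ) →
      arrivalTime φ m + ∑ j ∈ Finset.Icc m n', S j ≤ -((l + 1) * h) + w.toReal := by
    intro m n' hmn' hn'
    have hm0 : m ≤ 0 := by omega
    have hTm0 := arrivalTime_nonpos (φ := φ) hm0
    have hcount := (le_arrivalTime_iff hfin hinf hm0 hTm0).1 le_rfl
    have hbelow : ∀ k : ℕ, -(k * h : ℝ) < arrivalTime φ m → 1 - m ≤ (cumCount c k : ℤ) := by
      intro k hk
      have h1 : ((1 - m).toNat : ℝ≥0∞) ≤ cumCount c k := by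
        rw [hc, ← hφ.measure_Ioc_eq_cumCount]
        exact hcount.trans (measure_mono fun x hx => ⟨hk.trans_le hx.1, hx.2⟩)
      have h2 : (1 - m).toNat ≤ cumCount c k := by exact_mod_cast h1
      omega
    have hTm : arrivalTime φ m ≤ -((l + 1) * h) := by
      by_contra hcon
      have := hbelow (l + 1) (by push_cast; exact not_le.1 hcon)
      rw [hn1] at this
      omega
    -- The slot containing job `m`. It is written `l + 1 + q`, so that `q` slots of capacity
    -- compensate the backlog since that arrival.
    set k := ⌊-arrivalTime φ m / h⌋₊ with hk
    have hk1 : (k : ℝ) * h ≤ -arrivalTime φ m := by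
      rw [← le_div_iff₀ hhr]
      exact Nat.floor_le (div_nonneg (by linarith) hhr.le)
    have hk2 : -arrivalTime φ m < (k + 1 : ℝ) * h := by
      rw [← div_lt_iff₀ hhr]
      exact Nat.lt_floor_add_one _
    have hlk : l + 1 ≤ k := by
      refine Nat.le_floor ?_
      rw [le_div_iff₀ hhr]
      push_cast
      linarith
    obtain ⟨q, hq⟩ : ∃ q, k = l + 1 + q := ⟨k - (l + 1), by omega⟩
    rw [hq] at hk1 hk2
    have hmk := hbelow (l + 1 + q + 1) (by push_cast at hk2 ⊢; linarith)
    -- Slot work counts `S j` through `ENNReal.ofReal`; passing to `max (S j) 0` can only enlarge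
    -- the sum to be bounded. Jobs are then renumbered backwards by `p = -j`.
    have hwork : ENNReal.ofReal (∑ j ∈ Finset.Icc m n', max (S j) 0) ≤ w + q * h := by
      rw [ENNReal.ofReal_sum_of_nonneg fun j _ => le_max_right _ _]
      calc ∑ j ∈ Finset.Icc m n', ENNReal.ofReal (max (S j) 0)
          = ∑ j ∈ Finset.Icc m n', ENNReal.ofReal (S j) :=
            Finset.sum_congr rfl fun j _ => by simp [ENNReal.ofReal_max]
        _ = ∑ p ∈ (Finset.Icc m n').image (fun j => (-j).toNat : ℤ → ℕ),
              ENNReal.ofReal (S (-(p : ℤ))) := by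
            rw [Finset.sum_image]
            · refine Finset.sum_congr rfl fun j hj => ?_
              rw [Finset.mem_Icc] at hj
              congr 2
              omega
            · intro j hj j' hj' hjj
              simp only [Finset.coe_Icc, Set.mem_Icc] at hj hj'
              dsimp only at hjj
              omega
        _ ≤ ∑ p ∈ Finset.Ico (cumCount c (l + 1)) (cumCount c (q + 1 + (l + 1))),
              ENNReal.ofReal (S (-(p : ℤ))) := by
            refine Finset.sum_le_sum_of_subset fun p hp => ?_
            have h3 : q + 1 + (l + 1) = l + 1 + q + 1 := by ring
            rw [h3, hn1]
            simp only [Finset.mem_image, Finset.mem_Icc, Finset.mem_Ico] at hp ⊢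
            obtain ⟨j, hj, rfl⟩ := hp
            omega
        _ = slotWork c S (l + 1) + cumWork (dropSeq (l + 2) (slotWork c S)) q := by
            rw [← cumWork_dropSeq_slotWork, cumWork_succ', dropSeq_dropSeq, dropSeq_apply,
              zero_add, add_comm 1 (l + 1)]
        _ ≤ w + q * h := by
            rw [hw, add_assoc]
            gcongr
            rw [← tsub_le_iff_right]
            exact cumWork_sub_le_loadInf _ _ _
    have hqt : w + (q : ℝ≥0∞) * h ≠ ∞ :=
      ENNReal.add_ne_top.2 ⟨hwt, ENNReal.mul_ne_top (by simp) (by simp)⟩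
    have hwork' := (ENNReal.ofReal_le_iff_le_toReal hqt).1 hwork
    rw [ENNReal.toReal_add hwt (ENNReal.mul_ne_top (by simp) (by simp)),
      ENNReal.toReal_mul] at hwork'
    simp only [ENNReal.toReal_natCast, ENNReal.coe_toReal] at hwork'
    have hS : ∑ j ∈ Finset.Icc m n', S j ≤ ∑ j ∈ Finset.Icc m n', max (S j) 0 :=
      Finset.sum_le_sum fun j _ => le_max_left _ _
    push_cast at hk1
    linarith
  have hlt : -((l + 1) * h) + w.toReal < arrivalTime φ (1 - n) := by linarith
  have haT : a ≤ arrivalTime φ (1 - n) := ha.trans hTr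
  refine ⟨haT.trans (hmono i hri le_rfl), fun s hs => ?_⟩
  rw [queueLength_eq_of_regeneration hri hlt hreg hmono
      (hs.trans (by exact_mod_cast haT)),
    queueLength_eq_of_regeneration hri hlt hreg hmono
      (s := (a : EReal)) (by exact_mod_cast haT)]

/-! ### Measurability of arrival times and queue lengths -/

/-- Counts are monotone in the endpoint, so rational endpoints suffice to test strict inequalities.
The second set in each description accounts for the default value `0` on an empty set. -/
lemma measurable_arrivalTime (i : ℤ) : Measurable fun φ : Measure ℝ => arrivalTime φ i := by
  have hev : ∀ (n : ℕ) {s : Set ℝ}, MeasurableSet s →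
      MeasurableSet {φ : Measure ℝ | (n : ℝ≥0∞) ≤ φ s} := fun n s hs =>
    measurableSet_le measurable_const (Measure.measurable_coe hs)
  rcases le_or_gt 1 i with hi | hi
  · refine measurable_of_Iio fun x => ?_
    set n := i.toNat with hn
    have : (fun φ : Measure ℝ => arrivalTime φ i) ⁻¹' Set.Iio x =
        {φ | ∃ q : ℚ, (0 < (q : ℝ) ∧ (q : ℝ) < x) ∧ (n : ℝ≥0∞) ≤ φ (Set.Ioc 0 (q : ℝ))} ∪
        ({_φ | 0 < x} ∩ ⋂ k : ℕ, {φ | (n : ℝ≥0∞) ≤ φ (Set.Ioc 0 (k + 1 : ℝ))}ᶜ) := by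
      ext φ
      simp only [Set.mem_preimage, Set.mem_Iio, Set.mem_union, Set.mem_inter_iff,
        Set.mem_iInter, Set.mem_compl_iff, Set.mem_ofPred_eq, arrivalTime,
        if_pos hi, ← hn]
      set A := {t : ℝ | 0 < t ∧ (n : ℝ≥0∞) ≤ φ (Set.Ioc 0 t)} with hA
      have hbdd : BddBelow A := ⟨0, fun t ht => ht.1.le⟩
      constructor
      · intro h
        rcases A.eq_empty_or_nonempty with hE | hne
        · right
          rw [hE, Real.sInf_empty] at h
          refine ⟨h, fun k hk => ?_⟩
          have : (k + 1 : ℝ) ∈ A := ⟨by positivity, hk⟩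
          simp [hE] at this
        · left
          obtain ⟨t, ht, htx⟩ := exists_lt_of_csInf_lt hne h
          obtain ⟨q, hq1, hq2⟩ := exists_rat_btwn htx
          exact ⟨q, ⟨ht.1.trans hq1, hq2⟩,
            ht.2.trans (measure_mono (Set.Ioc_subset_Ioc_right hq1.le))⟩
      · rintro (⟨q, ⟨hq0, hqx⟩, hq⟩ | ⟨hx, hE⟩)
        · exact (csInf_le hbdd ⟨hq0, hq⟩).trans_lt hqx
        · have : A = ∅ := by
            rw [Set.eq_empty_iff_forall_notMem]
            rintro t ⟨-, ht⟩
            obtain ⟨k, hk⟩ := exists_nat_ge t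
            exact hE k (ht.trans (measure_mono (Set.Ioc_subset_Ioc_right (by linarith))))
          rwa [this, Real.sInf_empty]
    rw [this]
    refine MeasurableSet.union ?_ ?_
    · simp only [Set.ofPred_exists]
      exact MeasurableSet.iUnion fun q => (MeasurableSet.const _).inter (hev n measurableSet_Ioc)
    · refine (MeasurableSet.const _).inter ?_
      exact MeasurableSet.iInter fun k => (hev n measurableSet_Ioc).compl
  · refine measurable_of_Ioi fun x => ?_
    set n := (1 - i).toNat with hn
    have : (fun φ : Measure ℝ => arrivalTime φ i) ⁻¹' Set.Ioi x =
        {φ | ∃ q : ℚ, ((q : ℝ) ≤ 0 ∧ x < (q : ℝ)) ∧ (n : ℝ≥0∞) ≤ φ (Set.Icc (q : ℝ) 0)} ∪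
        ({_φ | x < 0} ∩ ⋂ k : ℕ, {φ | (n : ℝ≥0∞) ≤ φ (Set.Icc (-k : ℝ) 0)}ᶜ) := by
      ext φ
      simp only [Set.mem_preimage, Set.mem_Ioi, Set.mem_union, Set.mem_inter_iff,
        Set.mem_iInter, Set.mem_compl_iff, Set.mem_ofPred_eq, arrivalTime,
        if_neg (not_le.2 hi), ← hn]
      set A := {t : ℝ | t ≤ 0 ∧ (n : ℝ≥0∞) ≤ φ (Set.Icc t 0)} with hA
      have hbdd : BddAbove A := ⟨0, fun t ht => ht.1⟩
      constructor
      · intro h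
        rcases A.eq_empty_or_nonempty with hE | hne
        · right
          rw [hE, Real.sSup_empty] at h
          refine ⟨h, fun k hk => ?_⟩
          have : (-k : ℝ) ∈ A := ⟨by simp, hk⟩
          simp [hE] at this
        · left
          obtain ⟨t, ht, htx⟩ := exists_lt_of_lt_csSup hne h
          obtain ⟨q, hq1, hq2⟩ := exists_rat_btwn htx
          exact ⟨q, ⟨hq2.le.trans ht.1, hq1⟩,
            ht.2.trans (measure_mono (Set.Icc_subset_Icc_left hq2.le))⟩
      · rintro (⟨q, ⟨hq0, hqx⟩, hq⟩ | ⟨hx, hE⟩)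
        · exact hqx.trans_le (le_csSup hbdd ⟨hq0, hq⟩)
        · have : A = ∅ := by
            rw [Set.eq_empty_iff_forall_notMem]
            rintro t ⟨-, ht⟩
            obtain ⟨k, hk⟩ := exists_nat_ge (-t)
            exact hE k (ht.trans (measure_mono (Set.Icc_subset_Icc_left (by linarith))))
          rwa [this, Real.sSup_empty]
    rw [this]
    refine MeasurableSet.union ?_ ?_
    · simp only [Set.ofPred_exists]
      exact MeasurableSet.iUnion fun q => (MeasurableSet.const _).inter (hev n measurableSet_Icc)
    · refine (MeasurableSet.const _).inter ?_
      exact MeasurableSet.iInter fun k => (hev n measurableSet_Icc).compl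

/-- At least `n` indices occur exactly when some `n`-element finite set of indices does, and there
are countably many of these. -/
lemma measurable_encard {α : Type*} [MeasurableSpace α] {E : ℤ → Set α}
    (hE : ∀ m, MeasurableSet (E m)) : Measurable fun p => {m : ℤ | p ∈ E m}.encard := by
  have hge : ∀ n : ℕ, MeasurableSet {p | (n : ℕ∞) ≤ {m : ℤ | p ∈ E m}.encard} := by
    intro n
    have : {p | (n : ℕ∞) ≤ {m : ℤ | p ∈ E m}.encard} =
        ⋃ F : {F : Finset ℤ // F.card = n}, ⋂ m ∈ F.1, E m := by
      ext p
      simp only [Set.mem_ofPred_eq, Set.mem_iUnion, Set.mem_iInter]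
      constructor
      · intro h
        obtain ⟨t, hts, ht⟩ := Set.exists_subset_encard_eq h
        have hfin : t.Finite := Set.finite_of_encard_eq_coe ht
        refine ⟨⟨hfin.toFinset, ?_⟩, fun m hm => hts (hfin.mem_toFinset.1 hm)⟩
        rw [hfin.encard_eq_coe_toFinset_card] at ht
        exact_mod_cast ht
      · rintro ⟨⟨F, hF⟩, h⟩
        rw [← hF, ← Set.encard_coe_eq_coe_finsetCard]
        exact Set.encard_le_encard fun m hm => h m hm
    rw [this]
    exact MeasurableSet.iUnion fun F => Finset.measurableSet_biInter _ fun m _ => hE m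
  refine measurable_to_countable' fun x => ?_
  induction x using ENat.recTopCoe with
  | top =>
    have : (fun p => {m : ℤ | p ∈ E m}.encard) ⁻¹' {⊤} =
        ⋂ n : ℕ, {p | (n : ℕ∞) ≤ {m : ℤ | p ∈ E m}.encard} := by
      ext p
      simp only [Set.mem_preimage, Set.mem_singleton_iff, Set.mem_iInter, Set.mem_ofPred_eq]
      exact ENat.eq_top_iff_forall_ge
    rw [this]
    exact MeasurableSet.iInter hge
  | coe n =>
    have : (fun p => {m : ℤ | p ∈ E m}.encard) ⁻¹' {(n : ℕ∞)} =
        {p | (n : ℕ∞) ≤ {m : ℤ | p ∈ E m}.encard} \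
          {p | ((n + 1 : ℕ) : ℕ∞) ≤ {m : ℤ | p ∈ E m}.encard} := by
      ext p
      simp only [Set.mem_preimage, Set.mem_singleton_iff, Set.mem_sdiff, Set.mem_ofPred_eq, not_le]
      push_cast
      rw [ENat.lt_add_one_iff (ENat.natCast_ne_top n)]
      constructor
      · rintro h; rw [h]; exact ⟨le_rfl, le_rfl⟩
      · exact fun h => le_antisymm h.2 h.1
    rw [this]
    exact (hge n).diff (hge (n + 1))

lemma measurable_departure {α : Type*} [MeasurableSpace α] {t S : α → ℤ → ℝ}
    (ht : ∀ m, Measurable fun p => t p m) (hS : ∀ m, Measurable fun p => S p m) (s : EReal)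
    (n : ℤ) : Measurable fun p => departure (t p) (S p) s n := by
  classical
  unfold departure
  refine Measurable.iSup fun m => ?_
  simp only [iSup_eq_if]
  have h1 : Measurable fun p => ((t p m + ∑ j ∈ Finset.Icc m n, S p j : ℝ) : EReal) :=
    measurable_coe_real_ereal.comp ((ht m).add (Finset.measurable_sum _ fun j _ => hS j))
  refine Measurable.ite ?_ h1 measurable_const
  exact (MeasurableSet.const _).inter
    (measurableSet_le measurable_const (measurable_coe_real_ereal.comp (ht m)))

lemma measurable_queueLength {α : Type*} [MeasurableSpace α] {t S : α → ℤ → ℝ}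
    (ht : ∀ m, Measurable fun p => t p m) (hS : ∀ m, Measurable fun p => S p m) (s : EReal)
    (i : ℤ) : Measurable fun p => queueLength (t p) (S p) s i := by
  refine measurable_encard (E := fun m => {p | m < i ∧ s ≤ (t p m : EReal) ∧
    (t p i : EReal) ≤ departure (t p) (S p) s m}) fun m => ?_
  refine (MeasurableSet.const _).inter (MeasurableSet.inter ?_ ?_)
  · exact measurableSet_le measurable_const (measurable_coe_real_ereal.comp (ht m))
  · exact measurableSet_le (measurable_coe_real_ereal.comp (ht i)) (measurable_departure ht hS s m)

/-! ### Counts and work per slot -/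

lemma measurable_slotCount (h : ℝ≥0) : Measurable (slotCount h) :=
  measurable_pi_lambda _ fun _ => measurable_massNat.comp (Measure.measurable_coe measurableSet_Ioc)

lemma measurable_cumCount (k : ℕ) : Measurable fun c => cumCount c k := by
  unfold cumCount; fun_prop

lemma measurable_slotWork :
    Measurable fun p : (ℕ → ℕ) × (ℤ → ℝ) => slotWork p.1 p.2 := by
  refine measurable_pi_lambda _ fun l => ?_
  have h1 : Measurable fun q : (ℕ × ℕ) × (ℤ → ℝ) =>
      ∑ p ∈ Finset.Ico q.1.1 q.1.2, ENNReal.ofReal (q.2 (-(p : ℤ))) :=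
    measurable_from_prod_countable_right fun q => by
      dsimp only
      fun_prop
  exact h1.comp ((((measurable_cumCount l).comp measurable_fst).prodMk
    ((measurable_cumCount (l + 1)).comp measurable_fst)).prodMk measurable_snd)

lemma map_infinitePi_shift (PS : Measure ℝ) [IsProbabilityMeasure PS] (n : ℤ) :
    (Measure.infinitePi fun _ : ℤ => PS).map (fun S j => S (j - n)) =
      Measure.infinitePi fun _ : ℤ => PS := by
  convert! Measure.infinitePi_map_piCongrLeft (fun _ : ℤ => PS) (Equiv.addRight n) using 2
  funext S j
  have := Equiv.piCongrLeft_apply_apply (P := fun _ : ℤ => ℝ) (Equiv.addRight n) S (j - n)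
  simp only [Equiv.coe_addRight, sub_add_cancel] at this
  exact this.symm

/-- Dropping the latest slot shifts the counts and renumbers the services by `c 0`. This is a skew
product over the shift of counts whose fibre maps preserve the i.i.d. law. -/
lemma measurePreserving_slotWork {κ : Measure (ℕ → ℕ)} [IsProbabilityMeasure κ]
    (hκ : MeasurePreserving (dropSeq 1) κ κ) (PS : Measure ℝ) [IsProbabilityMeasure PS] :
    MeasurePreserving (dropSeq 1)
      ((κ.prod (Measure.infinitePi fun _ : ℤ => PS)).map fun p => slotWork p.1 p.2)
      ((κ.prod (Measure.infinitePi fun _ : ℤ => PS)).map fun p => slotWork p.1 p.2) := by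
  set π := Measure.infinitePi fun _ : ℤ => PS with hπ
  have hg : Measurable (Function.uncurry fun (c : ℕ → ℕ) (S : ℤ → ℝ) (j : ℤ) => S (j - c 0)) := by
    refine measurable_pi_lambda _ fun j => ?_
    have h1 : Measurable fun q : ℕ × (ℤ → ℝ) => q.2 (j - q.1) :=
      measurable_from_prod_countable_right fun q => measurable_pi_apply (j - (q : ℤ))
    have h2 : Measurable fun p : (ℕ → ℕ) × (ℤ → ℝ) => (p.1 0, p.2) := by fun_prop
    exact h1.comp h2
  have hT := hκ.skew_product (μc := π) (μd := π) hg
    (ae_of_all _ fun c => map_infinitePi_shift PS (c 0))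
  refine ⟨measurable_dropSeq 1, ?_⟩
  have hcomp : ∀ p : (ℕ → ℕ) × (ℤ → ℝ), slotWork (dropSeq 1 p.1) (fun j => p.2 (j - p.1 0)) =
      dropSeq 1 (slotWork p.1 p.2) := by
    rintro ⟨c, S⟩
    have hcc : ∀ k, cumCount (dropSeq 1 c) k + c 0 = cumCount c (k + 1) := fun k => by
      simp [cumCount, Finset.sum_range_succ']
    funext l
    simp only [slotWork, dropSeq_apply]
    rw [← hcc, ← hcc, ← Finset.sum_Ico_add']
    refine Finset.sum_congr rfl fun p _ => ?_
    congr 2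
    push_cast
    ring
  rw [Measure.map_map (measurable_dropSeq 1) measurable_slotWork]
  nth_rw 2 [← hT.map_eq]
  rw [Measure.map_map measurable_slotWork hT.measurable]
  congr 1
  funext p
  exact (hcomp p).symm

/-- Wald's identity: given the counts, the slot contains `c 0` services, each of the same mean. -/
lemma lintegral_slotWork_zero (κ : Measure (ℕ → ℕ)) [IsProbabilityMeasure κ]
    (PS : Measure ℝ) [IsProbabilityMeasure PS] :
    ∫⁻ p, slotWork p.1 p.2 0 ∂(κ.prod (Measure.infinitePi fun _ : ℤ => PS)) =
      (∫⁻ c, (c 0 : ℝ≥0∞) ∂κ) * ∫⁻ x, ENNReal.ofReal x ∂PS := by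
  set π := Measure.infinitePi fun _ : ℤ => PS with hπ
  have h0 : Measurable fun p : (ℕ → ℕ) × (ℤ → ℝ) => slotWork p.1 p.2 0 :=
    (measurable_pi_apply 0).comp measurable_slotWork
  have hc : Measurable fun c : ℕ → ℕ => (c 0 : ℝ≥0∞) :=
    measurable_from_nat.comp (measurable_pi_apply 0)
  rw [lintegral_prod _ h0.aemeasurable, ← lintegral_mul_const _ hc]
  refine lintegral_congr fun c => ?_
  have hj : ∀ j : ℤ, ∫⁻ S, ENNReal.ofReal (S j) ∂π = ∫⁻ x, ENNReal.ofReal x ∂PS := fun j =>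
    (measurePreserving_eval_infinitePi (fun _ : ℤ => PS) j).lintegral_comp
      (f := fun x => ENNReal.ofReal x) ENNReal.measurable_ofReal
  simp only [slotWork]
  rw [lintegral_finsetSum _ fun p _ => by fun_prop]
  simp [hj, cumCount]

/-- The joint law of the arrivals and the service times. -/
lemma map_arrivals_services {Ω : Type*} [MeasurableSpace Ω] {P : Measure Ω} [IsProbabilityMeasure P]
    {Ψ : Ω → Measure ℝ} (hΨ : Measurable Ψ) {S : ℤ → Ω → ℝ} {PS : Measure ℝ}
    [IsProbabilityMeasure PS] (hS : IsServiceSeq P S PS)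
    (hind : IndepFun Ψ (fun ω j => S j ω) P) :
    P.map (fun ω => (Ψ ω, fun j => S j ω)) =
      (P.map Ψ).prod (Measure.infinitePi fun _ : ℤ => PS) := by
  have hSm : Measurable fun ω j => S j ω := measurable_pi_lambda _ hS.measurable
  rw [(indepFun_iff_map_prod_eq_prod_map_map hΨ.aemeasurable hSm.aemeasurable).1 hind,
    hS.indep.map_fun_eq_infinitePi_map hS.measurable]
  simp only [hS.law]

/-! ### Stationarity -/

lemma slotCount_map_add (h : ℝ≥0) (φ : Measure ℝ) :
    slotCount h (φ.map fun t => t + h) = dropSeq 1 (slotCount h φ) := by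
  funext l
  simp only [slotCount, dropSeq_apply]
  rw [Measure.map_apply (by fun_prop) measurableSet_Ioc]
  congr 2
  ext x
  simp only [Set.mem_preimage, Set.mem_Ioc]
  push_cast
  constructor <;> rintro ⟨h1, h2⟩ <;> constructor <;> linarith

lemma IsStationary.measurePreserving_slotCount {Ω : Type*} [MeasurableSpace Ω] {P : Measure Ω}
    {Ψ : Ω → Measure ℝ} (hst : IsStationary P Ψ) (hΨ : Measurable Ψ) (h : ℝ≥0) :
    MeasurePreserving (dropSeq 1) (P.map fun ω => slotCount h (Ψ ω))
      (P.map fun ω => slotCount h (Ψ ω)) := by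
  have hm : Measurable fun ω => slotCount h (Ψ ω) := (measurable_slotCount h).comp hΨ
  have hmap : Measurable fun φ : Measure ℝ => φ.map fun t => t + (h : ℝ) :=
    Measure.measurable_map _ (by fun_prop)
  refine ⟨measurable_dropSeq 1, ?_⟩
  rw [Measure.map_map (measurable_dropSeq 1) hm]
  have h1 := congrArg (Measure.map (slotCount h)) (hst h)
  have hmap' : Measurable fun ω => (Ψ ω).map fun t => t + (h : ℝ) := hmap.comp hΨ
  rw [Measure.map_map (measurable_slotCount h) hmap',
    Measure.map_map (measurable_slotCount h) hΨ] at h1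
  refine Eq.trans ?_ h1
  congr 1
  funext ω
  exact (slotCount_map_add h (Ψ ω)).symm

/-- By independence the joint law is the product of the marginals, so invariance of each marginal
gives invariance of the joint law, and summation commutes with time shifts. -/
lemma isStationary_superposition {Ω : Type*} [MeasurableSpace Ω] {P : Measure Ω}
    [IsProbabilityMeasure P] {K : ℕ} {Φ : Fin K → Ω → Measure ℝ} (hm : ∀ k, Measurable (Φ k))
    (hst : ∀ k, IsStationary P (Φ k)) (hind : iIndepFun Φ P) :
    IsStationary P (superposition Φ) := by
  intro τ
  have hmap : Measurable fun φ : Measure ℝ => φ.map fun t => t + τ :=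
    Measure.measurable_map _ (by fun_prop)
  have hsum : Measurable fun v : Fin K → Measure ℝ => ∑ k, v k := by
    refine Measure.measurable_of_measurable_coe _ fun s hs => ?_
    simp only [Measure.coe_finsetSum, Finset.sum_apply]
    exact Finset.measurable_sum _ fun k _ =>
      (Measure.measurable_coe hs).comp (measurable_pi_apply k)
  have hind' : iIndepFun (fun k ω => (Φ k ω).map fun t => t + τ) P :=
    hind.comp (fun _ φ => φ.map fun t => t + τ) fun _ => hmap
  have h1 := (iIndepFun_iff_map_fun_eq_pi_map fun k => (hm k).aemeasurable).1 hind
  have h2 := (iIndepFun_iff_map_fun_eq_pi_map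
    fun k => (hmap.comp (hm k)).aemeasurable).1 hind'
  have h3 : P.map (fun ω k => (Φ k ω).map fun t => t + τ) = P.map fun ω k => Φ k ω := by
    rw [h1]
    refine h2.trans ?_
    congr 1
    funext k
    exact hst k τ
  have h4 := congrArg (Measure.map fun v : Fin K → Measure ℝ => ∑ k, v k) h3
  have hmap' : Measurable fun ω k => (Φ k ω).map fun t => t + τ :=
    measurable_pi_lambda _ fun k => hmap.comp (hm k)
  rw [Measure.map_map hsum hmap', Measure.map_map hsum (measurable_pi_lambda _ hm)] at h4
  refine Eq.trans ?_ h4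
  congr 1
  funext ω
  simp only [superposition, Function.comp]
  ext s hs
  simp only [Measure.map_apply (by fun_prop : Measurable fun t : ℝ => t + τ) hs,
    Measure.coe_finsetSum, Finset.sum_apply]

/-- The intensity of a stationary point process with finite mean on some interval. -/
lemma IsStationary.exists_intensity {Ω : Type*} [MeasurableSpace Ω] {P : Measure Ω}
    [IsProbabilityMeasure P] {Ψ : Ω → Measure ℝ} (hst : IsStationary P Ψ) (hΨ : Measurable Ψ)
    {a b : ℝ} (hab : a < b) (hfin : ∫⁻ ω, Ψ ω (Set.Ico a b) ∂P ≠ ∞) :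
    ∃ ℓ : ℝ≥0, ∀ s, MeasurableSet s → ∫⁻ ω, Ψ ω s ∂P = ℓ * volume s := by
  -- The mean measure is translation invariant and finite on an open interval, hence on compact
  -- sets; uniqueness of Haar measure then makes it a multiple of volume.
  set η : Measure ℝ := P.bind Ψ with hη
  have hηs : ∀ s, MeasurableSet s → η s = ∫⁻ ω, Ψ ω s ∂P := fun s hs =>
    Measure.bind_apply hs hΨ.aemeasurable
  have hinv : η.IsAddLeftInvariant := by
    refine ⟨fun τ => ?_⟩
    ext s hs
    have hmap : Measurable fun φ : Measure ℝ => φ.map fun t => t + τ :=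
      Measure.measurable_map _ (by fun_prop)
    have hmap' : Measurable fun ω => (Ψ ω).map fun t => t + τ := hmap.comp hΨ
    rw [Measure.map_apply (by fun_prop) hs, hηs _ hs, hηs _ ((by fun_prop : Measurable _) hs),
      ← lintegral_map (μ := P) (Measure.measurable_coe hs) hΨ, ← hst τ,
      lintegral_map (Measure.measurable_coe hs) hmap']
    refine lintegral_congr fun ω => ?_
    rw [Measure.map_apply (by fun_prop) hs]
    congr 1
    ext x
    simp [add_comm]
  have hfc : IsFiniteMeasureOnCompacts η := by
    refine ⟨fun K hK => ?_⟩
    refine measure_lt_top_of_isCompact_of_isAddLeftInvariant (Set.Ioo a b) isOpen_Ioo ?_ ?_ hK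
    · exact Set.nonempty_Ioo.2 hab
    · refine ne_top_of_le_ne_top ?_ (measure_mono Set.Ioo_subset_Ico_self)
      rwa [hηs _ measurableSet_Ico]
  refine ⟨η.addHaarScalarFactor volume, fun s hs => ?_⟩
  have := Measure.isAddLeftInvariant_eq_smul η volume
  rw [← hηs s hs]
  nth_rw 1 [this]
  rfl

/-! ### The work process of a queue with stationary input -/

section Work

variable {Ω : Type*} [MeasurableSpace Ω] {P : Measure Ω} {Ψ : Ω → Measure ℝ} {S : ℤ → Ω → ℝ}

/-- The work brought in the slots before the origin. -/
def workSeq (h : ℝ≥0) (Ψ : Ω → Measure ℝ) (S : ℤ → Ω → ℝ) (ω : Ω) : ℕ → ℝ≥0∞ :=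
  slotWork (slotCount h (Ψ ω)) fun j => S j ω

lemma measurable_workSeq (h : ℝ≥0) (hΨ : Measurable Ψ) (hS : ∀ j, Measurable (S j)) :
    Measurable (workSeq h Ψ S) := by
  have : Measurable fun ω => (slotCount h (Ψ ω), fun j => S j ω) :=
    ((measurable_slotCount h).comp hΨ).prodMk (measurable_pi_lambda _ hS)
  exact measurable_slotWork.comp this

variable [IsProbabilityMeasure P] {PS : Measure ℝ}

lemma map_workSeq (h : ℝ≥0) (hΨ : Measurable Ψ) (hS : IsServiceSeq P S PS)
    (hind : IndepFun Ψ (fun ω j => S j ω) P) :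
    P.map (workSeq h Ψ S) =
      ((P.map fun ω => slotCount h (Ψ ω)).prod (Measure.infinitePi fun _ : ℤ => PS)).map
        fun p => slotWork p.1 p.2 := by
  have hc : Measurable fun ω => slotCount h (Ψ ω) := (measurable_slotCount h).comp hΨ
  have hSm : Measurable fun ω j => S j ω := measurable_pi_lambda _ hS.measurable
  have hind' : IndepFun (fun ω => slotCount h (Ψ ω)) (fun ω j => S j ω) P :=
    hind.comp (measurable_slotCount h) measurable_id
  have h1 := (indepFun_iff_map_prod_eq_prod_map_map hc.aemeasurable hSm.aemeasurable).1 hind'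
  rw [hS.indep.map_fun_eq_infinitePi_map hS.measurable] at h1
  simp only [hS.law] at h1
  rw [← h1, Measure.map_map measurable_slotWork (hc.prodMk hSm)]
  rfl

variable [IsProbabilityMeasure PS]

lemma measurePreserving_workSeq (h : ℝ≥0) (hΨ : Measurable Ψ) (hS : IsServiceSeq P S PS)
    (hind : IndepFun Ψ (fun ω j => S j ω) P)
    (hst : MeasurePreserving (dropSeq 1) (P.map fun ω => slotCount h (Ψ ω))
      (P.map fun ω => slotCount h (Ψ ω))) :
    MeasurePreserving (dropSeq 1) (P.map (workSeq h Ψ S)) (P.map (workSeq h Ψ S)) := by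
  have hc : Measurable fun ω => slotCount h (Ψ ω) := (measurable_slotCount h).comp hΨ
  have := Measure.isProbabilityMeasure_map (μ := P) hc.aemeasurable
  rw [map_workSeq h hΨ hS hind]
  exact measurePreserving_slotWork hst PS

lemma lintegral_workSeq_zero (h : ℝ≥0) (hΨ : IsPointProcess Ψ) (hS : IsServiceSeq P S PS)
    (hind : IndepFun Ψ (fun ω j => S j ω) P) :
    ∫⁻ x, x 0 ∂(P.map (workSeq h Ψ S)) =
      (∫⁻ ω, Ψ ω (Set.Ioc (-h : ℝ) 0) ∂P) * ∫⁻ x, ENNReal.ofReal x ∂PS := by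
  have hc : Measurable fun ω => slotCount h (Ψ ω) := (measurable_slotCount h).comp hΨ.measurable
  have := Measure.isProbabilityMeasure_map (μ := P) hc.aemeasurable
  have hc0 : Measurable fun c : ℕ → ℕ => (c 0 : ℝ≥0∞) :=
    measurable_from_nat.comp (measurable_pi_apply 0)
  rw [map_workSeq h hΨ.measurable hS hind, lintegral_map (measurable_pi_apply 0)
    measurable_slotWork, lintegral_slotWork_zero, lintegral_map hc0 hc]
  congr 1
  refine lintegral_congr fun ω => ?_
  rw [slotCount, (hΨ.counting ω).cast_massNat measurableSet_Ioc (Metric.isBounded_Ioc _ _)]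
  simp

end Work

/-! ### The Poisson input -/

/-- From `(n + 1) p (n + 1) = r p n` for the Poisson weights. -/
lemma lintegral_poissonMeasure (r : ℝ≥0) : ∫⁻ n, (n : ℝ≥0∞) ∂(poissonMeasure r) = r := by
  rw [lintegral_countable', tsum_eq_zero_add' ENNReal.summable]
  simp only [Nat.cast_zero, zero_mul, zero_add]
  have hstep : ∀ n : ℕ, ((n + 1 : ℕ) : ℝ≥0∞) * poissonMeasure r {n + 1}
      = r * poissonMeasure r {n} := by
    intro n
    rw [poissonMeasure_singleton, poissonMeasure_singleton, ← ENNReal.ofReal_natCast,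
      ← ENNReal.ofReal_coe_nnreal, ← ENNReal.ofReal_mul (by positivity),
      ← ENNReal.ofReal_mul (by positivity)]
    congr 1
    rw [Nat.factorial_succ]
    push_cast
    field_simp
    ring
  simp only [hstep]
  rw [ENNReal.tsum_mul_left]
  have : ∑' n, poissonMeasure r {n} = 1 := by
    have := lintegral_countable' (μ := poissonMeasure r) fun _ => 1
    simpa using this.symm
  rw [this, mul_one]

section PoissonInput

variable {Ω : Type*} [MeasurableSpace Ω] {P : Measure Ω}
  {Φ : Ω → Measure ℝ} {S : ℤ → Ω → ℝ} {lam : ℝ} {PS : Measure ℝ}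

lemma volume_slot (h : ℝ≥0) (l : ℕ) :
    volume (Set.Ioc (-((l + 1) * h) : ℝ) (-(l * h))) = h := by
  rw [Real.volume_Ioc, ← ENNReal.ofReal_coe_nnreal]
  congr 1
  ring

lemma disjoint_slots (h : ℝ≥0) {l m : ℕ} (hlm : l ≠ m) :
    Disjoint (Set.Ioc (-((l + 1) * h) : ℝ) (-(l * h))) (Set.Ioc (-((m + 1) * h) : ℝ) (-(m * h))) := by
  have hh : (0 : ℝ) ≤ h := h.2
  wlog hlt : l < m generalizing l m
  · exact (this hlm.symm (by omega)).symm
  refine (Set.Ioc_disjoint_Ioc_of_le ?_).symm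
  have : (l + 1 : ℝ) ≤ m := by exact_mod_cast hlt
  nlinarith

lemma IsPoisson.iIndepFun_slotCount (hΦ : IsPoisson P Φ lam) (h : ℝ≥0) :
    iIndepFun (fun (l : ℕ) ω => slotCount h (Φ ω) l) P := by
  have h1 : iIndepFun (fun (l : ℕ) ω => Φ ω (Set.Ioc (-((l + 1) * h) : ℝ) (-(l * h)))) P := by
    rw [iIndepFun_iff_finset]
    intro s
    have h2 := hΦ.indep s.card
      (fun l => Set.Ioc (-(((s.equivFin.symm l : ℕ) + 1) * h) : ℝ) (-((s.equivFin.symm l : ℕ) * h)))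
      (fun l => measurableSet_Ioc) (fun l => Metric.isBounded_Ioc _ _) (by
        intro l m hlm
        refine disjoint_slots h fun heq => hlm ?_
        exact s.equivFin.symm.injective (Subtype.ext heq))
    have h3 := h2.precomp s.equivFin.injective
    convert! h3 using 1
    funext l ω
    simp
  exact h1.comp (fun _ => massNat) fun _ => measurable_massNat

lemma IsPoisson.measurable_slotCount (hΦ : IsPoisson P Φ lam) (h : ℝ≥0) (l : ℕ) :
    Measurable fun ω => slotCount h (Φ ω) l :=
  (measurable_pi_apply l).comp ((QueueTV.measurable_slotCount h).comp hΦ.pointProcess.measurable)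

lemma tendsto_natCast_of_tendsto_div {u : ℕ → ℕ} {c : ℝ} (hc : 0 < c)
    (hu : Tendsto (fun n : ℕ => (u n : ℝ) / n) atTop (𝓝 c)) : Tendsto u atTop atTop := by
  rw [← tendsto_natCast_atTop_iff (R := ℝ)]
  have h1 := hu.pos_mul_atTop hc (tendsto_natCast_atTop_atTop (R := ℝ))
  refine h1.congr' ?_
  filter_upwards [eventually_ne_atTop 0] with n hn
  have : (n : ℝ) ≠ 0 := by exact_mod_cast hn
  field_simp

/-- The strong law is applied to the positive parts, whose mean is the integral of `ENNReal.ofReal`.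
-/
lemma IsServiceSeq.ae_tendsto_sum (hS : IsServiceSeq P S PS)
    (hES : ∫⁻ x, ENNReal.ofReal x ∂PS ≠ ∞) :
    ∀ᵐ ω ∂P, Tendsto (fun n : ℕ => (∑ p ∈ Finset.range n, max (S (-(p : ℤ)) ω) 0) / n) atTop
      (𝓝 (∫⁻ x, ENNReal.ofReal x ∂PS).toReal) := by
  have hmax : Measurable fun x : ℝ => max x 0 := by fun_prop
  have hm : ∀ p : ℕ, Measurable fun ω => max (S (-(p : ℤ)) ω) 0 := fun p =>
    hmax.comp (hS.measurable _)
  have hof : ∀ x : ℝ, ENNReal.ofReal (max x 0) = ENNReal.ofReal x := fun x => by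
    simp [ENNReal.ofReal_max]
  have hlint : ∫⁻ ω, ENNReal.ofReal (max (S (-((0 : ℕ) : ℤ)) ω) 0) ∂P =
      ∫⁻ x, ENNReal.ofReal x ∂PS := by
    simp only [hof]
    rw [← hS.law (-((0 : ℕ) : ℤ)), lintegral_map ENNReal.measurable_ofReal (hS.measurable _)]
  have hnn : 0 ≤ᵐ[P] fun ω => max (S (-((0 : ℕ) : ℤ)) ω) 0 := ae_of_all _ fun ω => le_max_right _ _
  have hint : Integrable (fun ω => max (S (-((0 : ℕ) : ℤ)) ω) 0) P := by
    refine ⟨(hm 0).aestronglyMeasurable, ?_⟩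
    rw [hasFiniteIntegral_iff_ofReal hnn, hlint]
    exact hES.lt_top
  have hslln := strong_law_ae_real (fun (p : ℕ) ω => max (S (-(p : ℤ)) ω) 0) hint
    (fun p q hpq => (hS.indep.indepFun (by simpa using hpq)).comp hmax hmax)
    (fun p => (IdentDistrib.mk (hS.measurable _).aemeasurable (hS.measurable _).aemeasurable
      (by rw [hS.law, hS.law])).comp hmax)
  rw [integral_eq_lintegral_of_nonneg_ae hnn
    (hm 0).aestronglyMeasurable, hlint] at hslln
  exact hslln

variable [IsProbabilityMeasure P]

lemma IsPoisson.lintegral_apply (hΦ : IsPoisson P Φ lam) (hlam : 0 ≤ lam) {B : Set ℝ}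
    (hB : MeasurableSet B) (hb : Bornology.IsBounded B) :
    ∫⁻ ω, Φ ω B ∂P = ENNReal.ofReal lam * volume B := by
  have hm : Measurable fun ω => massNat (Φ ω B) :=
    measurable_massNat.comp (hΦ.pointProcess.measurable_apply hB)
  have h1 : ∫⁻ ω, Φ ω B ∂P = ∫⁻ n, (n : ℝ≥0∞) ∂(P.map fun ω => massNat (Φ ω B)) := by
    rw [lintegral_map (measurable_of_countable _) hm]
    exact lintegral_congr fun ω => ((hΦ.pointProcess.counting ω).cast_massNat hB hb).symm
  rw [h1, hΦ.map_apply_eq hlam hB hb, lintegral_poissonMeasure, ENNReal.coe_mul,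
    ENNReal.coe_toNNReal hb.measure_lt_top.ne]
  rfl

lemma IsPoisson.map_slotCount (hΦ : IsPoisson P Φ lam) (hlam : 0 ≤ lam) (h : ℝ≥0) (l : ℕ) :
    P.map (fun ω => slotCount h (Φ ω) l) = poissonMeasure (lam.toNNReal * h) := by
  have := hΦ.map_apply_eq hlam (measurableSet_Ioc (a := (-((l + 1) * h) : ℝ)) (b := -(l * h)))
    (Metric.isBounded_Ioc _ _)
  rwa [volume_slot, ENNReal.toNNReal_coe] at this

/-- The slot counts are i.i.d., so dropping one coordinate leaves their product law unchanged. -/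
lemma IsPoisson.measurePreserving_slotCount (hΦ : IsPoisson P Φ lam) (hlam : 0 ≤ lam) (h : ℝ≥0) :
    MeasurePreserving (dropSeq 1) (P.map fun ω => slotCount h (Φ ω))
      (P.map fun ω => slotCount h (Φ ω)) := by
  have hc : Measurable fun ω => slotCount h (Φ ω) :=
    (QueueTV.measurable_slotCount h).comp hΦ.pointProcess.measurable
  have hi := hΦ.iIndepFun_slotCount h
  have h1 := hi.map_fun_eq_infinitePi_map (hΦ.measurable_slotCount h)
  have h2 := (hi.precomp (g := fun l : ℕ => l + 1) (add_left_injective 1)).map_fun_eq_infinitePi_map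
    fun l => hΦ.measurable_slotCount h (l + 1)
  simp only [hΦ.map_slotCount hlam] at h1 h2
  refine ⟨measurable_dropSeq 1, ?_⟩
  rw [Measure.map_map (measurable_dropSeq 1) hc]
  exact h2.trans h1.symm

lemma IsPoisson.ae_tendsto_cumCount (hΦ : IsPoisson P Φ lam) (hlam : 0 ≤ lam) (h : ℝ≥0) :
    ∀ᵐ ω ∂P, Tendsto (fun n : ℕ => (cumCount (slotCount h (Φ ω)) n : ℝ) / n) atTop
      (𝓝 (lam * h)) := by
  have hm := hΦ.measurable_slotCount h
  have hlint : ∫⁻ ω, ((slotCount h (Φ ω) 0 : ℕ) : ℝ≥0∞) ∂P = ENNReal.ofReal (lam * h) := by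
    rw [← lintegral_map (f := fun n : ℕ => (n : ℝ≥0∞)) (measurable_of_countable _) (hm 0),
      hΦ.map_slotCount hlam, lintegral_poissonMeasure, ENNReal.ofReal_mul hlam]
    simp [ENNReal.ofReal]
  have hmr : ∀ l, Measurable fun ω => ((slotCount h (Φ ω) l : ℕ) : ℝ) := fun l =>
    (measurable_of_countable _).comp (hm l)
  have hof : ∀ ω, ENNReal.ofReal ((slotCount h (Φ ω) 0 : ℕ) : ℝ) = (slotCount h (Φ ω) 0 : ℕ) :=
    fun ω => ENNReal.ofReal_natCast _
  have hint : Integrable (fun ω => ((slotCount h (Φ ω) 0 : ℕ) : ℝ)) P := by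
    refine ⟨(hmr 0).aestronglyMeasurable, ?_⟩
    rw [hasFiniteIntegral_iff_ofReal (ae_of_all _ fun ω => Nat.cast_nonneg _)]
    simp only [hof, hlint]
    exact ENNReal.ofReal_lt_top
  have hval : ∫ ω, ((slotCount h (Φ ω) 0 : ℕ) : ℝ) ∂P = lam * h := by
    rw [integral_eq_lintegral_of_nonneg_ae (ae_of_all _ fun ω => Nat.cast_nonneg _)
      (hmr 0).aestronglyMeasurable]
    simp only [hof, hlint]
    exact ENNReal.toReal_ofReal (mul_nonneg hlam h.2)
  have hslln := strong_law_ae_real (fun l ω => ((slotCount h (Φ ω) l : ℕ) : ℝ)) hint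
    (fun l m hlm => ((hΦ.iIndepFun_slotCount h).indepFun hlm).comp
      (measurable_of_countable _) (measurable_of_countable _))
    (fun l => (IdentDistrib.mk (hm l).aemeasurable (hm 0).aemeasurable
      (by rw [hΦ.map_slotCount hlam, hΦ.map_slotCount hlam])).comp
        (measurable_of_countable (fun n : ℕ => (n : ℝ))))
  rw [hval] at hslln
  filter_upwards [hslln] with ω hω
  simpa [cumCount] using hω

/-- The law of large numbers for the work brought by the Poisson input. -/
lemma IsPoisson.ae_tendsto_cumWork (hΦ : IsPoisson P Φ lam) (hlam : 0 < lam)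
    (hS : IsServiceSeq P S PS) (hES : ∫⁻ x, ENNReal.ofReal x ∂PS ≠ ∞) {h : ℝ≥0} (hh : 0 < h) :
    ∀ᵐ ω ∂P, Tendsto (fun n : ℕ => cumWork (workSeq h Φ S ω) n / n) atTop
      (𝓝 (ENNReal.ofReal (lam * h) * ∫⁻ x, ENNReal.ofReal x ∂PS)) := by
  filter_upwards [hΦ.ae_tendsto_cumCount hlam.le h, hS.ae_tendsto_sum hES] with ω h1 h2
  set c := slotCount h (Φ ω) with hc
  have hpos : 0 < lam * h := mul_pos hlam hh
  have h3 := h2.comp (tendsto_natCast_of_tendsto_div hpos h1)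
  -- Work per slot is jobs per slot times work per job; the second average is taken along the random
  -- number of jobs, which tends to infinity.
  have h4 := (ENNReal.continuous_ofReal.tendsto _).comp (h1.mul h3)
  rw [ENNReal.ofReal_mul hpos.le, ENNReal.ofReal_toReal hES] at h4
  refine h4.congr' ?_
  filter_upwards [eventually_ne_atTop 0,
    (tendsto_natCast_of_tendsto_div hpos h1).eventually_ne_atTop 0] with n hn hcn
  have hn' : (0 : ℝ) < n := by exact_mod_cast Nat.pos_of_ne_zero hn
  have hcn' : (cumCount c n : ℝ) ≠ 0 := by exact_mod_cast hcn
  have h5 : cumWork (workSeq h Φ S ω) n =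
      ENNReal.ofReal (∑ p ∈ Finset.range (cumCount c n), max (S (-(p : ℤ)) ω) 0) := by
    have := cumWork_dropSeq_slotWork c (fun j => S j ω) 0 n
    rw [dropSeq_zero, add_zero] at this
    rw [workSeq, ← hc, this, ENNReal.ofReal_sum_of_nonneg fun p _ => le_max_right _ _]
    rw [Finset.range_eq_Ico]
    refine Finset.sum_congr (by simp [cumCount]) fun p _ => ?_
    simp [ENNReal.ofReal_max]
  rw [h5, ← ENNReal.ofReal_natCast n, ← ENNReal.ofReal_div_of_pos hn']
  simp only [Function.comp]
  congr 1
  field_simp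

lemma IsPoisson.ae_Iic_eq_top (hΦ : IsPoisson P Φ lam) (hlam : 0 < lam) :
    ∀ᵐ ω ∂P, Φ ω (Set.Iic 0) = ∞ := by
  filter_upwards [hΦ.ae_tendsto_cumCount hlam.le 1] with ω hω
  have h1 := tendsto_natCast_of_tendsto_div (by simpa using hlam) hω
  refine ENNReal.eq_top_of_forall_nnreal_le fun r => ?_
  obtain ⟨n, hn⟩ := (h1.eventually_ge_atTop ⌈r⌉₊).exists
  calc (r : ℝ≥0∞) ≤ (⌈r⌉₊ : ℕ) := by exact_mod_cast Nat.le_ceil r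
    _ ≤ cumCount (slotCount 1 (Φ ω)) n := by exact_mod_cast hn
    _ = Φ ω (Set.Ioc (-(n * (1 : ℝ≥0)) : ℝ) 0) :=
      ((hΦ.pointProcess.counting ω).measure_Ioc_eq_cumCount 1 n).symm
    _ ≤ _ := measure_mono Set.Ioc_subset_Iic_self

lemma tendsto_measure_compl_zero {E : ℕ → Set Ω} (hE : ∀ n, MeasurableSet (E n))
    (h : ∀ᵐ ω ∂P, ∀ᶠ n in atTop, ω ∈ E n) : Tendsto (fun n => P (E n)ᶜ) atTop (𝓝 0) := by
  have := tendsto_measure_of_ae_tendsto_indicator_of_isFiniteMeasure (μ := P) atTop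
    (A := ∅) (As := fun n => (E n)ᶜ) MeasurableSet.empty (fun n => (hE n).compl) (by
      filter_upwards [h] with ω hω
      filter_upwards [hω] with n hn
      simpa using hn)
  simpa using this

end PoissonInput

/-! ### Regeneration inside a bounded window -/

/-- The event that, among the slots `l₀, …, l₀ + L - 1`, the total idle time (with horizon `u`)
exceeds the total length of the nonempty slots by `η`, and that there are enough points before these
slots and in `(0, β]` to locate job `i`. -/
def goodWindow (h : ℝ≥0) (η : ℝ≥0∞) (β : ℝ) (i : ℤ) (l₀ L u : ℕ) :
    Set (Measure ℝ × (ℤ → ℝ)) :=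
  {p | (i.toNat : ℝ≥0∞) ≤ p.1 (Set.Ioc 0 β)} ∩
  ({p | i.natAbs + 1 ≤ cumCount (slotCount h p.1) l₀} ∩
  {p | ∑ l ∈ Finset.range L, (if slotCount h p.1 (l + l₀) = 0 then 0 else (h : ℝ≥0∞)) + η ≤
    ∑ l ∈ Finset.range L,
      idle h u (dropSeq (l + (l₀ + 1)) (slotWork (slotCount h p.1) p.2))})

/-- The idle time lost by passing from horizon `u` to the two-sided regime. -/
def idleGap (h : ℝ≥0) (l₀ L u : ℕ) (x : ℕ → ℝ≥0∞) : ℝ≥0∞ :=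
  ∑ l ∈ Finset.range L,
    (idle h u (dropSeq (l + (l₀ + 1)) x) - idleInf h (dropSeq (l + (l₀ + 1)) x))

section Window

variable {h : ℝ≥0} {η : ℝ≥0∞} {β : ℝ} {i : ℤ} {l₀ L u : ℕ}

lemma measurableSet_goodWindow : MeasurableSet (goodWindow h η β i l₀ L u) := by
  have hc : Measurable fun p : Measure ℝ × (ℤ → ℝ) => slotCount h p.1 :=
    (measurable_slotCount h).comp measurable_fst
  have hx : Measurable fun p : Measure ℝ × (ℤ → ℝ) => slotWork (slotCount h p.1) p.2 := by
    have : Measurable fun p : Measure ℝ × (ℤ → ℝ) => (slotCount h p.1, p.2) :=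
      hc.prodMk measurable_snd
    exact measurable_slotWork.comp this
  refine MeasurableSet.inter ?_ (MeasurableSet.inter ?_ ?_)
  · exact measurableSet_le measurable_const
      ((Measure.measurable_coe measurableSet_Ioc).comp measurable_fst)
  · exact measurableSet_le measurable_const ((measurable_cumCount l₀).comp hc)
  · refine measurableSet_le ((Finset.measurable_sum _ fun l _ => ?_).add_const _)
      (Finset.measurable_sum _ fun l _ =>
        (measurable_idle h u).comp ((measurable_dropSeq _).comp hx))
    exact (measurable_of_countable fun n : ℕ => if n = 0 then 0 else (h : ℝ≥0∞)).comp
      ((measurable_pi_apply (l + l₀)).comp hc)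

lemma measurable_idleGap : Measurable (idleGap h l₀ L u) :=
  Finset.measurable_sum _ fun _ _ =>
    ((measurable_idle h u).comp (measurable_dropSeq _)).sub
      ((measurable_idleInf h).comp (measurable_dropSeq _))

/-- Otherwise two-sided idle time could occur only in slots that precede nonempty ones, so its total
would not exceed the length of the nonempty slots; the excess `η`, larger than the gap, contradicts
this. -/
lemma exists_idle_slot {p : Measure ℝ × (ℤ → ℝ)} (hp : p ∈ goodWindow h η β i l₀ L u)
    (hgap : idleGap h l₀ L u (slotWork (slotCount h p.1) p.2) < η) :
    ∃ l < L, slotCount h p.1 (l + l₀) = 0 ∧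
      idleInf h (dropSeq (l + l₀ + 1) (slotWork (slotCount h p.1) p.2)) ≠ 0 := by
  by_contra hcon
  push Not at hcon
  set x := slotWork (slotCount h p.1) p.2 with hx
  have h1 : ∑ l ∈ Finset.range L, idleInf h (dropSeq (l + (l₀ + 1)) x) ≤
      ∑ l ∈ Finset.range L, (if slotCount h p.1 (l + l₀) = 0 then 0 else (h : ℝ≥0∞)) := by
    refine Finset.sum_le_sum fun l hl => ?_
    split_ifs with h0
    · rw [← add_assoc, hcon l (Finset.mem_range.1 hl) h0]
    · exact idleInf_le _ _
  have h2 : ∑ l ∈ Finset.range L, idle h u (dropSeq (l + (l₀ + 1)) x) ≤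
      ∑ l ∈ Finset.range L, idleInf h (dropSeq (l + (l₀ + 1)) x) + idleGap h l₀ L u x := by
    rw [idleGap, ← Finset.sum_add_distrib]
    exact Finset.sum_le_sum fun l _ => le_add_tsub
  have h3 := hp.2.2
  have h4 := h3.trans (h2.trans (add_le_add_left h1 _))
  have hfin : ∑ l ∈ Finset.range L,
      (if slotCount h p.1 (l + l₀) = 0 then 0 else (h : ℝ≥0∞)) ≠ ∞ :=
    ENNReal.sum_ne_top.2 fun l _ => by split_ifs <;> simp
  exact absurd ((ENNReal.add_le_add_iff_left hfin).1 h4) (not_le.2 hgap)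

lemma idle_congr {x y : ℕ → ℝ≥0∞} (hxy : ∀ j ≤ u, x j = y j) : idle h u x = idle h u y := by
  have hc : ∀ k ≤ u, cumWork (dropSeq 1 x) k = cumWork (dropSeq 1 y) k := fun k hk =>
    Finset.sum_congr rfl fun l hl => hxy _ (by have := Finset.mem_range.1 hl; omega)
  have hl : load h u (dropSeq 1 x) = load h u (dropSeq 1 y) :=
    Finset.sup_congr rfl fun k hk => by
      rw [hc k (Nat.lt_succ_iff.1 (Finset.mem_range.1 hk))]
  rw [idle, idle, hxy 0 (Nat.zero_le _), hl]

lemma cumCount_congr {c c' : ℕ → ℕ} {U : ℕ} (hc : ∀ l < U, c l = c' l) {k : ℕ} (hk : k ≤ U) :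
    cumCount c k = cumCount c' k :=
  Finset.sum_congr rfl fun l hl => hc l ((Finset.mem_range.1 hl).trans_le hk)

lemma slotWork_congr {c c' : ℕ → ℕ} {U : ℕ} (hc : ∀ l < U, c l = c' l) (S : ℤ → ℝ) {l : ℕ}
    (hl : l < U) : slotWork c S l = slotWork c' S l := by
  rw [slotWork, slotWork, cumCount_congr hc hl.le, cumCount_congr hc (Nat.succ_le_of_lt hl)]

lemma slotCount_restrict {φ : Measure ℝ} {a b : ℝ} {U : ℕ} (ha : a ≤ -(U * h)) (hb : 0 < b)
    {l : ℕ} (hl : l < U) : slotCount h (φ.restrict (Set.Ico a b)) l = slotCount h φ l := by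
  have hh : (0 : ℝ) ≤ h := h.2
  have hlU : (l + 1 : ℝ) ≤ U := by exact_mod_cast hl
  rw [slotCount, slotCount, Measure.restrict_apply measurableSet_Ioc, Set.inter_eq_left.2]
  intro x hx
  refine ⟨ha.trans (le_trans ?_ hx.1.le), hx.2.trans_lt (lt_of_le_of_lt ?_ hb)⟩
  · nlinarith
  · simp only [Left.neg_nonpos_iff]; positivity

/-- The oldest slot consulted has index `(L - 1) + (l₀ + 1) + u`, so `l₀ + L + u + 1` slots before
the origin decide membership, together with the points in `(0, β]`. -/
lemma mem_goodWindow_restrict_iff {φ : Measure ℝ} {S : ℤ → ℝ} {a b : ℝ}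
    (ha : a ≤ -((l₀ + L + u + 1 : ℕ) * h)) (hβ : 0 < β) (hb : β < b) :
    (φ.restrict (Set.Ico a b), S) ∈ goodWindow h η β i l₀ L u ↔
      (φ, S) ∈ goodWindow h η β i l₀ L u := by
  have hb0 : 0 < b := hβ.trans hb
  have hc : ∀ l < l₀ + L + u + 1, slotCount h (φ.restrict (Set.Ico a b)) l = slotCount h φ l :=
    fun l hl => slotCount_restrict ha hb0 hl
  have ha0 : a ≤ 0 := ha.trans (by simp only [Left.neg_nonpos_iff]; positivity)
  have h1 : φ.restrict (Set.Ico a b) (Set.Ioc 0 β) = φ (Set.Ioc 0 β) := by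
    rw [Measure.restrict_apply measurableSet_Ioc, Set.inter_eq_left.2]
    exact fun x hx => ⟨ha0.trans hx.1.le, hx.2.trans_lt hb⟩
  have h2 := cumCount_congr hc (k := l₀) (by omega)
  have h3 : ∑ l ∈ Finset.range L,
      (if slotCount h (φ.restrict (Set.Ico a b)) (l + l₀) = 0 then 0 else (h : ℝ≥0∞)) =
      ∑ l ∈ Finset.range L, (if slotCount h φ (l + l₀) = 0 then 0 else (h : ℝ≥0∞)) :=
    Finset.sum_congr rfl fun l hl => by
      rw [hc (l + l₀) (by have := Finset.mem_range.1 hl; omega)]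
  have h4 : ∑ l ∈ Finset.range L, idle h u (dropSeq (l + (l₀ + 1))
      (slotWork (slotCount h (φ.restrict (Set.Ico a b))) S)) =
      ∑ l ∈ Finset.range L, idle h u (dropSeq (l + (l₀ + 1)) (slotWork (slotCount h φ) S)) :=
    Finset.sum_congr rfl fun l hl => idle_congr fun j hj => by
      rw [dropSeq_apply, dropSeq_apply]
      exact slotWork_congr hc S (by have := Finset.mem_range.1 hl; omega)
  simp only [goodWindow, Set.mem_inter_iff, Set.mem_ofPred_eq, h1, h2, h3, h4]

lemma idle_restrict {φ : Measure ℝ} {S : ℤ → ℝ} {a b : ℝ}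
    (ha : a ≤ -((l₀ + L + u + 1 : ℕ) * h)) (hb : 0 < b) :
    idle h u (slotWork (slotCount h (φ.restrict (Set.Ico a b))) S) =
      idle h u (slotWork (slotCount h φ) S) :=
  idle_congr fun _ hj => slotWork_congr (fun _ hl => slotCount_restrict ha hb hl) S (by omega)

/-- The arrivals outside the window are replaced by Lebesgue measure: this keeps the arrival times
in the window and puts all others outside. -/
def windowFill (B : Set ℝ) (φ : Measure ℝ) : Measure ℝ := φ.restrict B + volume.restrict Bᶜ

lemma measurable_windowFill {B : Set ℝ} (hB : MeasurableSet B) : Measurable (windowFill B) := by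
  refine Measure.measurable_of_measurable_coe _ fun s hs => ?_
  simp only [windowFill, Measure.add_apply, Measure.restrict_apply hs]
  exact (Measure.measurable_coe (hs.inter hB)).add_const _

lemma windowFill_restrict {B : Set ℝ} (φ : Measure ℝ) :
    windowFill B (φ.restrict B) = windowFill B φ := by
  rw [windowFill, windowFill, Measure.restrict_restrict_of_subset le_rfl]

/-- On the good event, the queue found by job `i` is a function of the arrivals in the window. -/
lemma queueLength_eq_windowFill {φ : Measure ℝ} (hφ : IsCounting φ) (hinf : φ (Set.Iic 0) = ∞)
    (hh : 0 < h) {S : ℤ → ℝ} (hβ : 0 < β) {a b : ℝ}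
    (ha : a ≤ -((l₀ + L + u + 1 : ℕ) * h)) (hb : β < b)
    (hgood : (φ, S) ∈ goodWindow h η β i l₀ L u)
    (hgap : idleGap h l₀ L u (slotWork (slotCount h φ) S) < η) (s : EReal) :
    queueLength (arrivalTime φ) S s i =
      queueLength (arrivalTime (windowFill (Set.Ico a b) φ)) S (max s a) i := by
  obtain ⟨l, hlL, hempty, hidle⟩ := exists_idle_slot hgood hgap
  have hhr : (0 : ℝ) < h := hh
  have ha0 : a ≤ 0 := ha.trans (by simp only [Left.neg_nonpos_iff]; positivity)
  have hal : a ≤ -(((l + l₀ : ℕ) : ℝ) * h) := by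
    have hle : ((l + l₀ : ℕ) : ℝ) ≤ ((l₀ + L + u + 1 : ℕ) : ℝ) := Nat.cast_le.2 (by omega)
    exact ha.trans (neg_le_neg (mul_le_mul_of_nonneg_right hle hhr.le))
  have hcount : i.natAbs + 1 ≤ cumCount (slotCount h φ) (l + l₀) :=
    le_trans hgood.2.1 (cumCount_mono _ (by omega))
  obtain ⟨haT, hs⟩ := queueLength_eq_of_idle hφ hinf hh hβ hgood.1 hempty hidle hcount hal
  have h1 : queueLength (arrivalTime φ) S s i = queueLength (arrivalTime φ) S (max s a) i := by
    rcases le_total s a with h | h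
    · rw [max_eq_right h, hs s h]
    · rw [max_eq_left h]
  rw [h1]
  have hfin' : ∀ x y, windowFill (Set.Ico a b) φ (Set.Icc x y) < ∞ := by
    intro x y
    rw [windowFill, Measure.add_apply]
    refine ENNReal.add_lt_top.2 ⟨?_, ?_⟩
    · exact (Measure.restrict_apply_le _ _).trans_lt (hφ.Icc_lt_top x y)
    · exact (Measure.restrict_apply_le _ _).trans_lt measure_Icc_lt_top
  -- The Lebesgue filling is used here: with only finitely many points, the epochs of missing jobs
  -- would take the default value `0` and appear inside the window.
  have hinf' : windowFill (Set.Ico a b) φ (Set.Iic 0) = ∞ := by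
    rw [windowFill, Measure.add_apply, Measure.restrict_apply measurableSet_Iic,
      Measure.restrict_apply measurableSet_Iic]
    have : volume (Set.Iio a) ≤ volume (Set.Iic 0 ∩ (Set.Ico a b)ᶜ) :=
      measure_mono fun x hx => ⟨(le_of_lt hx).trans ha0, fun h => absurd h.1 (not_le.2 hx)⟩
    rw [Real.volume_Iio, top_le_iff] at this
    rw [this, add_top]
  have heq : ∀ s, MeasurableSet s → s ⊆ Set.Ico a b → φ s = windowFill (Set.Ico a b) φ s := by
    intro s hs hsub
    rw [windowFill, Measure.add_apply, Measure.restrict_apply hs, Measure.restrict_apply hs,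
      Set.inter_eq_left.2 hsub, ← Set.sdiff_eq, Set.sdiff_eq_empty.2 hsub, measure_empty, add_zero]
  have hT : ∀ m ≤ i, _ := fun m hm => arrivalTime_eq_or_lt hφ.Icc_lt_top hinf hfin' hinf' ha0 hβ hb
    heq hgood.1 hm
  refine queueLength_congr (fun m hm => ?_) ?_
  · rcases hT m hm with h | h
    · exact Or.inl h
    · right
      exact ⟨lt_of_lt_of_le (by exact_mod_cast h.1) (le_max_right _ _),
        lt_of_lt_of_le (by exact_mod_cast h.2) (le_max_right _ _)⟩
  · rcases hT i le_rfl with h | h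
    · exact h
    · exact absurd haT (not_le.2 h.1)

/-- Markov's inequality: the gap is nonnegative and, by shift invariance, each of its `L` terms has
the same mean, at most `D`. -/
lemma measure_idleGap_ge_le {Q : Measure (ℕ → ℝ≥0∞)} [IsProbabilityMeasure Q]
    (hQ : MeasurePreserving (dropSeq 1) Q Q) {D : ℝ≥0∞}
    (hD : ∫⁻ x, idle h u x ∂Q ≤ ∫⁻ x, idleInf h x ∂Q + D) (hη0 : η ≠ 0) (hη : η ≠ ∞) :
    Q {x | η ≤ idleGap h l₀ L u x} ≤ L * D / η := by
  have hsub : ∫⁻ x, (idle h u x - idleInf h x) ∂Q ≤ D := by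
    rw [lintegral_sub (measurable_idleInf h)
      (ne_top_of_le_ne_top ENNReal.coe_ne_top (lintegral_idleInf_le h))
      (ae_of_all _ fun x => idleInf_le_idle h u x), tsub_le_iff_left]
    exact hD
  have hint : ∫⁻ x, idleGap h l₀ L u x ∂Q ≤ L * D := by
    have hmeas : ∀ l, Measurable fun x => idle h u (dropSeq l x) - idleInf h (dropSeq l x) :=
      fun l => ((measurable_idle h u).comp (measurable_dropSeq _)).sub
        ((measurable_idleInf h).comp (measurable_dropSeq _))
    unfold idleGap
    rw [lintegral_finsetSum _ fun l _ => hmeas (l + (l₀ + 1))]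
    calc _ ≤ ∑ _l ∈ Finset.range L, D := Finset.sum_le_sum fun l _ => by
          refine le_trans (le_of_eq ?_) hsub
          exact (measurePreserving_dropSeq hQ (l + (l₀ + 1))).lintegral_comp
            ((measurable_idle h u).sub (measurable_idleInf h))
      _ = L * D := by simp
  refine (meas_ge_le_lintegral_div measurable_idleGap.aemeasurable hη0 hη).trans ?_
  gcongr

end Window

/-- For the Poisson input, the good event has probability close to one, uniformly in the horizon. -/
lemma IsPoisson.exists_goodWindow {Ω : Type*} [MeasurableSpace Ω] {P : Measure Ω}
    [IsProbabilityMeasure P] {Φ : Ω → Measure ℝ} {S : ℤ → Ω → ℝ} {lam : ℝ} {PS : Measure ℝ}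
    [IsProbabilityMeasure PS] (hΦ : IsPoisson P Φ lam) (hlam : 0 < lam)
    (hS : IsServiceSeq P S PS) (hind : IndepFun Φ (fun ω j => S j ω) P)
    (hρ : ENNReal.ofReal lam * ∫⁻ x, ENNReal.ofReal x ∂PS < 1) (i : ℤ) {ε : ℝ≥0∞} (hε : ε ≠ 0) :
    ∃ (h : ℝ≥0) (η : ℝ≥0∞) (β : ℝ) (l₀ L : ℕ), 0 < h ∧ η ≠ 0 ∧ η ≠ ∞ ∧ 0 < β ∧
      ∀ u, P {ω | (Φ ω, fun j => S j ω) ∉ goodWindow h η β i l₀ L u} ≤ ε := by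
  have hlam' : ENNReal.ofReal lam ≠ 0 := by simpa using hlam
  set ES := ∫⁻ x, ENNReal.ofReal x ∂PS with hESdef
  have hES : ES ≠ ∞ := by
    intro h
    rw [h, ENNReal.mul_top hlam'] at hρ
    simp at hρ
  set ρ : ℝ := lam * ES.toReal with hρdef
  have hρ0 : 0 ≤ ρ := by positivity
  have hρ1 : ρ < 1 := by
    have := (ENNReal.toReal_lt_toReal (ENNReal.mul_ne_top ENNReal.ofReal_ne_top hES)
      ENNReal.one_ne_top).2 hρ
    rwa [ENNReal.toReal_mul, ENNReal.toReal_ofReal hlam.le, ENNReal.toReal_one] at this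
  -- The unit of slack: `1 = (ρ + c) + c + 3 * c`. The first two terms bound the work brought and
  -- the earlier backlog; of the remaining three, one pays for the nonempty slots, one for `η`, and
  -- one is spare.
  set c : ℝ := (1 - ρ) / 5 with hcdef
  have hc0 : 0 < c := by rw [hcdef]; linarith
  -- Slots so short that the mean number of jobs in a slot is `c / 2`; the fraction of nonempty
  -- slots is then eventually at most `c`.
  set h : ℝ≥0 := (c / (2 * lam)).toNNReal with hhdef
  have hhr : (h : ℝ) = c / (2 * lam) := Real.coe_toNNReal _ (by positivity)
  have hh : 0 < h := by
    rw [← NNReal.coe_pos, hhr]; positivity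
  have hhr0 : (0 : ℝ) < h := hh
  have hlh : lam * h = c / 2 := by rw [hhr]; field_simp
  set x := workSeq h Φ S with hx
  have hxm : Measurable x := measurable_workSeq h hΦ.pointProcess.measurable hS.measurable
  have hcm : Measurable fun ω => slotCount h (Φ ω) :=
    (QueueTV.measurable_slotCount h).comp hΦ.pointProcess.measurable
  have hstc := hΦ.measurePreserving_slotCount hlam.le h
  have hst := measurePreserving_workSeq h hΦ.pointProcess.measurable hS hind hstc
  have hcount := hΦ.ae_tendsto_cumCount hlam.le h
  have hwork := hΦ.ae_tendsto_cumWork hlam hS hES hh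
  rw [hlh] at hcount
  have hm : ENNReal.ofReal (lam * h) * ES = ENNReal.ofReal (ρ * h) := by
    rw [← ENNReal.ofReal_toReal hES, ← ENNReal.ofReal_mul (by positivity), hρdef]
    congr 1
    ring
  rw [hm] at hwork
  -- shifted events
  have hshift : ∀ (l : ℕ) (E : Set (ℕ → ℝ≥0∞)), MeasurableSet E →
      P {ω | dropSeq l (x ω) ∈ E} = P {ω | x ω ∈ E} := by
    intro l E hE
    have := (measurePreserving_dropSeq hst l).measure_preimage hE.nullMeasurableSet
    rwa [Measure.map_apply hxm (measurable_dropSeq l hE), Measure.map_apply hxm hE] at this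
  have hshiftc : ∀ (l : ℕ) (E : Set (ℕ → ℕ)), MeasurableSet E →
      P {ω | dropSeq l (slotCount h (Φ ω)) ∈ E} = P {ω | slotCount h (Φ ω) ∈ E} := by
    intro l E hE
    have := (measurePreserving_dropSeq hstc l).measure_preimage hE.nullMeasurableSet
    rwa [Measure.map_apply hcm (measurable_dropSeq l hE), Measure.map_apply hcm hE] at this
  -- the five events
  have hε5 : 0 < ε / 5 := ENNReal.div_pos hε (by simp)
  have htends : ∀ N : ℕ, Tendsto (fun n => P {ω | ¬ N ≤ cumCount (slotCount h (Φ ω)) n}) atTop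
      (𝓝 0) := fun N =>
    tendsto_measure_compl_zero (E := fun n => {ω | N ≤ cumCount (slotCount h (Φ ω)) n})
      (fun n => measurableSet_le measurable_const ((measurable_cumCount n).comp hcm)) (by
        filter_upwards [hcount] with ω hω
        exact (tendsto_natCast_of_tendsto_div (by positivity) hω).eventually_ge_atTop N)
  obtain ⟨l₀, hl₀⟩ := ((htends (i.natAbs + 1)).eventually (ge_mem_nhds hε5)).exists
  obtain ⟨k, hk, hk0⟩ := (((htends i.toNat).eventually (ge_mem_nhds hε5)).and
    (eventually_gt_atTop 0)).exists
  -- The number of points in `(0, k * h]` has the Poisson law of the number in `(-(k * h), 0]`, for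
  -- which the bound is known.
  have hβ : P {ω | ¬ (i.toNat : ℝ≥0∞) ≤ Φ ω (Set.Ioc 0 (k * h : ℝ))} ≤ ε / 5 := by
    refine le_trans (le_of_eq ?_) hk
    have hIoc : ∀ a b : ℝ, P {ω | ¬ (i.toNat : ℝ≥0∞) ≤ Φ ω (Set.Ioc a b)} =
        poissonMeasure (lam.toNNReal * (ENNReal.ofReal (b - a)).toNNReal) {n | ¬ i.toNat ≤ n} := by
      intro a b
      have hb := Metric.isBounded_Ioc a b
      have hmeas : Measurable fun ω => massNat (Φ ω (Set.Ioc a b)) :=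
        measurable_massNat.comp (hΦ.pointProcess.measurable_apply measurableSet_Ioc)
      rw [← Real.volume_Ioc, ← hΦ.map_apply_eq hlam.le measurableSet_Ioc hb,
        Measure.map_apply hmeas MeasurableSet.of_discrete]
      congr 1
      ext ω
      obtain ⟨n, hn⟩ := hΦ.pointProcess.counting ω _ (measurableSet_Ioc (a := a) (b := b)) hb
      simp [hn]
    have h1 : {ω | ¬ i.toNat ≤ cumCount (slotCount h (Φ ω)) k} =
        {ω | ¬ (i.toNat : ℝ≥0∞) ≤ Φ ω (Set.Ioc (-(k * h) : ℝ) 0)} := by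
      ext ω
      simp [(hΦ.pointProcess.counting ω).measure_Ioc_eq_cumCount]
    rw [h1, hIoc, hIoc, sub_zero, zero_sub, neg_neg]
  -- bounds that hold for large `L`
  set E₁ : ℕ → Set (ℕ → ℝ≥0∞) := fun L => {y | cumWork y L ≤ ENNReal.ofReal ((ρ + c) * h) * L}
  set E₂ : ℕ → Set (ℕ → ℝ≥0∞) := fun L => {y | loadInf h y ≤ ENNReal.ofReal (c * h) * L}
  set E₃ : ℕ → Set (ℕ → ℕ) := fun L => {y | (cumCount y L : ℝ) ≤ c * L}
  have hE₁ : ∀ L, MeasurableSet (E₁ L) := fun L =>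
    measurableSet_le (measurable_cumWork L) measurable_const
  have hE₂ : ∀ L, MeasurableSet (E₂ L) := fun L =>
    measurableSet_le (measurable_loadInf h) measurable_const
  have hE₃ : ∀ L, MeasurableSet (E₃ L) := fun L =>
    measurableSet_le ((measurable_of_countable _).comp (measurable_cumCount L)) measurable_const
  have t₁ : Tendsto (fun L => P {ω | x ω ∈ (E₁ L)ᶜ}) atTop (𝓝 0) := by
    refine tendsto_measure_compl_zero (E := fun L => {ω | x ω ∈ E₁ L}) (fun L => hxm (hE₁ L)) ?_
    filter_upwards [hwork] with ω hω
    have hlt : ENNReal.ofReal (ρ * h) < ENNReal.ofReal ((ρ + c) * h) := by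
      rw [ENNReal.ofReal_lt_ofReal_iff (by positivity)]
      nlinarith
    filter_upwards [hω.eventually_lt_const hlt, eventually_ne_atTop 0] with L hL hL0
    exact (ENNReal.div_le_iff (by exact_mod_cast hL0) (by simp)).1 hL.le
  have t₂ : Tendsto (fun L => P {ω | x ω ∈ (E₂ L)ᶜ}) atTop (𝓝 0) := by
    refine tendsto_measure_compl_zero (E := fun L => {ω | x ω ∈ E₂ L}) (fun L => hxm (hE₂ L)) ?_
    filter_upwards [hwork] with ω hω
    have hlt : ENNReal.ofReal (ρ * h) < h := by
      rw [← ENNReal.ofReal_coe_nnreal, ENNReal.ofReal_lt_ofReal_iff (by positivity)]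
      nlinarith
    have hfin := loadInf_lt_top hlt hω
    have htop : Tendsto (fun L : ℕ => ENNReal.ofReal (c * h) * L) atTop (𝓝 ∞) := by
      have := ENNReal.Tendsto.const_mul (a := ENNReal.ofReal (c * h)) ENNReal.tendsto_nat_nhds_top
        (Or.inl (by simp))
      rwa [ENNReal.mul_top (by simp; positivity)] at this
    filter_upwards [htop.eventually (lt_mem_nhds hfin)] with L hL
    exact hL.le
  have t₃ : Tendsto (fun L => P {ω | slotCount h (Φ ω) ∈ (E₃ L)ᶜ}) atTop (𝓝 0) := by
    refine tendsto_measure_compl_zero (E := fun L => {ω | slotCount h (Φ ω) ∈ E₃ L})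
      (fun L => hcm (hE₃ L)) ?_
    filter_upwards [hcount] with ω hω
    filter_upwards [hω.eventually_lt_const (by linarith : c / 2 < c), eventually_ne_atTop 0]
      with L hL hL0
    have hL0' : (0 : ℝ) < L := by exact_mod_cast Nat.pos_of_ne_zero hL0
    exact ((div_lt_iff₀ hL0').1 hL).le
  obtain ⟨L, ⟨⟨b₁, b₂⟩, b₃⟩, hL0⟩ := ((((t₁.eventually (ge_mem_nhds hε5)).and
    (t₂.eventually (ge_mem_nhds hε5))).and (t₃.eventually (ge_mem_nhds hε5))).and
    (eventually_gt_atTop 0)).exists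
  -- Stationarity moves the three bounds to the slots where they are needed, without changing their
  -- probabilities.
  rw [← hshift (l₀ + 1) _ (hE₁ L).compl] at b₁
  rw [← hshift (L + (l₀ + 1)) _ (hE₂ L).compl] at b₂
  rw [← hshiftc l₀ _ (hE₃ L).compl] at b₃
  have hk0' : (0 : ℝ) < k := by exact_mod_cast hk0
  have hL0' : (L : ℝ≥0∞) ≠ 0 := by exact_mod_cast hL0.ne'
  have hch : ENNReal.ofReal (c * h) ≠ 0 := by simp; positivity
  refine ⟨h, ENNReal.ofReal (c * h) * L, k * h, l₀, L, hh, mul_ne_zero hch hL0',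
    ENNReal.mul_ne_top ENNReal.ofReal_ne_top (by simp), by positivity, fun u => ?_⟩
  have hsub : {ω | (Φ ω, fun j => S j ω) ∉ goodWindow h (ENNReal.ofReal (c * h) * L) (k * h) i l₀ L u}
      ⊆ {ω | ¬ (i.toNat : ℝ≥0∞) ≤ Φ ω (Set.Ioc 0 (k * h : ℝ))} ∪
        ({ω | ¬ i.natAbs + 1 ≤ cumCount (slotCount h (Φ ω)) l₀} ∪
        ({ω | dropSeq (l₀ + 1) (x ω) ∈ (E₁ L)ᶜ} ∪ ({ω | dropSeq (L + (l₀ + 1)) (x ω) ∈ (E₂ L)ᶜ} ∪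
        {ω | dropSeq l₀ (slotCount h (Φ ω)) ∈ (E₃ L)ᶜ}))) := by
    intro ω hω
    by_contra hcon
    simp only [Set.mem_union, Set.mem_ofPred_eq, not_or, Set.mem_compl_iff, not_not] at hcon
    obtain ⟨g1, g2, g3, g4, g5⟩ := hcon
    refine hω ⟨g1, g2, ?_⟩
    change _ + _ ≤ ∑ l ∈ Finset.range L, idle h u (dropSeq (l + (l₀ + 1)) (x ω))
    have hsum := sum_idleInf h (dropSeq (l₀ + 1) (x ω)) L
    simp only [dropSeq_dropSeq] at hsum
    have hlow : (L : ℝ≥0∞) * h ≤ ENNReal.ofReal ((ρ + c) * h) * L + ENNReal.ofReal (c * h) * L +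
        ∑ l ∈ Finset.range L, idleInf h (dropSeq (l + (l₀ + 1)) (x ω)) := by
      refine le_trans le_add_self (hsum.le.trans ?_)
      gcongr
      · exact g3
      · exact g4
    have hLh : (L : ℝ≥0∞) * h = (ENNReal.ofReal ((ρ + c) * h) * L + ENNReal.ofReal (c * h) * L) +
        (ENNReal.ofReal (c * h) * L + ENNReal.ofReal (c * h) * L +
          ENNReal.ofReal (c * h) * L) := by
      have h1 : (0 : ℝ) ≤ (ρ + c) * h := by positivity
      have h2 : (0 : ℝ) ≤ c * h := by positivity
      have hsplit : (h : ℝ≥0∞) = ENNReal.ofReal ((ρ + c) * h) + ENNReal.ofReal (c * h) +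
          (ENNReal.ofReal (c * h) + ENNReal.ofReal (c * h) + ENNReal.ofReal (c * h)) := by
        rw [← ENNReal.ofReal_add h1 h2, ← ENNReal.ofReal_add h2 h2,
          ← ENNReal.ofReal_add (add_nonneg h2 h2) h2, ← ENNReal.ofReal_add (add_nonneg h1 h2)
            (add_nonneg (add_nonneg h2 h2) h2), ← ENNReal.ofReal_coe_nnreal]
        congr 1
        rw [hcdef]
        ring
      conv_lhs => rw [hsplit]
      ring
    rw [hLh] at hlow
    have hlow' := (ENNReal.add_le_add_iff_left (ENNReal.add_ne_top.2
      ⟨ENNReal.mul_ne_top ENNReal.ofReal_ne_top (by simp),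
        ENNReal.mul_ne_top ENNReal.ofReal_ne_top (by simp)⟩)).1 hlow
    -- A nonempty slot contains at least one job, so the number of nonempty slots is at most the
    -- number of jobs.
    have hpen : ∑ l ∈ Finset.range L,
        (if slotCount h (Φ ω) (l + l₀) = 0 then 0 else (h : ℝ≥0∞)) ≤
        ENNReal.ofReal (c * h) * L := by
      calc _ ≤ ∑ l ∈ Finset.range L, (h : ℝ≥0∞) * (slotCount h (Φ ω) (l + l₀) : ℕ) := by
            refine Finset.sum_le_sum fun l _ => ?_
            split_ifs with h0
            · exact zero_le
            · exact le_mul_of_one_le_right zero_le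
                (by exact_mod_cast Nat.one_le_iff_ne_zero.2 h0)
        _ = (h : ℝ≥0∞) * (cumCount (dropSeq l₀ (slotCount h (Φ ω))) L : ℕ) := by
            rw [← Finset.mul_sum, cumCount]
            simp
        _ ≤ (h : ℝ≥0∞) * ENNReal.ofReal (c * L) := by
            gcongr
            rw [← ENNReal.ofReal_natCast]
            exact ENNReal.ofReal_le_ofReal g5
        _ = ENNReal.ofReal (c * h) * L := by
            rw [← ENNReal.ofReal_coe_nnreal, ← ENNReal.ofReal_natCast L,
              ← ENNReal.ofReal_mul (by positivity), ← ENNReal.ofReal_mul (by positivity)]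
            congr 1
            ring
    calc _ ≤ ENNReal.ofReal (c * h) * L + ENNReal.ofReal (c * h) * L := by gcongr
      _ ≤ _ := le_self_add
      _ ≤ _ := hlow'
      _ ≤ _ := Finset.sum_le_sum fun l _ => idleInf_le_idle _ _ _
  calc _ ≤ _ := measure_mono hsub
    _ ≤ ε / 5 + (ε / 5 + (ε / 5 + (ε / 5 + ε / 5))) := by
        refine (measure_union_le _ _).trans (add_le_add hβ ?_)
        refine (measure_union_le _ _).trans (add_le_add hl₀ ?_)
        refine (measure_union_le _ _).trans (add_le_add b₁ ?_)
        exact (measure_union_le _ _).trans (add_le_add b₂ b₃)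
    _ = 5 * (ε / 5) := by ring
    _ = ε := ENNReal.mul_div_cancel (by simp) (by simp)

/-! ### Sparse arrays -/

section Sparse

variable {Ω : Type*} [MeasurableSpace Ω] {P : Measure Ω} {K : ℕ} {Φ : Fin K → Ω → Measure ℝ}

lemma lintegral_superposition (hΦ : ∀ k, IsPointProcess (Φ k)) {s : Set ℝ} (hs : MeasurableSet s) :
    ∫⁻ ω, superposition Φ ω s ∂P = ∑ k, ∫⁻ ω, Φ k ω s ∂P := by
  rw [← lintegral_finsetSum _ fun k _ => (hΦ k).measurable_apply hs]
  simp [superposition]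

lemma g₁_eq_sum (hΦ : ∀ k, IsPointProcess (Φ k)) {B : Set ℝ} (hB : MeasurableSet B)
    (hb : Bornology.IsBounded B) :
    g₁ P Φ B = ∑ k, ∫⁻ ω in {ω | 2 ≤ Φ k ω B}, Φ k ω B ∂P :=
  Finset.sum_congr rfl fun k _ => (setLIntegral_two_le_eq_tsum ((hΦ k).measurable_apply hB)
    fun ω => (hΦ k).counting ω B hB hb).symm

lemma rate_mul_volume {B : Set ℝ} (hb : Bornology.IsBounded B) (hv : volume B ≠ 0) (k : Fin K) :
    rate P Φ k B * volume B = P {ω | Φ k ω B = 1} :=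
  ENNReal.div_mul_cancel hv hb.measure_lt_top.ne

lemma lintegral_superposition_eq (hΦ : ∀ k, IsPointProcess (Φ k)) {B : Set ℝ}
    (hB : MeasurableSet B) (hb : Bornology.IsBounded B) (hv : volume B ≠ 0) :
    ∫⁻ ω, superposition Φ ω B ∂P = sumRate P Φ B * volume B + g₁ P Φ B := by
  rw [lintegral_superposition hΦ hB, g₁_eq_sum hΦ hB hb, sumRate, Finset.sum_mul,
    ← Finset.sum_add_distrib]
  exact Finset.sum_congr rfl fun k _ => by
    rw [rate_mul_volume hb hv, ← lintegral_eq_measure_one_add ((hΦ k).measurable_apply hB)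
      fun ω => (hΦ k).counting ω B hB hb]

lemma add_sq_le_four_mul (x y : ℝ≥0∞) : (x + y) ^ 2 ≤ 4 * x ^ 2 + 4 * y ^ 2 := by
  rcases le_total x y with h | h
  · calc (x + y) ^ 2 ≤ (y + y) ^ 2 := by gcongr
      _ = 4 * y ^ 2 := by ring
      _ ≤ _ := le_add_self
  · calc (x + y) ^ 2 ≤ (x + x) ^ 2 := by gcongr
      _ = 4 * x ^ 2 := by ring
      _ ≤ _ := le_self_add

/-- The Poisson approximation error of a sparse row is of order `g`. -/
lemma sum_error_le (hΦ : ∀ k, IsPointProcess (Φ k)) {B : Set ℝ} (hB : MeasurableSet B)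
    (hb : Bornology.IsBounded B) (hv : volume B ≠ 0) {c : ℝ≥0∞}
    (hc : ∫⁻ ω, superposition Φ ω B ∂P ≤ c * volume B) (hg : g₁ P Φ B ≤ 1) :
    ∑ k, ((∫⁻ ω, Φ k ω B ∂P) ^ 2 + 2 * ∫⁻ ω in {ω | 2 ≤ Φ k ω B}, Φ k ω B ∂P) ≤
      (4 * c + 6) * g P Φ B := by
  set p : Fin K → ℝ≥0∞ := fun k => P {ω | Φ k ω B = 1}
  set γ : Fin K → ℝ≥0∞ := fun k => ∫⁻ ω in {ω | 2 ≤ Φ k ω B}, Φ k ω B ∂P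
  have ht : ∀ k, ∫⁻ ω, Φ k ω B ∂P = p k + γ k := fun k =>
    lintegral_eq_measure_one_add ((hΦ k).measurable_apply hB) fun ω => (hΦ k).counting ω B hB hb
  have hγ : ∑ k, γ k = g₁ P Φ B := (g₁_eq_sum hΦ hB hb).symm
  have hp : ∑ k, p k ≤ c * volume B := by
    refine le_trans ?_ hc
    rw [lintegral_superposition hΦ hB]
    exact Finset.sum_le_sum fun k _ => by rw [ht]; exact le_self_add
  -- One factor is replaced by its maximum over users; summing the other gives `c * volume B`, hence
  -- the term `volume B ^ 2 * g₂`.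
  have hpsq : ∀ k, p k ^ 2 ≤ p k * (g₂ P Φ B * volume B) := fun k => by
    rw [sq]
    gcongr
    refine (rate_mul_volume (P := P) (Φ := Φ) hb hv k).symm.le.trans ?_
    gcongr
    exact le_iSup (fun k => rate P Φ k B) k
  -- Each `γ k` is at most `g₁ ≤ 1`, so its square is absorbed in the linear term.
  have hγsq : ∀ k, γ k ^ 2 ≤ γ k := fun k => by
    have : γ k ≤ 1 := (Finset.single_le_sum (f := γ) (fun _ _ => zero_le)
      (Finset.mem_univ k)).trans (hγ.le.trans hg)
    calc γ k ^ 2 = γ k * γ k := sq _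
      _ ≤ γ k * 1 := by gcongr
      _ = γ k := mul_one _
  calc ∑ k, ((∫⁻ ω, Φ k ω B ∂P) ^ 2 + 2 * γ k)
      ≤ ∑ k, (4 * (p k * (g₂ P Φ B * volume B)) + 6 * γ k) := by
        refine Finset.sum_le_sum fun k _ => ?_
        rw [ht]
        calc (p k + γ k) ^ 2 + 2 * γ k ≤ 4 * p k ^ 2 + 4 * γ k ^ 2 + 2 * γ k := by
              gcongr; exact add_sq_le_four_mul _ _
          _ ≤ 4 * (p k * (g₂ P Φ B * volume B)) + 4 * γ k + 2 * γ k := by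
              gcongr
              · exact hpsq k
              · exact hγsq k
          _ = _ := by ring
    _ = 4 * ((∑ k, p k) * (g₂ P Φ B * volume B)) + 6 * g₁ P Φ B := by
        rw [Finset.sum_add_distrib, ← Finset.mul_sum, ← Finset.mul_sum, ← Finset.sum_mul, hγ]
    _ ≤ 4 * (c * volume B * (g₂ P Φ B * volume B)) + 6 * g₁ P Φ B := by gcongr
    _ = 4 * c * (volume B ^ 2 * g₂ P Φ B) + 6 * g₁ P Φ B := by ring
    _ ≤ 4 * c * g P Φ B + 6 * g P Φ B := by
        gcongr
        · exact le_max_right _ _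
        · exact le_max_left _ _
    _ = _ := by ring

end Sparse

section Array

variable {Ω : ℕ → Type*} [∀ K, MeasurableSpace (Ω K)] {P : ∀ K, Measure (Ω K)}
  {Φ : ∀ K, Fin K → Ω K → Measure ℝ}

/-- On the given interval the mean number of points is rate times length plus `g₁`, so it converges.
Stationarity extends the intensity to all sets; rows of infinite mean, possible for finitely many
`K` only, get the dummy value `0`. -/
lemma exists_intensity_tendsto [∀ K, IsProbabilityMeasure (P K)]
    (hΦ : ∀ K k, IsPointProcess (Φ K k)) (hst : ∀ K k, IsStationary (P K) (Φ K k)) (hind : ∀ K, iIndepFun (Φ K) (P K)) {a b : ℝ}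
    (hab : a < b) {lam : ℝ}
    (hg : Tendsto (fun K => g₁ (P K) (Φ K) (Set.Ico a b)) atTop (𝓝 0))
    (hrate : Tendsto (fun K => sumRate (P K) (Φ K) (Set.Ico a b)) atTop
      (𝓝 (ENNReal.ofReal lam))) :
    ∃ ℓ : ℕ → ℝ≥0, (∀ᶠ K in atTop, ∀ s, MeasurableSet s →
      ∫⁻ ω, superposition (Φ K) ω s ∂(P K) = ℓ K * volume s) ∧
      Tendsto ℓ atTop (𝓝 lam.toNNReal) := by
  have hv : volume (Set.Ico a b) ≠ 0 := by simpa using hab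
  have hvt : volume (Set.Ico a b) ≠ ∞ := by simp
  have hlim : Tendsto (fun K => ∫⁻ ω, superposition (Φ K) ω (Set.Ico a b) ∂(P K)) atTop
      (𝓝 (ENNReal.ofReal lam * volume (Set.Ico a b))) := by
    simp_rw [fun K => lintegral_superposition_eq (P := P K) (hΦ K) measurableSet_Ico
      (Metric.isBounded_Ico a b) hv]
    simpa using (ENNReal.Tendsto.mul_const hrate (Or.inr hvt)).add hg
  have hex : ∀ K, ∃ ℓ : ℝ≥0, ∫⁻ ω, superposition (Φ K) ω (Set.Ico a b) ∂(P K) ≠ ∞ →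
      ∀ s, MeasurableSet s → ∫⁻ ω, superposition (Φ K) ω s ∂(P K) = ℓ * volume s := by
    intro K
    by_cases h : ∫⁻ ω, superposition (Φ K) ω (Set.Ico a b) ∂(P K) = ∞
    · exact ⟨0, fun h' => absurd h h'⟩
    · obtain ⟨ℓ, hℓ⟩ := (isStationary_superposition (fun k => (hΦ K k).measurable) (hst K)
        (hind K)).exists_intensity (isPointProcess_superposition (hΦ K)).measurable hab h
      exact ⟨ℓ, fun _ => hℓ⟩
  choose ℓ hℓ using hex
  have hev : ∀ᶠ K in atTop, ∀ s, MeasurableSet s →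
      ∫⁻ ω, superposition (Φ K) ω s ∂(P K) = ℓ K * volume s := by
    filter_upwards [hlim.eventually_lt_const
      (ENNReal.mul_lt_top ENNReal.ofReal_lt_top hvt.lt_top)] with K hK
    exact hℓ K hK.ne
  refine ⟨ℓ, hev, ?_⟩
  rw [← ENNReal.tendsto_coe]
  have h1 := ENNReal.Tendsto.div_const hlim (Or.inr hv)
  rw [ENNReal.mul_div_cancel_right hv hvt] at h1
  refine h1.congr' ?_
  filter_upwards [hev] with K hK
  rw [hK _ measurableSet_Ico, ENNReal.mul_div_cancel_right hv hvt]

lemma IsSparse.g_tendsto (h : IsSparse P Φ) {a b : ℝ} (hab : a < b) :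
    Tendsto (fun K => g (P K) (Φ K) (Set.Ico a b)) atTop (𝓝 0) := by
  have h1 : Tendsto (fun K => volume (Set.Ico a b) ^ 2 * g₂ (P K) (Φ K) (Set.Ico a b)) atTop
      (𝓝 0) := by
    simpa using ENNReal.Tendsto.const_mul (a := volume (Set.Ico a b) ^ 2) (h.g₂_tendsto a b hab)
      (Or.inr (by simp))
  have h2 := (h.g₁_tendsto a b hab).max h1
  rwa [max_self] at h2

end Array

/-! ### Comparison of the queues -/

section Comparison

lemma measure_mem_le_add {Ω α : Type*} [MeasurableSpace Ω] {P : Measure Ω} {X Y : Ω → α}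
    {e : ℝ≥0∞} (h : P {ω | X ω ≠ Y ω} ≤ e) (A : Set α) :
    P {ω | X ω ∈ A} ≤ P {ω | Y ω ∈ A} + e := by
  refine (measure_mono (t := {ω | Y ω ∈ A} ∪ {ω | X ω ≠ Y ω}) fun ω hω => ?_).trans
    ((measure_union_le _ _).trans (by gcongr))
  by_cases hz : X ω = Y ω
  · exact Or.inl (by rw [Set.mem_ofPred_eq, ← hz]; exact hω)
  · exact Or.inr hz

lemma measure_mem_le_of_tvLe {Ω Ω' α : Type*} [MeasurableSpace Ω] [MeasurableSpace Ω']
    [MeasurableSpace α] {P : Measure Ω} {P' : Measure Ω'} {X X' : Ω → α} {Y Y' : Ω' → α}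
    (hX' : Measurable X') (hY' : Measurable Y') {e e' δ : ℝ≥0∞}
    (hX : P {ω | X ω ≠ X' ω} ≤ e) (hY : P' {ω | Y ω ≠ Y' ω} ≤ e')
    (h : TVLe (P.map X') (P'.map Y') δ) {A : Set α} (hA : MeasurableSet A) :
    P {ω | X ω ∈ A} ≤ P' {ω | Y ω ∈ A} + (e + δ + e') := by
  have h1 := h A hA
  rw [Measure.map_apply hX' hA, Measure.map_apply hY' hA] at h1
  have h2 : P' {ω | Y' ω ∈ A} ≤ P' {ω | Y ω ∈ A} + e' :=
    measure_mem_le_add (by simpa only [ne_comm] using hY) A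
  calc P {ω | X ω ∈ A} ≤ P {ω | X' ω ∈ A} + e := measure_mem_le_add hX A
    _ ≤ P' {ω | Y' ω ∈ A} + δ + e := by gcongr; exact h1
    _ ≤ P' {ω | Y ω ∈ A} + e' + δ + e := by gcongr
    _ = _ := by ring

lemma ofReal_dTV_le {Ω Ω' : Type*} [MeasurableSpace Ω] [MeasurableSpace Ω'] {P : Measure Ω}
    {P' : Measure Ω'} [IsProbabilityMeasure P] [IsProbabilityMeasure P'] {X X' : Ω → ℕ∞}
    {Y Y' : Ω' → ℕ∞} (hX' : Measurable X') (hY' : Measurable Y') {e e' δ : ℝ≥0∞}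
    (hX : P {ω | X ω ≠ X' ω} ≤ e) (hY : P' {ω | Y ω ≠ Y' ω} ≤ e')
    (h : TVLe (P.map X') (P'.map Y') δ) : ENNReal.ofReal (dTV P P' X Y) ≤ e + δ + e' := by
  have := Measure.isProbabilityMeasure_map (μ := P) hX'.aemeasurable
  have := Measure.isProbabilityMeasure_map (μ := P') hY'.aemeasurable
  rcases eq_or_ne (e + δ + e') ∞ with htop | htop
  · rw [htop]; exact le_top
  refine ENNReal.ofReal_le_of_le_toReal (ciSup_le fun A => ?_)
  have hA : MeasurableSet A := MeasurableSet.of_discrete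
  have h1 := measure_mem_le_of_tvLe hX' hY' hX hY h hA
  have h2 := measure_mem_le_of_tvLe hY' hX' hY hX h.symm hA
  rw [show e' + δ + e = e + δ + e' by ring] at h2
  rw [← ENNReal.toReal_le_toReal (measure_ne_top _ _) (ENNReal.add_ne_top.2
    ⟨measure_ne_top _ _, htop⟩), ENNReal.toReal_add (measure_ne_top _ _) htop] at h1 h2
  rw [abs_sub_le_iff]
  simp only [measureReal_def]
  exact ⟨by linarith, by linarith⟩

variable {Ω : Type*} [MeasurableSpace Ω] {P : Measure Ω} [IsProbabilityMeasure P]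
  {Ψ : Ω → Measure ℝ} {S : ℤ → Ω → ℝ}

/-- The queue seen by job `i` is, up to a small probability, a function of the arrivals in the
window. -/
lemma measure_queueSeen_ne_le {h : ℝ≥0} {η : ℝ≥0∞} {β : ℝ} {i : ℤ} {l₀ L u : ℕ} {a b : ℝ}
    {e D : ℝ≥0∞} (hΨ : IsPointProcess Ψ) (hS : ∀ j, Measurable (S j))
    (hinf : ∀ᵐ ω ∂P, Ψ ω (Set.Iic 0) = ∞) (hh : 0 < h) (hη0 : η ≠ 0) (hη : η ≠ ∞) (hβ : 0 < β)
    (ha : a ≤ -((l₀ + L + u + 1 : ℕ) * h)) (hb : β < b)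
    (hQ : MeasurePreserving (dropSeq 1) (P.map (workSeq h Ψ S)) (P.map (workSeq h Ψ S)))
    (hgood : P {ω | (Ψ ω, fun j => S j ω) ∉ goodWindow h η β i l₀ L u} ≤ e)
    (hD : ∫⁻ x, idle h u x ∂(P.map (workSeq h Ψ S)) ≤
      ∫⁻ x, idleInf h x ∂(P.map (workSeq h Ψ S)) + D) (s : EReal) :
    P {ω | queueSeen Ψ S s i ω ≠ queueLength (arrivalTime (windowFill (Set.Ico a b) (Ψ ω)))
      (fun j => S j ω) (max s a) i} ≤ e + L * D / η := by
  have hwm : Measurable (workSeq h Ψ S) := measurable_workSeq h hΨ.measurable hS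
  have := Measure.isProbabilityMeasure_map (μ := P) hwm.aemeasurable
  have hgap := measure_idleGap_ge_le (l₀ := l₀) (L := L) hQ hD hη0 hη
  rw [Measure.map_apply hwm (measurableSet_le measurable_const measurable_idleGap)] at hgap
  refine le_trans (measure_mono_ae ?_) ((measure_union_le _ _).trans (add_le_add hgood hgap))
  filter_upwards [hinf] with ω hω hne
  by_contra hcon
  have hcon' := not_or.1 hcon
  exact hne (queueLength_eq_windowFill (hΨ.counting ω) hω hh hβ ha hb (not_not.1 hcon'.1)
    (not_le.1 hcon'.2) s)

variable {Ω' : Type*} [MeasurableSpace Ω'] {P' : Measure Ω'} [IsProbabilityMeasure P']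
  {Ψ' : Ω' → Measure ℝ} {S' : ℤ → Ω' → ℝ} {PS : Measure ℝ} [IsProbabilityMeasure PS]

/-- The services have the same law in both models and are independent of the arrivals, so they add a
common product factor at no cost. -/
lemma tvLe_restrict_services (hΨ : Measurable Ψ) (hΨ' : Measurable Ψ') (hS : IsServiceSeq P S PS)
    (hS' : IsServiceSeq P' S' PS) (hind : IndepFun Ψ (fun ω j => S j ω) P)
    (hind' : IndepFun Ψ' (fun ω j => S' j ω) P') {B : Set ℝ} (hB : MeasurableSet B) {δ : ℝ≥0∞}
    (h : TVLe (P.map fun ω => (Ψ ω).restrict B) (P'.map fun ω => (Ψ' ω).restrict B) δ) :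
    TVLe (P.map fun ω => ((Ψ ω).restrict B, fun j => S j ω))
      (P'.map fun ω => ((Ψ' ω).restrict B, fun j => S' j ω)) δ := by
  have hm := measurable_restrict_measure hB
  have h1 : IndepFun (fun ω => (Ψ ω).restrict B) (fun ω j => S j ω) P :=
    hind.comp hm measurable_id
  have h2 : IndepFun (fun ω => (Ψ' ω).restrict B) (fun ω j => S' j ω) P' :=
    hind'.comp hm measurable_id
  have hmΨ : Measurable fun ω => (Ψ ω).restrict B := hm.comp hΨ
  have hmΨ' : Measurable fun ω => (Ψ' ω).restrict B := hm.comp hΨ'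
  have := Measure.isProbabilityMeasure_map (μ := P) hmΨ.aemeasurable
  have := Measure.isProbabilityMeasure_map (μ := P') hmΨ'.aemeasurable
  rw [map_arrivals_services hmΨ hS h1, map_arrivals_services hmΨ' hS' h2]
  exact h.prod_right _

end Comparison

section Transfer

variable {Ω Ω' : Type*} [MeasurableSpace Ω] [MeasurableSpace Ω'] {P : Measure Ω} {P' : Measure Ω'}
  {Ψ : Ω → Measure ℝ} {Ψ' : Ω' → Measure ℝ}
  {S : ℤ → Ω → ℝ} {S' : ℤ → Ω' → ℝ} {PS : Measure ℝ}

lemma measurable_queueLength_windowFill (hΨ : Measurable Ψ) (hS : ∀ j, Measurable (S j))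
    (a b : ℝ) (s : EReal) (i : ℤ) : Measurable fun ω =>
      queueLength (arrivalTime (windowFill (Set.Ico a b) (Ψ ω))) (fun j => S j ω) s i :=
  measurable_queueLength (fun m => (measurable_arrivalTime m).comp
    ((measurable_windowFill measurableSet_Ico).comp hΨ)) hS s i

lemma tvLe_queueLength_windowFill (hΨ : Measurable Ψ) (hΨ' : Measurable Ψ')
    (hS : ∀ j, Measurable (S j)) (hS' : ∀ j, Measurable (S' j)) {a b : ℝ} {δ : ℝ≥0∞}
    (hTV : TVLe (P.map fun ω => ((Ψ ω).restrict (Set.Ico a b), fun j => S j ω))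
      (P'.map fun ω => ((Ψ' ω).restrict (Set.Ico a b), fun j => S' j ω)) δ) (s : EReal) (i : ℤ) :
    TVLe (P.map fun ω =>
        queueLength (arrivalTime (windowFill (Set.Ico a b) (Ψ ω))) (fun j => S j ω) s i)
      (P'.map fun ω =>
        queueLength (arrivalTime (windowFill (Set.Ico a b) (Ψ' ω))) (fun j => S' j ω) s i) δ := by
  have hr := measurable_restrict_measure (measurableSet_Ico (a := a) (b := b))
  have hm : Measurable fun ω => ((Ψ ω).restrict (Set.Ico a b), fun j => S j ω) :=
    (hr.comp hΨ).prodMk (measurable_pi_lambda _ hS)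
  have hm' : Measurable fun ω => ((Ψ' ω).restrict (Set.Ico a b), fun j => S' j ω) :=
    (hr.comp hΨ').prodMk (measurable_pi_lambda _ hS')
  have hG := measurable_queueLength_windowFill (Ψ := fun p : Measure ℝ × (ℤ → ℝ) => p.1)
    (S := fun j p => p.2 j) measurable_fst
    (fun j => (measurable_pi_apply j).comp measurable_snd) a b s i
  have hTVq := hTV.map hG
  rw [Measure.map_map hG hm, Measure.map_map hG hm'] at hTVq
  simpa only [Function.comp_def, windowFill_restrict] using hTVq

/-- Transfer of the window approximation from an input `Ψ'` to an input `Ψ` that is close to it in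
the window and brings almost the same work per slot. -/
lemma ofReal_dTV_queueSeen_le [IsProbabilityMeasure P] [IsProbabilityMeasure P']
    {h : ℝ≥0} {η : ℝ≥0∞} {β : ℝ} {i : ℤ} {l₀ L u : ℕ} {a b : ℝ}
    {e D δ : ℝ≥0∞} (hΨ : IsPointProcess Ψ) (hΨ' : IsPointProcess Ψ') (hS : IsServiceSeq P S PS)
    (hS' : IsServiceSeq P' S' PS)
    (hinf : ∀ᵐ ω ∂P, Ψ ω (Set.Iic 0) = ∞) (hinf' : ∀ᵐ ω ∂P', Ψ' ω (Set.Iic 0) = ∞)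
    (hh : 0 < h) (hη0 : η ≠ 0) (hη : η ≠ ∞) (hβ : 0 < β)
    (ha : a ≤ -((l₀ + L + u + 1 : ℕ) * h)) (hb : β < b)
    (hQ : MeasurePreserving (dropSeq 1) (P.map (workSeq h Ψ S)) (P.map (workSeq h Ψ S)))
    (hQ' : MeasurePreserving (dropSeq 1) (P'.map (workSeq h Ψ' S')) (P'.map (workSeq h Ψ' S')))
    (hgood' : P' {ω | (Ψ' ω, fun j => S' j ω) ∉ goodWindow h η β i l₀ L u} ≤ e)
    (hD' : ∫⁻ x, idle h u x ∂(P'.map (workSeq h Ψ' S')) ≤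
      ∫⁻ x, idleInf h x ∂(P'.map (workSeq h Ψ' S')) + D)
    (hmean' : ∫⁻ x, idleInf h x ∂(P'.map (workSeq h Ψ' S')) +
      ∫⁻ x, x 0 ∂(P'.map (workSeq h Ψ' S')) ≤ h)
    (hmean : ∫⁻ x, x 0 ∂(P.map (workSeq h Ψ S)) ≤ ∫⁻ x, x 0 ∂(P'.map (workSeq h Ψ' S')) + D)
    (hDfin : D ≠ ∞) (hDη : L * (3 * D) / η ≤ e) (hδe : δ ≤ e) (hδD : h * δ ≤ D)
    (hTV : TVLe (P.map fun ω => ((Ψ ω).restrict (Set.Ico a b), fun j => S j ω))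
      (P'.map fun ω => ((Ψ' ω).restrict (Set.Ico a b), fun j => S' j ω)) δ) (s : EReal) :
    ENNReal.ofReal (dTV P P' (queueSeen Ψ S s i) (queueSeen Ψ' S' s i)) ≤ 5 * e + δ := by
  have hSm : Measurable fun ω j => S j ω := measurable_pi_lambda _ hS.measurable
  have hSm' : Measurable fun ω j => S' j ω := measurable_pi_lambda _ hS'.measurable
  have hr := measurable_restrict_measure (measurableSet_Ico (a := a) (b := b))
  have hm : Measurable fun ω => ((Ψ ω).restrict (Set.Ico a b), fun j => S j ω) :=
    (hr.comp hΨ.measurable).prodMk hSm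
  have hm' : Measurable fun ω => ((Ψ' ω).restrict (Set.Ico a b), fun j => S' j ω) :=
    (hr.comp hΨ'.measurable).prodMk hSm'
  have hw : Measurable (workSeq h Ψ S) := measurable_workSeq h hΨ.measurable hS.measurable
  have hw' : Measurable (workSeq h Ψ' S') := measurable_workSeq h hΨ'.measurable hS'.measurable
  have := Measure.isProbabilityMeasure_map (μ := P) hw.aemeasurable
  have := Measure.isProbabilityMeasure_map (μ := P') hw'.aemeasurable
  -- the good event
  have hgood : P {ω | (Ψ ω, fun j => S j ω) ∉ goodWindow h η β i l₀ L u} ≤ 2 * e := by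
    have h1 := hTV _ (measurableSet_goodWindow (h := h) (η := η) (β := β) (i := i) (l₀ := l₀)
      (L := L) (u := u)).compl
    rw [Measure.map_apply hm measurableSet_goodWindow.compl,
      Measure.map_apply hm' measurableSet_goodWindow.compl] at h1
    simp only [Set.preimage, Set.mem_compl_iff, mem_goodWindow_restrict_iff ha hβ hb] at h1
    calc _ ≤ _ := h1
      _ ≤ e + e := add_le_add hgood' hδe
      _ = _ := (two_mul e).symm
  -- the mean idle times
  have hf : Measurable fun p : Measure ℝ × (ℤ → ℝ) =>
      idle h u (slotWork (slotCount h p.1) p.2) := by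
    have h1 : Measurable fun p : Measure ℝ × (ℤ → ℝ) => (slotCount h p.1, p.2) :=
      ((measurable_slotCount h).comp measurable_fst).prodMk measurable_snd
    exact (measurable_idle h u).comp (measurable_slotWork.comp h1)
  have hidle := hTV.lintegral_le hf (c := h) h.2 fun p => by
    rw [ENNReal.ofReal_coe_nnreal]; exact idle_le _ _ _
  rw [lintegral_map hf hm, lintegral_map hf hm', ENNReal.ofReal_coe_nnreal] at hidle
  simp only [idle_restrict ha (hβ.trans hb)] at hidle
  have hidle1 : ∫⁻ x, idle h u x ∂(P.map (workSeq h Ψ S)) ≤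
      ∫⁻ x, idle h u x ∂(P'.map (workSeq h Ψ' S')) + D := by
    rw [lintegral_map (measurable_idle h u) hw, lintegral_map (measurable_idle h u) hw']
    exact hidle.trans (add_le_add le_rfl hδD)
  have hm'fin : ∫⁻ x, x 0 ∂(P'.map (workSeq h Ψ' S')) ≠ ∞ :=
    ne_top_of_le_ne_top ENNReal.coe_ne_top (le_add_self.trans hmean')
  -- The central comparison: the upper bound on idleness for the limiting input meets the universal
  -- lower bound for `Ψ`, and the mean works differ by at most `D`.
  have hinfle : ∫⁻ x, idleInf h x ∂(P'.map (workSeq h Ψ' S')) ≤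
      ∫⁻ x, idleInf h x ∂(P.map (workSeq h Ψ S)) + D := by
    have h1 := le_lintegral_idleInf (h := h) hQ
      (ne_top_of_le_ne_top (ENNReal.add_ne_top.2 ⟨hm'fin, hDfin⟩) hmean)
    refine (ENNReal.add_le_add_iff_right hm'fin).1 (hmean'.trans (h1.trans ?_))
    calc _ ≤ (∫⁻ x, x 0 ∂(P'.map (workSeq h Ψ' S')) + D) +
          ∫⁻ x, idleInf h x ∂(P.map (workSeq h Ψ S)) := by gcongr
      _ = _ := by ring
  -- Three errors: replacing the input within the horizon, passing from horizon `u` to the two-sided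
  -- regime for `Ψ'`, and returning to `Ψ` by the mean balance.
  have hD : ∫⁻ x, idle h u x ∂(P.map (workSeq h Ψ S)) ≤
      ∫⁻ x, idleInf h x ∂(P.map (workSeq h Ψ S)) + 3 * D := by
    calc _ ≤ _ := hidle1
      _ ≤ ∫⁻ x, idleInf h x ∂(P.map (workSeq h Ψ S)) + D + D + D := by
          gcongr
          exact hD'.trans (by gcongr)
      _ = _ := by ring
  have hD'' : ∫⁻ x, idle h u x ∂(P'.map (workSeq h Ψ' S')) ≤
      ∫⁻ x, idleInf h x ∂(P'.map (workSeq h Ψ' S')) + 3 * D :=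
    hD'.trans (by gcongr; exact le_mul_of_one_le_left zero_le (by norm_num))
  -- the queues as functions of the window
  exact (ofReal_dTV_le (measurable_queueLength_windowFill hΨ.measurable hS.measurable a b _ i)
    (measurable_queueLength_windowFill hΨ'.measurable hS'.measurable a b _ i)
    (measure_queueSeen_ne_le hΨ hS.measurable hinf hh hη0 hη hβ ha hb hQ hgood hD s)
    (measure_queueSeen_ne_le hΨ' hS'.measurable hinf' hh hη0 hη hβ ha hb hQ' hgood' hD'' s)
    (tvLe_queueLength_windowFill hΨ.measurable hΨ'.measurable hS.measurable hS'.measurable hTV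
      (max s a) i)).trans (calc
    2 * e + L * (3 * D) / η + δ + (e + L * (3 * D) / η) ≤ 2 * e + e + δ + (e + e) := by gcongr
    _ = 5 * e + δ := by ring)

end Transfer

/-- A window for the Poisson input, with the error terms that the transfer needs. -/
lemma IsPoisson.exists_window {Ω : Type*} [MeasurableSpace Ω] {P : Measure Ω}
    [IsProbabilityMeasure P] {Φ : Ω → Measure ℝ} {S : ℤ → Ω → ℝ} {lam : ℝ} {PS : Measure ℝ}
    [IsProbabilityMeasure PS] (hΦ : IsPoisson P Φ lam) (hlam : 0 < lam)
    (hS : IsServiceSeq P S PS) (hind : IndepFun Φ (fun ω j => S j ω) P)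
    (hρ : ENNReal.ofReal lam * ∫⁻ x, ENNReal.ofReal x ∂PS < 1) (i : ℤ) {e : ℝ≥0∞} (he : e ≠ 0)
    (he' : e ≠ ∞) :
    ∃ (h : ℝ≥0) (η : ℝ≥0∞) (β : ℝ) (l₀ L u : ℕ) (D : ℝ≥0∞), 0 < h ∧ η ≠ 0 ∧ η ≠ ∞ ∧ 0 < β ∧
      D ≠ 0 ∧ D ≠ ∞ ∧ L * (3 * D) / η ≤ e ∧
      P {ω | (Φ ω, fun j => S j ω) ∉ goodWindow h η β i l₀ L u} ≤ e ∧
      ∫⁻ x, idle h u x ∂(P.map (workSeq h Φ S)) ≤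
        ∫⁻ x, idleInf h x ∂(P.map (workSeq h Φ S)) + D ∧
      ∫⁻ x, idleInf h x ∂(P.map (workSeq h Φ S)) + ∫⁻ x, x 0 ∂(P.map (workSeq h Φ S)) ≤ h ∧
      MeasurePreserving (dropSeq 1) (P.map (workSeq h Φ S)) (P.map (workSeq h Φ S)) ∧
      ∫⁻ x, x 0 ∂(P.map (workSeq h Φ S)) =
        ENNReal.ofReal lam * h * ∫⁻ x, ENNReal.ofReal x ∂PS := by
  obtain ⟨h, η, β, l₀, L, hh, hη0, hη, hβ, hgood⟩ :=
    hΦ.exists_goodWindow hlam hS hind hρ i he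
  have hES : ∫⁻ x, ENNReal.ofReal x ∂PS ≠ ∞ := by
    intro h
    rw [h, ENNReal.mul_top (by simpa using hlam)] at hρ
    simp at hρ
  have hw : Measurable (workSeq h Φ S) :=
    measurable_workSeq h hΦ.pointProcess.measurable hS.measurable
  have := Measure.isProbabilityMeasure_map (μ := P) hw.aemeasurable
  have hQ := measurePreserving_workSeq h hΦ.pointProcess.measurable hS hind
    (hΦ.measurePreserving_slotCount hlam.le h)
  have hmean : ∫⁻ x, x 0 ∂(P.map (workSeq h Φ S)) =
      ENNReal.ofReal lam * h * ∫⁻ x, ENNReal.ofReal x ∂PS := by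
    rw [lintegral_workSeq_zero h hΦ.pointProcess hS hind,
      hΦ.lintegral_apply hlam.le measurableSet_Ioc (Metric.isBounded_Ioc _ _), Real.volume_Ioc,
      zero_sub, neg_neg, ENNReal.ofReal_coe_nnreal]
  have hh' : (h : ℝ≥0∞) ≠ 0 := by exact_mod_cast hh.ne'
  have hlt : ∫⁻ x, x 0 ∂(P.map (workSeq h Φ S)) < h := by
    rw [hmean, mul_right_comm]
    calc _ < 1 * (h : ℝ≥0∞) := ENNReal.mul_lt_mul_left hh' ENNReal.coe_ne_top hρ
      _ = h := one_mul _
  have hlln : ∀ᵐ x ∂(P.map (workSeq h Φ S)), Tendsto (fun n : ℕ => cumWork x n / n) atTop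
      (𝓝 (∫⁻ x, x 0 ∂(P.map (workSeq h Φ S)))) := by
    have hms : MeasurableSet {x : ℕ → ℝ≥0∞ | Tendsto (fun n : ℕ => cumWork x n / n) atTop
        (𝓝 (∫⁻ x, x 0 ∂(P.map (workSeq h Φ S))))} :=
      measurableSet_tendsto _ fun n => (measurable_cumWork n).div_const _
    rw [ae_map_iff hw.aemeasurable hms, hmean]
    have h1 := hΦ.ae_tendsto_cumWork hlam hS hES hh
    rwa [ENNReal.ofReal_mul hlam.le, ENNReal.ofReal_coe_nnreal] at h1
  -- Chosen so that Markov's bound with mean gap `3 * D` in each of `L` slots is at most `e`; the `+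
  -- 1` keeps the denominator nonzero.
  set D : ℝ≥0∞ := e * η / (3 * L + 1) with hDdef
  have hD0 : D ≠ 0 := (ENNReal.div_pos (mul_ne_zero he hη0)
    (ENNReal.add_ne_top.2 ⟨ENNReal.mul_ne_top (by simp) (by simp), by simp⟩)).ne'
  have hDt : D ≠ ∞ := ENNReal.div_ne_top (ENNReal.mul_ne_top he' hη) (by simp)
  have hDη : L * (3 * D) / η ≤ e := by
    refine ENNReal.div_le_of_le_mul ?_
    calc L * (3 * D) = 3 * L * D := by ring
      _ ≤ (3 * L + 1) * D := by gcongr; exact le_self_add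
      _ ≤ e * η := ENNReal.mul_div_le
  have hi : ∫⁻ x, idleInf h x ∂(P.map (workSeq h Φ S)) ≠ ∞ :=
    ne_top_of_le_ne_top ENNReal.coe_ne_top (lintegral_idleInf_le h)
  -- The horizon is chosen last, depending on `D`; this is legitimate because the bound on the good
  -- event holds for every `u`.
  obtain ⟨u, hu⟩ := ((tendsto_lintegral_idle (Q := P.map (workSeq h Φ S)) h).eventually_lt_const
    (ENNReal.lt_add_right hi hD0)).exists
  exact ⟨h, η, β, l₀, L, u, D, hh, hη0, hη, hβ, hD0, hDt, hDη, hgood u, hu.le,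
    lintegral_idleInf_add_le hQ hlt hlln, hQ, hmean⟩

/-! ### Comparison along the array -/

section Main

variable {Ω : ℕ → Type*} [∀ K, MeasurableSpace (Ω K)] {P : ∀ K, Measure (Ω K)}
  [∀ K, IsProbabilityMeasure (P K)] {Ω' : Type*} [MeasurableSpace Ω'] {P' : Measure Ω'}
  [IsProbabilityMeasure P'] {F : ℕ → Measure ℝ} {PS : Measure ℝ} [IsProbabilityMeasure PS]
  {lam : ℝ} {Φ : ∀ K, Fin K → Ω K → Measure ℝ} {S : ∀ K, ℤ → Ω K → ℝ} {Φ' : Ω' → Measure ℝ}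
  {S' : ℤ → Ω' → ℝ}

lemma IndepFun.superposition_left {Ω β : Type*} [MeasurableSpace Ω] [MeasurableSpace β]
    {P : Measure Ω} {K : ℕ} {Φ : Fin K → Ω → Measure ℝ} {T : Ω → β}
    (h : IndepFun (fun ω k => Φ k ω) T P) : IndepFun (superposition Φ) T P := by
  have hsum : Measurable fun v : Fin K → Measure ℝ => ∑ k, v k := by
    refine Measure.measurable_of_measurable_coe _ fun s hs => ?_
    simp only [Measure.coe_finsetSum, Finset.sum_apply]
    exact Finset.measurable_sum _ fun k _ =>
      (Measure.measurable_coe hs).comp (measurable_pi_apply k)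
  exact h.comp hsum measurable_id

/-- The comparison of the queues for large `K`, uniformly in the starting time. -/
theorem exists_eventually_ofReal_dTV_le
    (hΦ : ∀ K k, IsStationaryRenewal (P K) (Φ K k) (F K))
    (hΦ_indep : ∀ K, iIndepFun (Φ K) (P K)) (hS : ∀ K, IsServiceSeq (P K) (S K) PS)
    (hΦS : ∀ K, IndepFun (fun ω k => Φ K k ω) (fun ω i => S K i ω) (P K))
    (hlam : 0 < lam) (hΦ' : IsPoisson P' Φ' lam) (hS' : IsServiceSeq P' S' PS)
    (hΦS' : IndepFun Φ' (fun ω i => S' i ω) P')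
    (hρ : ENNReal.ofReal lam * ∫⁻ x, ENNReal.ofReal x ∂PS < 1) (hsparse : IsSparse P Φ)
    {a₀ b₀ : ℝ} (hab₀ : a₀ < b₀)
    (hrate : Tendsto (fun K => sumRate (P K) (Φ K) (Set.Ico a₀ b₀)) atTop
      (𝓝 (ENNReal.ofReal lam))) (i : ℤ) {e : ℝ≥0∞} (he : e ≠ 0) (he' : e ≠ ∞) :
    ∃ a b : ℝ, a < b ∧ ∀ᶠ K in atTop, ∀ s : EReal,
      ENNReal.ofReal (dTV (P K) P' (queueSeen (superposition (Φ K)) (S K) s i)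
        (queueSeen Φ' S' s i)) ≤
        6 * e + ((4 * (lam.toNNReal + 1) + 6 : ℝ≥0) : ℝ≥0∞) * g (P K) (Φ K) (Set.Ico a b) := by
  have hpp : ∀ K k, IsPointProcess (Φ K k) := fun K k => IsStationaryRenewal.pointProcess (hΦ K k)
  obtain ⟨ℓ, hℓ, hℓlim⟩ := exists_intensity_tendsto hpp (fun K k => (hΦ K k).stationary) hΦ_indep
    hab₀ (hsparse.g₁_tendsto a₀ b₀ hab₀) hrate
  obtain ⟨h, η, β, l₀, L, u, D, hh, hη0, hη, hβ, hD0, hDt, hDη, hgood, hidle, hmean, hQ, hm⟩ :=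
    hΦ'.exists_window hlam hS' hΦS' hρ i he he'
  have hES : ∫⁻ x, ENNReal.ofReal x ∂PS ≠ ∞ := by
    intro h
    rw [h, ENNReal.mul_top (by simpa using hlam)] at hρ
    simp at hρ
  -- The window is fixed by the Poisson input alone; it depends neither on `K` nor on `s`.
  set a : ℝ := -((l₀ + L + u + 1 : ℕ) * h) with ha
  set b : ℝ := β + 1 with hb
  have ha0 : a ≤ 0 := by
    rw [ha, Left.neg_nonpos_iff]
    positivity
  have hab : a < b := by linarith
  set C : ℝ≥0 := 4 * (lam.toNNReal + 1) + 6 with hC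
  set B := Set.Ico a b with hB
  have hv : volume B ≠ 0 := by simpa [hB] using hab
  have hvt : volume B ≠ ∞ := by simp [hB]
  have hedist : Tendsto (fun K => edist (ℓ K : ℝ≥0) lam.toNNReal * volume B) atTop (𝓝 0) := by
    have h1 := tendsto_iff_edist_tendsto_0.1 hℓlim
    simpa using ENNReal.Tendsto.mul_const h1 (Or.inr hvt)
  have hCg : Tendsto (fun K => (C : ℝ≥0∞) * g (P K) (Φ K) B) atTop (𝓝 0) := by
    simpa using ENNReal.Tendsto.const_mul (a := (C : ℝ≥0∞)) (hsparse.g_tendsto hab)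
      (Or.inr ENNReal.coe_ne_top)
  have hδ : Tendsto (fun K => (C : ℝ≥0∞) * g (P K) (Φ K) B +
      edist (ℓ K : ℝ≥0) lam.toNNReal * volume B) atTop (𝓝 0) := by
    simpa using hCg.add hedist
  have hhδ : Tendsto (fun K => (h : ℝ≥0∞) * (C * g (P K) (Φ K) B +
      edist (ℓ K : ℝ≥0) lam.toNNReal * volume B)) atTop (𝓝 0) := by
    simpa using ENNReal.Tendsto.const_mul (a := (h : ℝ≥0∞)) hδ (Or.inr ENNReal.coe_ne_top)
  have hwork : Tendsto (fun K => (ℓ K : ℝ≥0∞) * h * ∫⁻ x, ENNReal.ofReal x ∂PS) atTop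
      (𝓝 (ENNReal.ofReal lam * h * ∫⁻ x, ENNReal.ofReal x ∂PS)) :=
    ENNReal.Tendsto.mul_const (ENNReal.Tendsto.mul_const (ENNReal.tendsto_coe.2 hℓlim)
      (Or.inr ENNReal.coe_ne_top)) (Or.inr hES)
  have hworkfin : ENNReal.ofReal lam * h * ∫⁻ x, ENNReal.ofReal x ∂PS ≠ ∞ :=
    ENNReal.mul_ne_top (ENNReal.mul_ne_top ENNReal.ofReal_ne_top ENNReal.coe_ne_top) hES
  refine ⟨a, b, hab, ?_⟩
  -- Eventually the intensity is below `lam + 1`, so the factor of `g` can be a constant independent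
  -- of `i` and `e`; the other smallness conditions are those of the transfer.
  filter_upwards [hℓ, (hsparse.g₁_tendsto a b hab).eventually_lt_const zero_lt_one,
    hℓlim.eventually_lt_const (lt_add_one _), hedist.eventually_lt_const (pos_iff_ne_zero.2 he),
    hδ.eventually_lt_const (pos_iff_ne_zero.2 he), hhδ.eventually_lt_const (pos_iff_ne_zero.2 hD0),
    hwork.eventually_lt_const (ENNReal.lt_add_right hworkfin hD0), eventually_gt_atTop 0]
    with K hℓK hg₁ hℓ1 hed hδe hδD hwK hK s
  have hΨ := isPointProcess_superposition (hpp K)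
  have hind : IndepFun (superposition (Φ K)) (fun ω i => S K i ω) (P K) :=
    IndepFun.superposition_left (hΦS K)
  have hinf : ∀ᵐ ω ∂(P K), superposition (Φ K) ω (Set.Iic 0) = ∞ := by
    filter_upwards [(hΦ K ⟨0, hK⟩).infinite_points] with ω hω
    rw [superposition, Measure.coe_finsetSum, Finset.sum_apply, ENNReal.sum_eq_top]
    exact ⟨⟨0, hK⟩, Finset.mem_univ _, hω.1⟩
  have hQK := measurePreserving_workSeq h hΨ.measurable (hS K) hind
    ((isStationary_superposition (fun k => (hpp K k).measurable)
      (fun k => (hΦ K k).stationary) (hΦ_indep K)).measurePreserving_slotCount hΨ.measurable h)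
  have hmK : ∫⁻ x, x 0 ∂((P K).map (workSeq h (superposition (Φ K)) (S K))) =
      ℓ K * h * ∫⁻ x, ENNReal.ofReal x ∂PS := by
    rw [lintegral_workSeq_zero h hΨ (hS K) hind, hℓK _ measurableSet_Ioc, Real.volume_Ioc,
      zero_sub, neg_neg, ENNReal.ofReal_coe_nnreal]
  have hTV : TVLe ((P K).map fun ω => (superposition (Φ K) ω).restrict B)
      (P'.map fun ω => (Φ' ω).restrict B)
      (C * g (P K) (Φ K) B + edist (ℓ K : ℝ≥0) lam.toNNReal * volume B) := by
    refine (tvLe_restrict_superposition (hpp K) (hΦ_indep K) hlam.le hΦ' hℓK measurableSet_Ico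
      (Metric.isBounded_Ico a b)).mono ?_
    gcongr
    refine (sum_error_le (hpp K) measurableSet_Ico (Metric.isBounded_Ico a b) hv
      (hℓK _ measurableSet_Ico).le hg₁.le).trans ?_
    gcongr
    rw [hC]
    push_cast
    gcongr
    exact_mod_cast hℓ1.le
  refine (ofReal_dTV_queueSeen_le hΨ hΦ'.pointProcess (hS K) hS' hinf (hΦ'.ae_Iic_eq_top hlam) hh
    hη0 hη hβ ha.le (lt_add_one β) hQK hQ hgood hidle hmean (by rw [hmK, hm]; exact hwK.le) hDt hDη
    hδe.le hδD.le (tvLe_restrict_services hΨ.measurable hΦ'.pointProcess.measurable (hS K) hS' hind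
      hΦS' measurableSet_Ico hTV) s).trans ?_
  -- The sixth `e` absorbs the discrepancy of the intensities.
  calc 5 * e + (C * g (P K) (Φ K) B + edist (ℓ K : ℝ≥0) lam.toNNReal * volume B)
      ≤ 5 * e + (C * g (P K) (Φ K) B + e) := by gcongr
    _ = 6 * e + C * g (P K) (Φ K) B := by ring

end Main

end QueueTV

end

theorem mainTheorem9
    -- row `K` of the triangular array lives on the probability space `(Ω K, P K)`
    {Ω : ℕ → Type*} [∀ K, MeasurableSpace (Ω K)] (P : ∀ K, Measure (Ω K))
    [∀ K, IsProbabilityMeasure (P K)]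
    {Ω' : Type*} [MeasurableSpace Ω'] (P' : Measure Ω') [IsProbabilityMeasure P']
    (F : ℕ → Measure ℝ) (PS : Measure ℝ) [IsProbabilityMeasure PS] (lam : ℝ)
    (Φ : ∀ K, Fin K → Ω K → Measure ℝ) (S : ∀ K, ℤ → Ω K → ℝ)
    (Φ' : Ω' → Measure ℝ) (S' : ℤ → Ω' → ℝ)
    -- the users of row `K`: i.i.d. stationary renewal processes
    (hΦ : ∀ K k, QueueTV.IsStationaryRenewal (P K) (Φ K k) (F K))
    (hΦ_indep : ∀ K, iIndepFun (Φ K) (P K))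
    -- i.i.d. service times, independent of the arrivals
    (hS : ∀ K, QueueTV.IsServiceSeq (P K) (S K) PS)
    (hΦS : ∀ K, IndepFun (fun ω k => Φ K k ω) (fun ω i => S K i ω) (P K))
    (hPS : PS (Set.Iic 0) = 0)
    -- the Poisson input
    (hlam : 0 < lam)
    (hΦ' : QueueTV.IsPoisson P' Φ' lam)
    (hS' : QueueTV.IsServiceSeq P' S' PS)
    (hΦS' : IndepFun Φ' (fun ω i => S' i ω) P')
    -- stability: the traffic intensity is less than one
    (hρ : ENNReal.ofReal lam * ∫⁻ x, ENNReal.ofReal x ∂PS < 1)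
    -- sparsity, with Poisson sum rate `lam`
    (hsparse : QueueTV.IsSparse P Φ)
    (a₀ b₀ : ℝ) (hab₀ : a₀ < b₀)
    (hrate : Tendsto (fun K => QueueTV.sumRate (P K) (Φ K) (Set.Ico a₀ b₀)) atTop
      (𝓝 (ENNReal.ofReal lam))) :
    (∃ C : ℝ≥0, ∀ (i : ℤ) (ε : ℝ), 0 < ε → ∃ (K₀ : ℕ) (a b : ℝ), a < b ∧
      ∀ K, K₀ ≤ K → ∀ s : EReal, s ≤ 0 →
        ENNReal.ofReal (QueueTV.dTV (P K) P'
            (QueueTV.queueSeen (QueueTV.superposition (Φ K)) (S K) s i)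
            (QueueTV.queueSeen Φ' S' s i))
          ≤ ENNReal.ofReal (2 * ε) + C * QueueTV.g (P K) (Φ K) (Set.Ico a b)) ∧
    (∀ (i : ℤ) (s : EReal), s ≤ 0 →
      Tendsto (fun K => QueueTV.dTV (P K) P'
          (QueueTV.queueSeen (QueueTV.superposition (Φ K)) (S K) s i)
          (QueueTV.queueSeen Φ' S' s i)) atTop (𝓝 0)) := by
  have key := fun (i : ℤ) (ε : ℝ) (hε : 0 < ε) =>
    QueueTV.exists_eventually_ofReal_dTV_le hΦ hΦ_indep hS hΦS hlam hΦ' hS' hΦS' hρ hsparse hab₀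
      -- The comparison costs `6 * e`, which is to equal `2 * ε`.
      hrate i (e := ENNReal.ofReal (ε / 3)) (by simpa using hε) ENNReal.ofReal_ne_top
  have hε6 : ∀ ε : ℝ, 6 * ENNReal.ofReal (ε / 3) = ENNReal.ofReal (2 * ε) := fun ε => by
    rw [← ENNReal.ofReal_ofNat 6, ← ENNReal.ofReal_mul (by norm_num)]
    congr 1
    ring
  refine ⟨⟨4 * (lam.toNNReal + 1) + 6, fun i ε hε => ?_⟩, fun i s _ => ?_⟩
  · obtain ⟨a, b, hab, hev⟩ := key i ε hε
    obtain ⟨K₀, hK₀⟩ := eventually_atTop.1 hev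
    refine ⟨K₀, a, b, hab, fun K hK s _ => ?_⟩
    rw [← hε6]
    exact hK₀ K hK s
  · have h0 : ∀ K, 0 ≤ QueueTV.dTV (P K) P'
        (QueueTV.queueSeen (QueueTV.superposition (Φ K)) (S K) s i)
        (QueueTV.queueSeen Φ' S' s i) := fun K => Real.iSup_nonneg fun A => abs_nonneg _
    rw [Metric.tendsto_nhds]
    intro ε hε
    -- Half of `ε` is spent on the window error; the other half bounds the multiple of `g`, which
    -- vanishes on the window now fixed.
    obtain ⟨a, b, hab, hev⟩ := key i (ε / 4) (by positivity)
    have hg := ENNReal.Tendsto.const_mul (a := ((4 * (lam.toNNReal + 1) + 6 : ℝ≥0) : ℝ≥0∞))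
      (hsparse.g_tendsto hab) (Or.inr ENNReal.coe_ne_top)
    rw [mul_zero] at hg
    have hpos : 0 < ENNReal.ofReal (ε / 2) := by simpa using hε
    filter_upwards [hev, hg.eventually_lt_const hpos] with K hK hgK
    rw [Real.dist_0_eq_abs, abs_of_nonneg (h0 K), ← ENNReal.ofReal_lt_ofReal_iff hε]
    refine (hK s).trans_lt ?_
    rw [hε6]
    calc _ < ENNReal.ofReal (2 * (ε / 4)) + ENNReal.ofReal (ε / 2) :=
          ENNReal.add_lt_add_left ENNReal.ofReal_ne_top hgK
      _ = ENNReal.ofReal ε := by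
          rw [← ENNReal.ofReal_add (by positivity) (by positivity)]
          congr 1
          ring
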